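/- Let $\zeta$ be the Riemann zeta function and $\gamma$ the Euler–Mascheroni constant. For real $b$ with $1/2\le b<1$ and $t>0$, let $\arg\zeta(b+it)$ denote the value obtained by continuous variation of the argument of $\zeta$ along the straight line segments joining $2$, $2+it$, $b+it$, starting from the value $0$ at the point $2$ (this is defined for all $t>0$ except the countably many for which $\zeta$ has a zero on the path). (i) For every real $b$ with $1/2\le b<1$ the integral below converges absolutely, and the equality $$\int_0^\infty \frac{t\,\arg\zeta(b+it)}{\left((1-b)^2+t^2\right)^2}\,dt=\frac{\pi}{4(1-b)}\left(\gamma-\frac{3}{2(1-b)}\right)$$ holds if and only if $\zeta$ has no zero with real part $>b$. (ii) For $b=1/2$ the equality in (i) is equivalent to the Riemann hypothesis. Likewise Volchkov's equality $$\frac1\pi\int_0^\infty \frac{2t\,\arg\zeta(1/2+it)}{\left(1/4+t^2\right)^2}\,dt=\gamma-3$$ (which is the case $b=1/2$ of the equality in (i)) is equivalent to the Riemann hypothesis. -/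

import Mathlib

open MeasureTheory Set

/-- The broken line that joins `2`, `2 + it` and `b + it` by straight segments. -/
def zetaArgPath (b t : ℝ) : Set ℂ :=
  segment ℝ (2 : ℂ) (2 + t * Complex.I) ∪ segment ℝ (2 + t * Complex.I) (b + t * Complex.I)

/-- `θ` is a continuous branch of the argument of `ζ` along the broken line `2, 2 + it, b + it`,
starting from the value `0` at the point `2`. -/
def IsZetaArgBranch (b t : ℝ) (θ : ℂ → ℝ) : Prop :=
  ContinuousOn θ (zetaArgPath b t) ∧ θ 2 = 0 ∧
    ∀ z ∈ zetaArgPath b t, riemannZeta z = ‖riemannZeta z‖ * Complex.exp (θ z * Complex.I)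

/-- `ζ` has no zero on the broken line and a continuous branch of its argument exists there
(for `t > 0` the second part follows from the first). -/
def HasZetaArg (b t : ℝ) : Prop :=
  (∀ z ∈ zetaArgPath b t, riemannZeta z ≠ 0) ∧ ∃ θ : ℂ → ℝ, IsZetaArgBranch b t θ

open Classical in
/-- `arg ζ(b + it)`, obtained by continuous variation along the straight lines joining `2`,
`2 + it`, `b + it`, starting from the value `0`. If the broken line meets a zero of `ζ`, which for
given `b` happens only for countably many `t > 0`, the value is `0` by convention. -/
noncomputable def zetaArg (b t : ℝ) : ℝ :=
  if h : HasZetaArg b t then h.2.choose (b + t * Complex.I) else 0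

/-- The value does not depend on the branch that is chosen. -/
theorem zetaArg_eq {b t : ℝ} (hz : ∀ z ∈ zetaArgPath b t, riemannZeta z ≠ 0) {θ : ℂ → ℝ}
    (hθ : IsZetaArgBranch b t θ) : zetaArg b t = θ (b + t * Complex.I) := by
  have h : HasZetaArg b t := ⟨hz, θ, hθ⟩
  have hdef : zetaArg b t = h.2.choose (b + t * Complex.I) := by
    unfold zetaArg
    rw [dif_pos h]
  rw [hdef]
  obtain ⟨hc, h0, he⟩ := h.2.choose_spec
  generalize h.2.choose = φ at hc h0 he
  obtain ⟨kc, k0, ke⟩ := hθ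
  have hcon : IsPreconnected (zetaArgPath b t) :=
    IsPreconnected.union (2 + t * Complex.I) (right_mem_segment ℝ _ _) (left_mem_segment ℝ _ _)
      (convex_segment _ _).isPreconnected (convex_segment _ _).isPreconnected
  have hint : ∀ z ∈ zetaArgPath b t, ∃ n : ℤ, (φ z - θ z) / (2 * Real.pi) = n := by
    intro z hzm
    have hn : (‖riemannZeta z‖ : ℂ) ≠ 0 := by simpa using hz z hzm
    have h1 := (he z hzm).symm.trans (ke z hzm)
    obtain ⟨n, hn⟩ := Complex.exp_eq_exp_iff_exists_int.1 (mul_left_cancel₀ hn h1)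
    refine ⟨n, ?_⟩
    have h2 : φ z = θ z + n * (2 * Real.pi) := by
      have := congrArg Complex.im hn
      simpa using this
    rw [h2]
    field_simp
    ring
  have hcont : ContinuousOn (fun z => (φ z - θ z) / (2 * Real.pi)) (zetaArgPath b t) :=
    (hc.sub kc).div_const _
  have hround : ContinuousOn (fun z => round ((φ z - θ z) / (2 * Real.pi))) (zetaArgPath b t) := by
    rw [Int.isClosedEmbedding_coe_real.isInducing.continuousOn_iff]
    refine hcont.congr fun z hzm => ?_
    obtain ⟨n, hn⟩ := hint z hzm
    simp [hn]
  have m2 : (2 : ℂ) ∈ zetaArgPath b t := Or.inl (left_mem_segment ℝ _ _)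
  have mb : (b + t * Complex.I : ℂ) ∈ zetaArgPath b t := Or.inr (right_mem_segment ℝ _ _)
  have hconst := hcon.constant hround mb m2
  obtain ⟨n, hn⟩ := hint _ mb
  simp only [hn, h0, k0, round_intCast, sub_zero, zero_div, round_zero] at hconst
  rw [hconst] at hn
  have hpi := Real.pi_pos
  have h3 : φ (b + t * Complex.I) - θ (b + t * Complex.I) = 0 := by
    simpa using hn
  linarith

/-! Put a = 1 - b, w = s - b and f(w) = (s - 1)ζ(s) (`shiftedZeta`). This is entire, with f(a) = 1
and f'(a) = γ, so log f(w) - γ(w - a) vanishes to second order at a and cancels the double pole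
there of the kernel w/(w² - a²)². The product (`rectTerm`) is integrated around the square [0, T] ×
[0, T], where T is not the height of a zero.

The bottom side is real. On the left side w = iy the kernel is purely imaginary and arg f(iy) = arg
ζ(b + iy) + π - arctan(y/a), so that side contributes to the imaginary part the truncated integral
of the theorem plus two elementary integrals, with limits 3π/(8a²) and -γπ/(4a)
(`tendsto_truncatedIntegral`). The top and right sides are O(1/T): the kernel is O(T⁻³), while the
argument and the mean of |log|f|| on the relevant segments are O(T), by Jensen's inequality and
Borel–Carathéodory (`exists_horizontal_bounds`). The claimed equality therefore says that the
imaginary part of the whole boundary integral tends to 0 (`exists_truncatedIntegral_approx`,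
`limit_eq_zero_iff`).

That imaginary part is a sum over the zeros ρ = u + iv of f in the square. With the logarithm cut
along the half line to the left of ρ, the jump 2πi times the integral of the kernel along the cut
gives a positive multiple of u²(3v² + u² - a²) (`logTerm_rectIntegral`, `zero_excess`). The last
factor is positive because zeros with real part at least 1/2 keep distance 3/5 from 1
(`le_norm_sub_one_of_riemannZeta₁_eq_zero`). No cancellation is possible, so the limit is 0 exactly
when no zero lies to the right of b. Splitting off the finitely many zeros in a disc is enough to
build the logarithm (`exists_log_rect`); no infinite product enters. For b = 1/2 the functional
equation translates the condition into the Riemann hypothesis (`riemannHypothesis_iff`). -/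

/-! ### ζ in the half plane Re s > 0 and its zeros near 1 -/

/-- The analytic continuation to `0 < re s` of `(ζ(s) - s / (s - 1)) / (-s)`. -/
noncomputable def fractMellin (s : ℂ) : ℂ :=
  ∫ x in Ioi (1 : ℝ), ((Int.fract x : ℝ) : ℂ) * (x : ℂ) ^ (-(s + 1))

theorem fractMellin_eq_mellin (s : ℂ) :
    fractMellin s = mellin ((Ioi (1 : ℝ)).indicator fun x => ((Int.fract x : ℝ) : ℂ)) (-s) := by
  have h : ∀ x : ℝ, (x : ℂ) ^ (-s - 1) • (Ioi (1 : ℝ)).indicator (fun x => ((Int.fract x : ℝ) : ℂ)) x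
      = (Ioi (1 : ℝ)).indicator (fun x => ((Int.fract x : ℝ) : ℂ) * (x : ℂ) ^ (-(s + 1))) x := by
    intro x
    by_cases hx : x ∈ Ioi (1 : ℝ)
    · rw [indicator_of_mem hx, indicator_of_mem hx, smul_eq_mul, mul_comm]
      ring_nf
    · rw [indicator_of_notMem hx, indicator_of_notMem hx, smul_zero]
  rw [fractMellin, mellin, setIntegral_congr_fun measurableSet_Ioi fun x _ => h x,
    setIntegral_indicator measurableSet_Ioi]
  congr 2
  rw [inter_eq_right.2 (Ioi_subset_Ioi zero_le_one)]

theorem measurable_fract_complex : Measurable fun x : ℝ => ((Int.fract x : ℝ) : ℂ) :=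
  Complex.measurable_ofReal.comp measurable_fract

theorem norm_fract_complex_le (x : ℝ) : ‖((Int.fract x : ℝ) : ℂ)‖ ≤ 1 := by
  rw [Complex.norm_real, Real.norm_eq_abs, abs_of_nonneg (Int.fract_nonneg x)]
  exact (Int.fract_lt_one x).le

theorem differentiableAt_fractMellin {s : ℂ} (hs : 0 < s.re) :
    DifferentiableAt ℂ fractMellin s := by
  have h : fractMellin = fun s => mellin ((Ioi (1 : ℝ)).indicator fun x => ((Int.fract x : ℝ) : ℂ)) (-s) :=
    funext fractMellin_eq_mellin
  rw [h]
  have hb : ∀ x : ℝ, ‖(Ioi (1 : ℝ)).indicator (fun x => ((Int.fract x : ℝ) : ℂ)) x‖ ≤ 1 := fun x =>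
    (norm_indicator_le_norm_self _ _).trans (norm_fract_complex_le x)
  have hm : DifferentiableAt ℂ (mellin ((Ioi (1 : ℝ)).indicator fun x => ((Int.fract x : ℝ) : ℂ))) (-s) := by
    -- The function is bounded, whence exponent 0 at infinity. It vanishes near 0, so any exponent
    -- below Re(-s) serves there.
    refine mellin_differentiableAt_of_isBigO_rpow (a := 0) (b := -s.re - 1) ?_ ?_ ?_ ?_ ?_
    · refine LocallyIntegrable.locallyIntegrableOn ?_ _
      refine (locallyIntegrable_const (1 : ℝ)).mono
        (measurable_fract_complex.indicator measurableSet_Ioi).aestronglyMeasurable ?_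
      exact Filter.Eventually.of_forall fun x => by simpa using hb x
    · refine Asymptotics.IsBigO.of_bound 1 (Filter.Eventually.of_forall fun x => ?_)
      simpa using hb x
    · simpa using hs
    · refine Asymptotics.IsBigO.of_bound 1 ?_
      filter_upwards [mem_nhdsWithin_of_mem_nhds (Iio_mem_nhds zero_lt_one)] with x hx
      rw [indicator_of_notMem (s := Ioi (1 : ℝ)) fun h => lt_asymm (mem_Iio.1 hx) h]
      simp only [norm_zero, one_mul, norm_nonneg]
    · simp
  exact hm.comp s differentiableAt_id.neg

/-- Abel summation: the partial sums of the coefficients are ⌊x⌋ = x - {x}, and the part x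
integrates to s/(s - 1). -/
theorem riemannZeta_eq_sub_mul_fractMellin_of_one_lt {s : ℂ} (hs : 1 < s.re) :
    riemannZeta s = s / (s - 1) - s * fractMellin s := by
  have hO : (fun n : ℕ => ∑ k ∈ Finset.Icc 1 n, ‖(1 : ℕ → ℂ) k‖) =O[Filter.atTop]
      fun n => (n : ℝ) ^ (1 : ℝ) := by
    refine Asymptotics.IsBigO.of_bound 1 (Filter.Eventually.of_forall fun n => ?_)
    simp
  have hs1 : s - 1 ≠ 0 := by
    intro h
    have : s = 1 := by linear_combination h
    simp [this] at hs
  have hI1 : IntegrableOn (fun x : ℝ => (x : ℂ) ^ (-s)) (Ioi 1) :=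
    integrableOn_Ioi_cpow_of_lt (by simpa using hs) one_pos
  have hre : -(s + 1).re < -1 := by simp; linarith
  have hI2 : IntegrableOn (fun x : ℝ => ((Int.fract x : ℝ) : ℂ) * (x : ℂ) ^ (-(s + 1))) (Ioi 1) := by
    refine (integrableOn_Ioi_cpow_of_lt (a := -(s + 1)) (by simpa using hre) one_pos).bdd_mul (c := 1)
      measurable_fract_complex.aestronglyMeasurable
      (Filter.Eventually.of_forall fun x => norm_fract_complex_le x)
  have hsum : ∀ x ∈ Ioi (1 : ℝ), (∑ k ∈ Finset.Icc 1 ⌊x⌋₊, (1 : ℕ → ℂ) k) * (x : ℂ) ^ (-(s + 1))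
      = (x : ℂ) ^ (-s) - ((Int.fract x : ℝ) : ℂ) * (x : ℂ) ^ (-(s + 1)) := by
    intro x hx
    have hx0 : (0 : ℝ) < x := zero_lt_one.trans hx
    have h1 : (∑ k ∈ Finset.Icc 1 ⌊x⌋₊, (1 : ℕ → ℂ) k) = (x : ℂ) - ((Int.fract x : ℝ) : ℂ) := by
      have h2 : ((⌊x⌋₊ : ℕ) : ℝ) = x - Int.fract x := by
        rw [natCast_floor_eq_intCast_floor hx0.le, Int.self_sub_fract]
      rw [← Complex.ofReal_sub, ← h2]
      simp
    have h4 : (x : ℂ) ^ (-s) = x * (x : ℂ) ^ (-(s + 1)) := by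
      rw [show -s = 1 + -(s + 1) by ring, Complex.cpow_add _ _ (by exact_mod_cast hx0.ne'),
        Complex.cpow_one]
    rw [h1, h4]
    ring
  rw [← LSeries_one_eq_riemannZeta hs, LSeries_eq_mul_integral' 1 zero_le_one hs hO,
    setIntegral_congr_fun measurableSet_Ioi hsum, integral_sub hI1 hI2,
    integral_Ioi_cpow_of_lt (by simpa using hs) one_pos, fractMellin]
  have h5 : -s + 1 ≠ 0 := by
    intro h
    apply hs1
    linear_combination -h
  simp only [Complex.ofReal_one, Complex.one_cpow]
  field_simp
  ring

theorem riemannZeta₁_eq_sub_mul_riemannZeta {s : ℂ} (hs : s ≠ 1) :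
    riemannZeta₁ s = (s - 1) * riemannZeta s := by
  rw [riemannZeta_eq_inv_sub_mul hs, mul_inv_cancel_left₀ (sub_ne_zero.2 hs)]

/-- The factor s - 1 removes the pole, so the identity theorem applies on the whole half plane. -/
theorem riemannZeta₁_eq_sub_mul_fractMellin {s : ℂ} (hs : 0 < s.re) :
    riemannZeta₁ s = s - s * (s - 1) * fractMellin s := by
  have hU : IsOpen {s : ℂ | 0 < s.re} := isOpen_lt continuous_const Complex.continuous_re
  have h1 : AnalyticOnNhd ℂ riemannZeta₁ {s : ℂ | 0 < s.re} :=
    differentiable_riemannZeta₁.differentiableOn.analyticOnNhd hU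
  have h2 : AnalyticOnNhd ℂ (fun s => s - s * (s - 1) * fractMellin s) {s : ℂ | 0 < s.re} := by
    refine DifferentiableOn.analyticOnNhd (fun s hs => ?_) hU
    have := differentiableAt_fractMellin hs
    exact DifferentiableAt.differentiableWithinAt (by fun_prop)
  refine h1.eqOn_of_preconnected_of_eventuallyEq h2
    (convex_halfSpace_re_gt 0).isPreconnected (z₀ := 2) (by simp) ?_ hs
  have h3 : {s : ℂ | 1 < s.re} ∈ nhds (2 : ℂ) :=
    (isOpen_lt continuous_const Complex.continuous_re).mem_nhds (by simp)
  filter_upwards [h3] with z hz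
  have hz1 : z ≠ 1 := by
    rintro rfl
    simp at hz
  rw [riemannZeta₁_eq_sub_mul_riemannZeta hz1, riemannZeta_eq_sub_mul_fractMellin_of_one_lt hz]
  have : z - 1 ≠ 0 := sub_ne_zero.2 hz1
  field_simp

theorem norm_fract_mul_cpow_le {s : ℂ} {σ x : ℝ} (hs : σ ≤ s.re) (hx : 1 < x) :
    ‖((Int.fract x : ℝ) : ℂ) * (x : ℂ) ^ (-(s + 1))‖ ≤ Int.fract x * x ^ (-(σ + 1)) := by
  rw [norm_mul, Complex.norm_real, Real.norm_eq_abs, abs_of_nonneg (Int.fract_nonneg x),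
    Complex.norm_cpow_eq_rpow_re_of_pos (zero_lt_one.trans hx)]
  refine mul_le_mul_of_nonneg_left (Real.rpow_le_rpow_of_exponent_le hx.le ?_) (Int.fract_nonneg x)
  simp only [Complex.neg_re, Complex.add_re, Complex.one_re]
  linarith

theorem integrableOn_fract_mul_rpow {σ : ℝ} (hσ : 0 < σ) :
    IntegrableOn (fun x : ℝ => Int.fract x * x ^ (-(σ + 1))) (Ioi 1) :=
  (integrableOn_Ioi_rpow_of_lt (by linarith) one_pos).bdd_mul (c := 1)
    measurable_fract.aestronglyMeasurable (Filter.Eventually.of_forall fun x => by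
      rw [Real.norm_eq_abs, abs_of_nonneg (Int.fract_nonneg x)]
      exact (Int.fract_lt_one x).le)

theorem norm_fractMellin_le {s : ℂ} {σ : ℝ} (hσ : 0 < σ) (hs : σ ≤ s.re) :
    ‖fractMellin s‖ ≤ ∫ x in Ioi (1 : ℝ), Int.fract x * x ^ (-(σ + 1)) := by
  refine norm_integral_le_of_norm_le (integrableOn_fract_mul_rpow hσ) ?_
  exact (ae_restrict_mem measurableSet_Ioi).mono fun x hx => norm_fract_mul_cpow_le hs hx

/-- Polynomial growth is needed as far left as 1/4, since the discs of radius 7/4 about 2 + it used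
below reach that line. -/
theorem norm_riemannZeta₁_le {s : ℂ} (hs : 1 / 4 ≤ s.re) :
    ‖riemannZeta₁ s‖ ≤ 5 * (1 + ‖s‖) ^ 2 := by
  have h1 : (∫ x in Ioi (1 : ℝ), Int.fract x * x ^ (-((1 / 4 : ℝ) + 1))) ≤ 4 := by
    have h2 : (∫ x in Ioi (1 : ℝ), x ^ (-((1 / 4 : ℝ) + 1))) = 4 := by
      rw [integral_Ioi_rpow_of_lt (by norm_num) one_pos]
      norm_num
    refine le_trans ?_ h2.le
    refine setIntegral_mono_on (integrableOn_fract_mul_rpow (by norm_num))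
      (integrableOn_Ioi_rpow_of_lt (by norm_num) one_pos) measurableSet_Ioi fun x hx => ?_
    have hx0 : (0 : ℝ) < x := zero_lt_one.trans hx
    exact mul_le_of_le_one_left (by positivity) (Int.fract_lt_one x).le
  have h3 := (norm_fractMellin_le (by norm_num) hs).trans h1
  rw [riemannZeta₁_eq_sub_mul_fractMellin (by linarith)]
  have h4 : ‖s - 1‖ ≤ ‖s‖ + 1 := by simpa using norm_sub_le s 1
  calc ‖s - s * (s - 1) * fractMellin s‖ ≤ ‖s‖ + ‖s‖ * ‖s - 1‖ * ‖fractMellin s‖ := by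
        simpa using norm_sub_le s (s * (s - 1) * fractMellin s)
    _ ≤ ‖s‖ + ‖s‖ * (‖s‖ + 1) * 4 := by gcongr
    _ ≤ 5 * (1 + ‖s‖) ^ 2 := by nlinarith [norm_nonneg s]

/-- The fractional part is x - 1 on (1, 2) and is replaced by 1 only beyond 2. The crude bound 1
throughout would keep the zeros only 1/2 away from 1, whereas `shiftedZeta_zero_bounds` at b = 1/2
asks for more than 1/√3. -/
theorem integral_fract_mul_rpow_half_le :
    (∫ x in Ioi (1 : ℝ), Int.fract x * x ^ (-((1 / 2 : ℝ) + 1))) ≤ 4 * √2 - 4 := by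
  have hI := integrableOn_fract_mul_rpow (σ := 1 / 2) (by norm_num)
  have hs2 : (0 : ℝ) < √2 := by positivity
  have e1 : (2 : ℝ) ^ (1 / 2 : ℝ) = √2 := (Real.sqrt_eq_rpow 2).symm
  have e2 : (2 : ℝ) ^ (-(1 / 2) : ℝ) = √2 / 2 := by
    rw [Real.rpow_neg two_pos.le, e1]
    have := Real.mul_self_sqrt two_pos.le
    field_simp
    linarith
  have hsplit : Ioi (1 : ℝ) = Ioc 1 2 ∪ Ioi 2 := (Ioc_union_Ioi_eq_Ioi one_le_two).symm
  have hI' := hI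
  rw [hsplit] at hI'
  rw [hsplit, setIntegral_union (Ioc_disjoint_Ioi le_rfl) measurableSet_Ioi
    hI'.left_of_union hI'.right_of_union]
  have hA : (∫ x in Ioc (1 : ℝ) 2, Int.fract x * x ^ (-((1 / 2 : ℝ) + 1))) ≤ 3 * √2 - 4 := by
    have h0 : ∀ x ∈ uIcc (1 : ℝ) 2, (0 : ℝ) < x := fun x hx => by
      rw [uIcc_of_le one_le_two] at hx
      linarith [hx.1]
    have hp : ∀ r : ℝ, IntervalIntegrable (fun x : ℝ => x ^ r) volume 1 2 := fun r =>
      ContinuousOn.intervalIntegrable fun x hx =>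
        (Real.continuousAt_rpow_const x r (Or.inl (h0 x hx).ne')).continuousWithinAt
    have h1 : (∫ x in (1 : ℝ)..2, (x ^ (-(1 / 2) : ℝ) - x ^ (-(3 / 2) : ℝ))) = 3 * √2 - 4 := by
      rw [intervalIntegral.integral_sub (hp _) (hp _), integral_rpow (Or.inl (by norm_num)),
        integral_rpow (Or.inr ⟨by norm_num, fun h => (h0 0 h).ne' rfl⟩)]
      norm_num
      rw [e1, e2]
      ring
    rw [← h1, intervalIntegral.integral_of_le one_le_two]
    refine setIntegral_mono_on_ae hI'.left_of_union ((hp _).sub (hp _)).1 measurableSet_Ioc ?_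
    have hne : ∀ᵐ x : ℝ, x ≠ 2 := by simp [ae_iff]
    filter_upwards [hne] with x hx2 hx
    have hx0 : (0 : ℝ) < x := by linarith [hx.1]
    have hfl : Int.fract x = x - 1 := by
      have : ⌊x⌋ = 1 := Int.floor_eq_iff.2 ⟨by simpa using hx.1.le, by
        have := lt_of_le_of_ne hx.2 hx2
        norm_num
        linarith⟩
      rw [Int.fract, this]
      simp
    rw [hfl, sub_mul, one_mul, show (-((1 / 2 : ℝ) + 1)) = -(3 / 2) by norm_num]
    have : x ^ (-(1 / 2) : ℝ) = x * x ^ (-(3 / 2) : ℝ) := by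
      rw [show (-(1 / 2) : ℝ) = 1 + -(3 / 2) by norm_num, Real.rpow_add hx0, Real.rpow_one]
    rw [this]
  have hB : (∫ x in Ioi (2 : ℝ), Int.fract x * x ^ (-((1 / 2 : ℝ) + 1))) ≤ √2 := by
    have h2 : (∫ x in Ioi (2 : ℝ), x ^ (-((1 / 2 : ℝ) + 1))) = √2 := by
      rw [integral_Ioi_rpow_of_lt (by norm_num) two_pos]
      norm_num
      rw [e2]
      ring
    refine le_trans ?_ h2.le
    refine setIntegral_mono_on hI'.right_of_union
      (integrableOn_Ioi_rpow_of_lt (by norm_num) two_pos) measurableSet_Ioi fun x hx => ?_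
    have hx0 : (0 : ℝ) < x := two_pos.trans hx
    exact mul_le_of_le_one_left (by positivity) (Int.fract_lt_one x).le
  linarith

/-- Zeros of `ζ` with real part at least `1 / 2` stay away from `1`. -/
theorem le_norm_sub_one_of_riemannZeta₁_eq_zero {s : ℂ} (hs : 1 / 2 ≤ s.re)
    (h0 : riemannZeta₁ s = 0) : 3 / 5 ≤ ‖s - 1‖ := by
  have hre : 0 < s.re := by linarith
  rw [riemannZeta₁_eq_sub_mul_fractMellin hre] at h0
  have hs0 : s ≠ 0 := by
    rintro rfl
    simp at hre
  have h1 : (s - 1) * fractMellin s = 1 := by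
    have : s * (1 - (s - 1) * fractMellin s) = 0 := by linear_combination h0
    rcases mul_eq_zero.1 this with h | h
    · exact absurd h hs0
    · linear_combination -h
  have h2 := (norm_fractMellin_le (by norm_num) hs).trans integral_fract_mul_rpow_half_le
  have h3 : ‖s - 1‖ * ‖fractMellin s‖ = 1 := by rw [← norm_mul, h1, norm_one]
  -- With this, 4√2 - 4 ≤ 5/3, the reciprocal of 3/5.
  have h4 : √2 ≤ 17 / 12 := Real.sqrt_le_iff.2 ⟨by norm_num, by norm_num⟩
  by_contra hlt
  have h6 : ‖s - 1‖ * ‖fractMellin s‖ < 1 := by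
    have : 0 < ‖fractMellin s‖ := by
      rw [norm_pos_iff]
      rintro h
      simp [h] at h1
    calc _ < 3 / 5 * ‖fractMellin s‖ := by gcongr; linarith
      _ ≤ 3 / 5 * (5 / 3) := by gcongr; linarith
      _ = 1 := by norm_num
  linarith

theorem riemannZeta₁_ne_zero_of_one_le_re {s : ℂ} (hs : 1 ≤ s.re) : riemannZeta₁ s ≠ 0 := by
  by_cases h : s = 1
  · simp [h]
  · rw [riemannZeta₁_eq_sub_mul_riemannZeta h]
    exact mul_ne_zero (sub_ne_zero.2 h) (riemannZeta_ne_zero_of_one_le_re hs)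

theorem riemannZeta₁_eq_zero_iff {s : ℂ} : riemannZeta₁ s = 0 ↔ riemannZeta s = 0 := by
  by_cases h : s = 1
  · simp [h, riemannZeta_one_ne_zero]
  · rw [riemannZeta₁_eq_sub_mul_riemannZeta h, mul_eq_zero, or_iff_right (sub_ne_zero.2 h)]

/-- Zeros of `ζ` with real part at least `1 / 2` stay away from the real axis. -/
theorem le_im_sq_of_riemannZeta₁_eq_zero {s : ℂ} (hs : 1 / 2 ≤ s.re)
    (h0 : riemannZeta₁ s = 0) : 11 / 100 ≤ s.im ^ 2 := by
  have h1 := le_norm_sub_one_of_riemannZeta₁_eq_zero hs h0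
  have h2 : s.re < 1 := by
    by_contra h
    exact riemannZeta₁_ne_zero_of_one_le_re (not_lt.1 h) h0
  have h3 : (3 / 5) ^ 2 ≤ ‖s - 1‖ ^ 2 := by gcongr
  rw [Complex.sq_norm, Complex.normSq_apply] at h3
  simp only [Complex.sub_re, Complex.one_re, Complex.sub_im, Complex.one_im] at h3
  -- The real part is within 1/2 of 1, and 9/25 - 1/4 = 11/100.
  nlinarith

theorem riemannZeta₁_conj (s : ℂ) :
    riemannZeta₁ ((starRingEnd ℂ) s) = (starRingEnd ℂ) (riemannZeta₁ s) := by
  by_cases h : s = 1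
  · simp [h]
  · have h' : (starRingEnd ℂ) s ≠ 1 := fun h1 => h (by simpa using congrArg (starRingEnd ℂ) h1)
    rw [riemannZeta₁_eq_sub_mul_riemannZeta h, riemannZeta₁_eq_sub_mul_riemannZeta h',
      riemannZeta_conj]
    simp

theorem riemannZeta₁_ofReal_im (x : ℝ) : (riemannZeta₁ x).im = 0 := by
  have h := riemannZeta₁_conj x
  rw [Complex.conj_ofReal] at h
  exact Complex.conj_eq_iff_im.1 h.symm

/-! ### Splitting off zeros and taking logarithms in discs -/

theorem norm_multiset_map_prod {ι : Type*} (S : Multiset ι) (F : ι → ℂ) :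
    ‖(S.map F).prod‖ = (S.map fun ρ => ‖F ρ‖).prod := by
  induction S using Multiset.induction with
  | empty => simp
  | cons a S ih => simp [ih]

theorem differentiable_multiset_map_prod {ι : Type*} (S : Multiset ι) {q : ℂ → ι → ℂ}
    (hq : ∀ i, Differentiable ℂ fun z => q z i) : Differentiable ℂ fun z => (S.map (q z)).prod := by
  induction S using Multiset.induction with
  | empty => simp
  | cons a S ih =>
    simp only [Multiset.map_cons, Multiset.prod_cons]
    exact (hq a).mul ih

/-- A form of Jensen's inequality: the number of zeros that can be split off in a disc is
controlled by the maximum on a larger circle. -/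
theorem norm_mul_pow_card_le_of_factorization {f g : ℂ → ℂ} (hg : Differentiable ℂ g)
    {c : ℂ} {R₁ R₂ M : ℝ} (h1 : 0 < R₁) (h12 : R₁ < R₂) (hM : ∀ z ∈ Metric.sphere c R₂, ‖f z‖ ≤ M)
    {S : Multiset ℂ} (hfg : ∀ z, f z = (S.map (z - ·)).prod * g z) (hS : ∀ ρ ∈ S, ‖ρ - c‖ ≤ R₁) :
    ‖f c‖ * (R₂ / R₁) ^ S.card ≤ M := by
  have h2 : 0 < R₂ := h1.trans h12
  -- Blaschke-type replacement for z - ρ: it has the same modulus on the circle of radius R₂, and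
  -- its value at the centre is R₂.
  let q : ℂ → ℂ → ℂ := fun z ρ => (R₂ ^ 2 - (starRingEnd ℂ) (ρ - c) * (z - c)) / R₂
  have hq : ∀ z ∈ Metric.sphere c R₂, ∀ ρ, ‖q z ρ‖ = ‖z - ρ‖ := by
    intro z hz ρ
    have hz' : ‖z - c‖ = R₂ := by simpa [dist_eq_norm] using hz
    have e : (R₂ : ℂ) ^ 2 = (starRingEnd ℂ) (z - c) * (z - c) := by
      rw [mul_comm, Complex.mul_conj, Complex.normSq_eq_norm_sq, hz']
      simp
    have : q z ρ = (starRingEnd ℂ) (z - ρ) * (z - c) / R₂ := by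
      simp only [q, e, map_sub]
      ring
    rw [this, norm_div, norm_mul, hz', Complex.norm_conj, Complex.norm_real, Real.norm_eq_abs,
      abs_of_pos h2, mul_div_cancel_right₀ _ h2.ne']
  let h : ℂ → ℂ := fun z => (S.map (q z)).prod * g z
  have hqd : Differentiable ℂ fun z => (S.map (q z)).prod := by
    refine differentiable_multiset_map_prod S fun ρ => ?_
    simp only [q]
    fun_prop
  have hd : Differentiable ℂ h := hqd.mul hg
  -- Maximum principle for h, whose modulus on the circle is that of f.
  have hb : ‖h c‖ ≤ M := by
    refine Complex.norm_le_of_forall_mem_frontier_norm_le (U := Metric.ball c R₂)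
      Metric.isBounded_ball hd.diffContOnCl (fun z hz => ?_)
      (subset_closure (Metric.mem_ball_self h2))
    rw [frontier_ball c h2.ne'] at hz
    have e : ‖h z‖ = ‖f z‖ := by
      simp only [h, hfg z, norm_mul, norm_multiset_map_prod, hq z hz]
    rw [e]
    exact hM z hz
  have hqc : ∀ ρ, q c ρ = R₂ := by
    intro ρ
    have : (R₂ : ℂ) ≠ 0 := by exact_mod_cast h2.ne'
    simp only [q, sub_self, mul_zero, sub_zero]
    field_simp
  have hhc : ‖h c‖ = R₂ ^ S.card * ‖g c‖ := by
    simp only [h, hqc, Multiset.map_const', Multiset.prod_replicate, norm_mul, norm_pow,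
      Complex.norm_real, Real.norm_eq_abs, abs_of_pos h2]
  have hfc : ‖f c‖ ≤ R₁ ^ S.card * ‖g c‖ := by
    rw [hfg c, norm_mul, norm_multiset_map_prod]
    refine mul_le_mul_of_nonneg_right ?_ (norm_nonneg _)
    rw [← Multiset.prod_replicate, ← Multiset.map_const']
    refine Multiset.prod_map_le_prod_map₀ _ _ (fun _ _ => norm_nonneg _) fun ρ hρ => ?_
    rw [norm_sub_rev]
    exact hS ρ hρ
  calc ‖f c‖ * (R₂ / R₁) ^ S.card ≤ R₁ ^ S.card * ‖g c‖ * (R₂ / R₁) ^ S.card := by gcongr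
    _ = ‖h c‖ := by
      rw [hhc, div_pow]
      field_simp
    _ ≤ M := hb

/-- Splitting off all zeros of an entire function in a closed disc. -/
theorem exists_factorization {f : ℂ → ℂ} (hf : Differentiable ℂ f)
    {c : ℂ} {R₁ R₂ M : ℝ} (h1 : 0 < R₁) (h12 : R₁ < R₂) (hM : ∀ z ∈ Metric.sphere c R₂, ‖f z‖ ≤ M)
    (hc : f c ≠ 0) :
    ∃ (S : Multiset ℂ) (g : ℂ → ℂ), Differentiable ℂ g ∧
      (∀ z, f z = (S.map (z - ·)).prod * g z) ∧ (∀ ρ ∈ S, ‖ρ - c‖ ≤ R₁) ∧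
      (∀ z ∈ Metric.closedBall c R₁, g z ≠ 0) ∧ ‖f c‖ * (R₂ / R₁) ^ S.card ≤ M := by
  -- If no factorization were complete, one more zero could always be split off, and the number of
  -- factors would exceed the Jensen bound.
  by_contra hno
  have hall : ∀ n : ℕ, ∃ (S : Multiset ℂ) (g : ℂ → ℂ), S.card = n ∧ Differentiable ℂ g ∧
      (∀ z, f z = (S.map (z - ·)).prod * g z) ∧ (∀ ρ ∈ S, ‖ρ - c‖ ≤ R₁) := by
    intro n
    induction n with
    | zero => exact ⟨0, f, rfl, hf, by simp, by simp⟩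
    | succ n ih =>
      obtain ⟨S, g, hn, hg, hfg, hS⟩ := ih
      have : ∃ z ∈ Metric.closedBall c R₁, g z = 0 := by
        by_contra hz
        push Not at hz
        exact hno ⟨S, g, hg, hfg, hS, hz,
          norm_mul_pow_card_le_of_factorization hg h1 h12 hM hfg hS⟩
      obtain ⟨ρ, hρ, h0⟩ := this
      refine ⟨ρ ::ₘ S, dslope g ρ, by simp [hn], ?_, fun z => ?_, ?_⟩
      · rw [← differentiableOn_univ]
        exact (Complex.differentiableOn_dslope Filter.univ_mem).2 hg.differentiableOn
      · have h2 := sub_smul_dslope g ρ z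
        rw [h0, sub_zero, smul_eq_mul] at h2
        rw [hfg z, Multiset.map_cons, Multiset.prod_cons, ← h2]
        ring
      · intro x hx
        rcases Multiset.mem_cons.1 hx with rfl | hx
        · simpa [dist_eq_norm] using hρ
        · exact hS x hx
  have hlim : Filter.Tendsto (fun n : ℕ => ‖f c‖ * (R₂ / R₁) ^ n) Filter.atTop Filter.atTop :=
    (tendsto_pow_atTop_atTop_of_one_lt ((one_lt_div h1).2 h12)).const_mul_atTop (norm_pos_iff.2 hc)
  obtain ⟨n, hn⟩ := (hlim.eventually_gt_atTop M).exists
  obtain ⟨S, g, rfl, hg, hfg, hS⟩ := hall n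
  exact absurd (norm_mul_pow_card_le_of_factorization hg h1 h12 hM hfg hS) (not_le.2 hn)

/-- A zero free holomorphic function on a disc is the exponential of a holomorphic function. -/
theorem exists_differentiableOn_exp_eq {g : ℂ → ℂ} {c : ℂ} {R : ℝ} (hR : 0 < R)
    (hg : DifferentiableOn ℂ g (Metric.ball c R)) (h0 : ∀ z ∈ Metric.ball c R, g z ≠ 0) :
    ∃ ℓ : ℂ → ℂ, Measurable ℓ ∧ DifferentiableOn ℂ ℓ (Metric.ball c R) ∧
      ∀ z ∈ Metric.ball c R, Complex.exp (ℓ z) = g z := by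
  have hd : DifferentiableOn ℂ (fun z => deriv g z / g z) (Metric.ball c R) :=
    (hg.deriv Metric.isOpen_ball).div hg h0
  obtain ⟨F, hF⟩ := hd.isExactOn_ball
  have hcb : c ∈ Metric.ball c R := Metric.mem_ball_self hR
  classical
  have hℓd : DifferentiableOn ℂ (fun z => F z - F c + Complex.log (g c)) (Metric.ball c R) :=
    fun z hz => (((hF z hz).differentiableAt.sub_const _).add_const _).differentiableWithinAt
  have heqOn := piecewise_eqOn (Metric.ball c R) (fun z => F z - F c + Complex.log (g c)) 0
  -- A primitive of g'/g, normalised at c. The value 0 outside the ball makes the function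
  -- measurable on the whole plane.
  refine ⟨(Metric.ball c R).piecewise (fun z => F z - F c + Complex.log (g c)) 0,
    hℓd.continuousOn.measurable_piecewise continuousOn_const Metric.isOpen_ball.measurableSet,
    hℓd.congr heqOn, fun z hz => ?_⟩
  · rw [heqOn hz]
    have hconst : ∀ z ∈ Metric.ball c R,
        HasDerivAt (fun z => Complex.exp (-F z) * g z) 0 z := by
      intro z hz
      have hgz := (hg.differentiableAt (Metric.isOpen_ball.mem_nhds hz)).hasDerivAt
      refine HasDerivAt.congr_deriv ((hF z hz).fun_neg.cexp.fun_mul hgz) ?_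
      rw [mul_neg, neg_mul, mul_assoc, div_mul_cancel₀ _ (h0 z hz), neg_add_cancel]
    have heq := Metric.isOpen_ball.is_const_of_deriv_eq_zero
      (convex_ball c R).isPreconnected
      (fun z hz => (hconst z hz).differentiableAt.differentiableWithinAt)
      (fun z hz => (hconst z hz).deriv) hz hcb
    rw [Complex.exp_add, Complex.exp_log (h0 c hcb), Complex.exp_sub]
    simp only [Complex.exp_neg] at heq
    have e1 := Complex.exp_ne_zero (F z)
    have e2 := Complex.exp_ne_zero (F c)
    field_simp at heq ⊢
    linear_combination -heq

/-! ### Boundary integrals over rectangles and the contribution of one zero -/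

/-- The kernel `w / (w² - a²)²`. -/
noncomputable def argKernel (a : ℝ) (w : ℂ) : ℂ := w / (w ^ 2 - (a : ℂ) ^ 2) ^ 2

/-- The integral over the boundary of the rectangle `[0, X] × [y₀, y₁]`. -/
noncomputable def rectIntegral (X y₀ y₁ : ℝ) (h : ℂ → ℂ) : ℂ :=
  (∫ x : ℝ in 0..X, h (x + y₀ * Complex.I)) - (∫ x : ℝ in 0..X, h (x + y₁ * Complex.I)) +
    Complex.I * (∫ y : ℝ in y₀..y₁, h (X + y * Complex.I)) -
    Complex.I * (∫ y : ℝ in y₀..y₁, h ((0 : ℝ) + y * Complex.I))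

/-- Integrability on the four sides of the rectangle `[0, X] × [y₀, y₁]`. -/
structure RectIntegrable (X y₀ y₁ : ℝ) (h : ℂ → ℂ) : Prop where
  bot : IntervalIntegrable (fun x : ℝ => h (x + y₀ * Complex.I)) volume 0 X
  top : IntervalIntegrable (fun x : ℝ => h (x + y₁ * Complex.I)) volume 0 X
  right : IntervalIntegrable (fun y : ℝ => h (X + y * Complex.I)) volume y₀ y₁
  left : IntervalIntegrable (fun y : ℝ => h ((0 : ℝ) + y * Complex.I)) volume y₀ y₁

theorem RectIntegrable.add {X y₀ y₁ : ℝ} {h k : ℂ → ℂ} (hh : RectIntegrable X y₀ y₁ h)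
    (hk : RectIntegrable X y₀ y₁ k) : RectIntegrable X y₀ y₁ fun w => h w + k w :=
  ⟨hh.bot.add hk.bot, hh.top.add hk.top, hh.right.add hk.right, hh.left.add hk.left⟩

theorem rectIntegral_add {X y₀ y₁ : ℝ} {h k : ℂ → ℂ} (hh : RectIntegrable X y₀ y₁ h)
    (hk : RectIntegrable X y₀ y₁ k) :
    rectIntegral X y₀ y₁ (fun w => h w + k w) = rectIntegral X y₀ y₁ h + rectIntegral X y₀ y₁ k := by
  simp only [rectIntegral]
  rw [intervalIntegral.integral_add hh.bot hk.bot, intervalIntegral.integral_add hh.top hk.top,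
    intervalIntegral.integral_add hh.right hk.right, intervalIntegral.integral_add hh.left hk.left]
  ring

theorem RectIntegrable.of_continuousOn {X y₀ y₁ : ℝ} (hX : 0 ≤ X) (hy : y₀ ≤ y₁) {h : ℂ → ℂ}
    (hh : ContinuousOn h (Icc 0 X ×ℂ Icc y₀ y₁)) : RectIntegrable X y₀ y₁ h := by
  have hor : ∀ y ∈ Icc y₀ y₁, IntervalIntegrable (fun x : ℝ => h (x + y * Complex.I)) volume 0 X := by
    intro y hyy
    refine ContinuousOn.intervalIntegrable ?_
    rw [uIcc_of_le hX]
    refine hh.comp (by fun_prop) fun x hx => ?_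
    simpa [Complex.mem_reProdIm] using ⟨hx, hyy⟩
  have ver : ∀ x ∈ Icc 0 X,
      IntervalIntegrable (fun y : ℝ => h ((x : ℝ) + y * Complex.I)) volume y₀ y₁ := by
    intro x hx
    refine ContinuousOn.intervalIntegrable ?_
    rw [uIcc_of_le hy]
    refine hh.comp (by fun_prop) fun y hyy => ?_
    simpa [Complex.mem_reProdIm] using ⟨hx, hyy⟩
  exact ⟨hor _ (left_mem_Icc.2 hy), hor _ (right_mem_Icc.2 hy), ver _ (right_mem_Icc.2 hX),
    ver _ (left_mem_Icc.2 hX)⟩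

theorem rectIntegral_eq_zero {X y₀ y₁ : ℝ} (hX : 0 ≤ X) (hy : y₀ ≤ y₁) {h : ℂ → ℂ}
    (hh : DifferentiableOn ℂ h (Icc 0 X ×ℂ Icc y₀ y₁)) : rectIntegral X y₀ y₁ h = 0 := by
  have := Complex.integral_boundary_rect_eq_zero_of_differentiableOn h
    ((0 : ℝ) + y₀ * Complex.I) (X + y₁ * Complex.I)
    (by simpa [uIcc_of_le hX, uIcc_of_le hy] using hh)
  simpa [rectIntegral] using this

theorem sq_sub_sq_ne_zero {a : ℝ} (ha : 0 < a) {w : ℂ} (hw : 0 ≤ w.re) (hwa : w ≠ a) :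
    w ^ 2 - (a : ℂ) ^ 2 ≠ 0 := by
  rw [sq_sub_sq]
  refine mul_ne_zero (fun h => ?_) (sub_ne_zero.2 hwa)
  have := congrArg Complex.re h
  simp at this
  linarith

theorem differentiableAt_argKernel {a : ℝ} {w : ℂ} (hw : w ^ 2 - (a : ℂ) ^ 2 ≠ 0) :
    DifferentiableAt ℂ (argKernel a) w := by
  unfold argKernel
  have : (w ^ 2 - (a : ℂ) ^ 2) ^ 2 ≠ 0 := pow_ne_zero 2 hw
  fun_prop (disch := assumption)

theorem ae_ofReal_add_ne (y : ℝ) (p : ℂ) : ∀ᵐ x : ℝ, (x : ℂ) + y * Complex.I ≠ p := by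
  have : ∀ᵐ x : ℝ, x ≠ p.re := by simp [ae_iff]
  filter_upwards [this] with x hx h
  exact hx (by simpa using congrArg Complex.re h)

/-- Cauchy's theorem for the kernel times a function, where the double pole of the kernel at `a` is
removed by subtraction of a Taylor polynomial. -/
theorem argKernel_mul_rectIntegral_eq_zero {a X y₁ : ℝ} (ha : 0 < a) (haX : a < X) (hy : 0 < y₁)
    {U : Set ℂ} (hU : IsOpen U) (hUR : Icc 0 X ×ℂ Icc 0 y₁ ⊆ U) {L : ℂ → ℂ}
    (hL : DifferentiableOn ℂ L U) {c : ℂ} (hc : HasDerivAt L c a) :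
    RectIntegrable X 0 y₁ (fun w => argKernel a w * (L w - L a - c * (w - a))) ∧
      rectIntegral X 0 y₁ (fun w => argKernel a w * (L w - L a - c * (w - a))) = 0 := by
  have hX : 0 < X := ha.trans haX
  have haU : (a : ℂ) ∈ U := hUR (by simp [Complex.mem_reProdIm, ha.le, haX.le, hy.le])
  have hUa : U ∈ nhds (a : ℂ) := hU.mem_nhds haU
  -- Two divided differences at a divide the second-order zero by (w - a)²; the factor (w + a)² left
  -- from the kernel has no zero on the rectangle.
  let r : ℂ → ℂ := fun w => w / (w + a) ^ 2 * dslope (dslope L a) a w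
  have hr : DifferentiableOn ℂ r (Icc 0 X ×ℂ Icc 0 y₁) := by
    have h1 : DifferentiableOn ℂ (dslope (dslope L a) a) U :=
      (Complex.differentiableOn_dslope hUa).2 ((Complex.differentiableOn_dslope hUa).2 hL)
    refine DifferentiableOn.mul (fun w hw => ?_) (h1.mono hUR)
    have : (w + a) ^ 2 ≠ 0 := by
      refine pow_ne_zero 2 fun h => ?_
      have h2 := congrArg Complex.re h
      have h3 : 0 ≤ w.re := (Complex.mem_reProdIm.1 hw).1.1
      simp at h2
      linarith
    exact DifferentiableAt.differentiableWithinAt (by fun_prop (disch := assumption))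
  have heq : ∀ w : ℂ, w ≠ a → argKernel a w * (L w - L a - c * (w - a)) = r w := by
    intro w hw
    have hwa : w - a ≠ 0 := sub_ne_zero.2 hw
    simp only [r, argKernel]
    rw [dslope_of_ne _ hw, slope_def_field, dslope_of_ne _ hw, slope_def_field, dslope_same,
      hc.deriv, sq_sub_sq]
    -- At w = -a both sides are 0, since division by zero gives 0.
    by_cases hp : w + a = 0
    · simp [hp]
    · field_simp
  have hor : ∀ y : ℝ, ∀ᵐ x : ℝ, argKernel a (x + y * Complex.I) *
      (L (x + y * Complex.I) - L a - c * (x + y * Complex.I - a)) = r (x + y * Complex.I) := by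
    intro y
    filter_upwards [ae_ofReal_add_ne y a] with x hx
    exact heq _ hx
  have ver : ∀ x : ℝ, x ≠ a → ∀ y : ℝ, argKernel a (x + y * Complex.I) *
      (L (x + y * Complex.I) - L a - c * (x + y * Complex.I - a)) = r (x + y * Complex.I) := by
    intro x hx y
    refine heq _ fun h => hx ?_
    simpa using congrArg Complex.re h
  have hri := RectIntegrable.of_continuousOn hX.le hy.le hr.continuousOn
  constructor
  · refine ⟨hri.bot.congr_ae ?_, hri.top.congr_ae ?_, hri.right.congr_ae ?_, hri.left.congr_ae ?_⟩
    · exact ae_restrict_of_ae ((hor 0).mono fun x hx => hx.symm)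
    · exact ae_restrict_of_ae ((hor y₁).mono fun x hx => hx.symm)
    · exact Filter.Eventually.of_forall fun y => (ver X haX.ne' y).symm
    · exact Filter.Eventually.of_forall fun y => (ver 0 ha.ne y).symm
  · rw [← rectIntegral_eq_zero hX.le hy.le hr]
    simp only [rectIntegral]
    rw [intervalIntegral.integral_congr_ae ((hor 0).mono fun x hx _ => hx),
      intervalIntegral.integral_congr_ae ((hor y₁).mono fun x hx _ => hx)]
    simp only [ver X haX.ne', ver 0 ha.ne]

/-- On a line, δ is taken to be the distance to the zero in one coordinate; the bound is then an
integrable logarithmic singularity. -/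
theorem norm_log_le {z : ℂ} {δ K : ℝ} (hδ : 0 < δ) (hδz : δ ≤ ‖z‖) (hz : ‖z‖ ≤ K) (hK : 1 ≤ K) :
    ‖Complex.log z‖ ≤ |Real.log δ| + (Real.log K + Real.pi) := by
  have h1 : ‖Complex.log z‖ ≤ |Real.log ‖z‖| + Real.pi := by
    refine (Complex.norm_le_abs_re_add_abs_im _).trans ?_
    rw [Complex.log_re, Complex.log_im]
    gcongr
    exact Complex.abs_arg_le_pi z
  have h2 : |Real.log ‖z‖| ≤ |Real.log δ| + Real.log K := by
    have h3 := Real.log_le_log hδ hδz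
    have h4 := Real.log_le_log (hδ.trans_le hδz) hz
    have h5 := Real.log_nonneg hK
    rw [abs_le]
    constructor
    · linarith [neg_abs_le (Real.log δ)]
    · linarith [abs_nonneg (Real.log δ)]
  linarith

theorem intervalIntegrable_abs_log_abs_sub (u p q : ℝ) :
    IntervalIntegrable (fun x : ℝ => |Real.log (|x - u|)|) volume p q := by
  have h : IntervalIntegrable Real.log volume (p - u) (q - u) := intervalIntegral.intervalIntegrable_log'
  have h2 := (h.comp_sub_right u).abs
  simpa [Real.log_abs] using h2

theorem intervalIntegrable_of_norm_le_log {g : ℝ → ℂ} (hg : Measurable g) {u p q C : ℝ}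
    (hb : ∀ x ∈ uIcc p q, x ≠ u → ‖g x‖ ≤ |Real.log (|x - u|)| + C) :
    IntervalIntegrable g volume p q := by
  refine ((intervalIntegrable_abs_log_abs_sub u p q).add
    (intervalIntegrable_const (c := C))).mono_fun hg.aestronglyMeasurable ?_
  have hne : ∀ᵐ x : ℝ, x ≠ u := by simp [ae_iff]
  filter_upwards [ae_restrict_mem measurableSet_uIoc, ae_restrict_of_ae hne] with x hx hxu
  exact (hb x (uIoc_subset_uIcc hx) hxu).trans (le_abs_self _)

theorem exists_bound_uIcc (f : ℝ → ℂ) (hf : Continuous f) (p q : ℝ) :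
    ∃ K, 1 ≤ K ∧ ∀ x ∈ uIcc p q, ‖f x‖ ≤ K := by
  obtain ⟨K, hK⟩ := isCompact_uIcc.exists_bound_of_continuousOn (f := f) hf.continuousOn
  exact ⟨max K 1, le_max_right _ _, fun x hx => (hK x hx).trans (le_max_left _ _)⟩

theorem intervalIntegrable_log_vertical (x : ℝ) (ρ : ℂ) (p q : ℝ) :
    IntervalIntegrable (fun y : ℝ => Complex.log (x + y * Complex.I - ρ)) volume p q := by
  obtain ⟨K, hK, hb⟩ := exists_bound_uIcc (fun y => x + y * Complex.I - ρ) (by fun_prop) p q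
  refine intervalIntegrable_of_norm_le_log (by fun_prop)
    (u := ρ.im) (C := Real.log K + Real.pi) fun y hy hyu => ?_
  refine norm_log_le (abs_pos.2 (sub_ne_zero.2 hyu)) ?_ (hb y hy) hK
  simpa using Complex.abs_im_le_norm ((x : ℂ) + y * Complex.I - ρ)

theorem intervalIntegrable_log_horizontal (y : ℝ) (ρ : ℂ) (p q : ℝ) :
    IntervalIntegrable (fun x : ℝ => Complex.log (x + y * Complex.I - ρ)) volume p q := by
  obtain ⟨K, hK, hb⟩ := exists_bound_uIcc (fun x => x + y * Complex.I - ρ) (by fun_prop) p q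
  refine intervalIntegrable_of_norm_le_log (by fun_prop)
    (u := ρ.re) (C := Real.log K + Real.pi) fun x hx hxu => ?_
  refine norm_log_le (abs_pos.2 (sub_ne_zero.2 hxu)) ?_ (hb x hx) hK
  simpa using Complex.abs_re_le_norm ((x : ℂ) + y * Complex.I - ρ)

theorem continuousOn_argKernel {a : ℝ} (ha : 0 < a) :
    ContinuousOn (argKernel a) {w | 0 ≤ w.re ∧ 0 < w.im} := fun w hw =>
  (differentiableAt_argKernel (sq_sub_sq_ne_zero ha hw.1 fun h => by
    have := hw.2
    simp [h] at this)).continuousAt.continuousWithinAt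

theorem measurable_argKernel (a : ℝ) : Measurable (argKernel a) := by
  unfold argKernel
  fun_prop

/-- Dominated convergence as a horizontal line moves onto the height of ρ: since |w - ρ| ≥ |x - Re
ρ|, one logarithmic singularity dominates for all small η. The filter `l` selects the side of
approach. -/
theorem tendsto_integral_mul_log {k P : ℂ → ℂ} {ρ : ℂ} {X : ℝ} (hX : 0 ≤ X) (hv : 0 < ρ.im)
    (hk : ContinuousOn k {w | 0 ≤ w.re ∧ 0 < w.im}) (hkm : Measurable k) (hP : Continuous P)
    {l : Filter ℝ} [l.IsCountablyGenerated] (hl : l ≤ nhds 0) {Λ : ℝ → ℂ}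
    (hΛ : ∀ x : ℝ, x ≠ ρ.re →
      Filter.Tendsto (fun η : ℝ => Complex.log ((x - ρ.re : ℝ) + η * Complex.I)) l (nhds (Λ x))) :
    Filter.Tendsto (fun η : ℝ => ∫ x : ℝ in 0..X, k (x + (ρ.im + η : ℝ) * Complex.I) *
        (Complex.log (x + (ρ.im + η : ℝ) * Complex.I - ρ) - P (x + (ρ.im + η : ℝ) * Complex.I))) l
      (nhds (∫ x : ℝ in 0..X, k (x + ρ.im * Complex.I) * (Λ x - P (x + ρ.im * Complex.I)))) := by
  have hcpt : IsCompact (Icc 0 X ×ℂ Icc (ρ.im / 2) (3 * ρ.im / 2)) := isCompact_Icc.reProdIm isCompact_Icc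
  obtain ⟨A, hA⟩ := hcpt.exists_bound_of_continuousOn (f := k) (hk.mono fun w hw => by
    rw [Complex.mem_reProdIm] at hw
    exact ⟨hw.1.1, by linarith [hw.2.1]⟩)
  obtain ⟨B, hB⟩ := hcpt.exists_bound_of_continuousOn (f := P) hP.continuousOn
  obtain ⟨C', hC'⟩ := hcpt.exists_bound_of_continuousOn (f := fun w => w - ρ) (by fun_prop)
  set C := max C' 1
  have hev : ∀ᶠ η in l, η ∈ Ioo (-(ρ.im / 2)) (ρ.im / 2) :=
    hl (Ioo_mem_nhds (by linarith) (by linarith))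
  have hmem : ∀ η ∈ Ioo (-(ρ.im / 2)) (ρ.im / 2), ∀ x ∈ uIoc 0 X,
      ((x : ℂ) + (ρ.im + η : ℝ) * Complex.I) ∈ Icc 0 X ×ℂ Icc (ρ.im / 2) (3 * ρ.im / 2) := by
    intro η hη x hx
    rw [uIoc_of_le hX] at hx
    rw [Complex.mem_reProdIm]
    simp only [Complex.add_re, Complex.ofReal_re, Complex.mul_re, Complex.I_re, mul_zero,
      Complex.ofReal_im, Complex.I_im, mul_one, sub_self, add_zero, Complex.add_im, Complex.mul_im,
      zero_add]
    exact ⟨⟨hx.1.le, hx.2⟩, by linarith [hη.1], by linarith [hη.2]⟩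
  have hne : ∀ᵐ x : ℝ, x ≠ ρ.re := by simp [ae_iff]
  refine intervalIntegral.tendsto_integral_filter_of_dominated_convergence
    (fun x => A * (|Real.log (|x - ρ.re|)| + (Real.log C + Real.pi + B))) ?_ ?_ ?_ ?_
  · refine Filter.Eventually.of_forall fun η => Measurable.aestronglyMeasurable ?_
    have := hP.measurable
    fun_prop
  · filter_upwards [hev] with η hη
    filter_upwards [hne] with x hxu hx
    have hm := hmem η hη x hx
    rw [norm_mul]
    refine mul_le_mul (hA _ hm) ?_ (norm_nonneg _) ((norm_nonneg _).trans (hA _ hm))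
    refine (norm_sub_le _ _).trans ?_
    have h1 := norm_log_le (z := (x : ℂ) + (ρ.im + η : ℝ) * Complex.I - ρ) (δ := |x - ρ.re|) (K := C)
      (abs_pos.2 (sub_ne_zero.2 hxu))
      (by simpa using Complex.abs_re_le_norm ((x : ℂ) + (ρ.im + η : ℝ) * Complex.I - ρ))
      ((hC' _ hm).trans (le_max_left _ _)) (le_max_right _ _)
    linarith [hB _ hm]
  · exact ((intervalIntegrable_abs_log_abs_sub _ _ _).add intervalIntegrable_const).const_mul A
  · filter_upwards [hne] with x hxu hx
    have hlim : Filter.Tendsto (fun η : ℝ => (x : ℂ) + (ρ.im + η : ℝ) * Complex.I) l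
        (nhds (x + ρ.im * Complex.I)) := by
      have : Continuous fun η : ℝ => (x : ℂ) + (ρ.im + η : ℝ) * Complex.I := by fun_prop
      have h2 := (this.tendsto 0).mono_left hl
      simpa using h2
    have hk0 : ContinuousAt k (x + ρ.im * Complex.I) := by
      refine (hk.continuousWithinAt ?_).continuousAt ?_
      · rw [uIoc_of_le hX] at hx
        simpa using ⟨hx.1.le, hv⟩
      · have ho : IsOpen {w : ℂ | 0 < w.re ∧ 0 < w.im} :=
          (isOpen_lt continuous_const Complex.continuous_re).inter
            (isOpen_lt continuous_const Complex.continuous_im)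
        refine Filter.mem_of_superset (ho.mem_nhds ?_) fun w hw => ⟨hw.1.le, hw.2⟩
        rw [uIoc_of_le hX] at hx
        simpa using ⟨hx.1, hv⟩
    refine (hk0.tendsto.comp hlim).mul (Filter.Tendsto.sub ?_ ((hP.tendsto _).comp hlim))
    refine (hΛ x hxu).congr fun η => ?_
    congr 1
    apply Complex.ext <;> simp

/-- The principal logarithm is continuous up to its cut from the closed upper half plane. -/
theorem tendsto_log_add_mul_I_right {x : ℝ} (hx : x ≠ 0) :
    Filter.Tendsto (fun η : ℝ => Complex.log (x + η * Complex.I)) (nhdsWithin 0 (Ioi 0))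
      (nhds (Complex.log x)) := by
  have h1 : Filter.Tendsto (fun η : ℝ => (x : ℂ) + η * Complex.I) (nhdsWithin 0 (Ioi 0))
      (nhdsWithin (x : ℂ) {z | 0 ≤ z.im}) := by
    refine tendsto_nhdsWithin_iff.2 ⟨?_, ?_⟩
    · have : Continuous fun η : ℝ => (x : ℂ) + η * Complex.I := by fun_prop
      simpa using (this.tendsto 0).mono_left nhdsWithin_le_nhds
    · filter_upwards [self_mem_nhdsWithin] with η hη
      simpa using (mem_Ioi.1 hη).le
  rcases lt_or_gt_of_ne hx with hneg | hpos
  · exact (Complex.continuousWithinAt_log_of_re_neg_of_im_zero (by simpa using hneg) (by simp)).tendsto.comp h1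
  · exact (continuousAt_clog (Or.inl (by simpa using hpos))).tendsto.comp
      (h1.mono_right nhdsWithin_le_nhds)

/-- Conjugation exchanges the two sides of the cut. -/
theorem tendsto_log_sub_mul_I_right {x : ℝ} (hx : x ≠ 0) :
    Filter.Tendsto (fun η : ℝ => Complex.log (x + (-η : ℝ) * Complex.I)) (nhdsWithin 0 (Ioi 0))
      (nhds ((starRingEnd ℂ) (Complex.log x))) := by
  refine ((Complex.continuous_conj.tendsto _).comp (tendsto_log_add_mul_I_right hx)).congr' ?_
  filter_upwards [self_mem_nhdsWithin] with η hη
  rw [Function.comp_apply, ← Complex.log_conj]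
  · simp
  · intro h
    rw [Complex.arg_eq_pi_iff] at h
    have := h.2
    simp at this
    exact (mem_Ioi.1 hη).ne' this

/-- The jump of the logarithm, lower boundary value minus upper one. -/
theorem log_ofReal_conj_sub (x : ℝ) : (starRingEnd ℂ) (Complex.log x) - Complex.log x
    = (Iio (0 : ℝ)).indicator (fun _ => -(2 * Real.pi * Complex.I)) x := by
  by_cases hx : x < 0
  · rw [indicator_of_mem (mem_Iio.2 hx)]
    apply Complex.ext
    · simp
    · simp [Complex.log_im, Complex.arg_ofReal_of_neg hx]
      ring
  · rw [indicator_of_notMem (by simpa using hx)]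
    apply Complex.ext
    · simp
    · simp [Complex.log_im, Complex.arg_ofReal_of_nonneg (not_lt.1 hx)]

/-- The kernel has the primitive -1/(2(w² - a²)). -/
theorem integral_argKernel_horizontal {a u v : ℝ} (ha : 0 < a) (hu : 0 ≤ u) (hv : 0 < v) :
    (∫ x : ℝ in 0..u, argKernel a (x + v * Complex.I)) =
      -(1 / (2 * ((u + v * Complex.I) ^ 2 - (a : ℂ) ^ 2))) - 1 / (2 * ((v : ℂ) ^ 2 + a ^ 2)) := by
  have hne : ∀ x ∈ uIcc 0 u, ((x : ℂ) + v * Complex.I) ^ 2 - (a : ℂ) ^ 2 ≠ 0 := by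
    intro x hx
    rw [uIcc_of_le hu] at hx
    refine sq_sub_sq_ne_zero ha (by simpa using hx.1) fun h => hv.ne' ?_
    simpa using congrArg Complex.im h
  have hder : ∀ x ∈ uIcc 0 u, HasDerivAt
      (fun x : ℝ => -(1 / (2 * (((x : ℂ) + v * Complex.I) ^ 2 - (a : ℂ) ^ 2))))
      (argKernel a (x + v * Complex.I)) x := by
    intro x hx
    have h0 := hne x hx
    have h1 : HasDerivAt (fun w : ℂ => -(1 / (2 * ((w + v * Complex.I) ^ 2 - (a : ℂ) ^ 2))))
        (argKernel a (x + v * Complex.I)) (x : ℂ) := by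
      have h2 : HasDerivAt (fun w : ℂ => 2 * ((w + v * Complex.I) ^ 2 - (a : ℂ) ^ 2))
          (2 * (2 * (x + v * Complex.I))) (x : ℂ) := by
        have := ((((hasDerivAt_id (x : ℂ)).add_const (v * Complex.I)).pow 2).sub_const
          ((a : ℂ) ^ 2)).const_mul 2
        refine this.congr_deriv ?_
        simp
      refine (((hasDerivAt_const (x : ℂ) (1 : ℂ)).fun_div h2 (mul_ne_zero two_ne_zero h0)).fun_neg).congr_deriv ?_
      unfold argKernel
      field_simp
      ring
    exact h1.comp_ofReal
  rw [intervalIntegral.integral_eq_sub_of_hasDerivAt hder]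
  · have e : ((0 : ℝ) + v * Complex.I) ^ 2 - (a : ℂ) ^ 2 = -((v : ℂ) ^ 2 + a ^ 2) := by
      simp only [Complex.ofReal_zero, zero_add, mul_pow, Complex.I_sq]
      ring
    rw [e]
    have h3 : (v : ℂ) ^ 2 + a ^ 2 ≠ 0 := by exact_mod_cast (by positivity : v ^ 2 + a ^ 2 ≠ 0)
    field_simp
  · refine ContinuousOn.intervalIntegrable fun x hx => ?_
    have h1 := (differentiableAt_argKernel (hne x hx)).continuousAt
    exact (ContinuousAt.comp (f := fun x : ℝ => (x : ℂ) + v * Complex.I) h1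
      (by fun_prop)).continuousWithinAt

/-- `log (w - ρ)` minus its first Taylor polynomial at `a`, times the kernel. -/
noncomputable def logTerm (a : ℝ) (ρ w : ℂ) : ℂ :=
  argKernel a w * (Complex.log (w - ρ) - Complex.log (a - ρ) - (a - ρ)⁻¹ * (w - a))

theorem hasDerivAt_log_sub {w ρ : ℂ} (h : w - ρ ∈ Complex.slitPlane) :
    HasDerivAt (fun w => Complex.log (w - ρ)) (w - ρ)⁻¹ w := by
  simpa using ((hasDerivAt_id w).sub_const ρ).clog h

theorem logTerm_rectIntegral_eq_zero {a X y₁ : ℝ} (ha : 0 < a) (haX : a < X) (hy : 0 < y₁)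
    {ρ : ℂ} {U : Set ℂ} (hU : IsOpen U) (hUR : Icc 0 X ×ℂ Icc 0 y₁ ⊆ U)
    (hρ : ∀ w ∈ U, w - ρ ∈ Complex.slitPlane) :
    RectIntegrable X 0 y₁ (logTerm a ρ) ∧ rectIntegral X 0 y₁ (logTerm a ρ) = 0 := by
  refine argKernel_mul_rectIntegral_eq_zero ha haX hy hU hUR (L := fun w => Complex.log (w - ρ))
    (fun w hw => (hasDerivAt_log_sub (hρ w hw)).differentiableAt.differentiableWithinAt)
    (hasDerivAt_log_sub (hρ _ (hUR ?_)))
  simp [Complex.mem_reProdIm, ha.le, haX.le, hy.le]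

/-- Above the height of ρ there is neither the cut nor the pole a, which is real, so Cauchy's
theorem applies directly. -/
theorem logTerm_rectIntegral_above {a X y₀ y₁ : ℝ} (ha : 0 < a) (haX : a < X)
    {ρ : ℂ} (him : 0 < ρ.im) (h0 : ρ.im < y₀) (hy : y₀ ≤ y₁) :
    RectIntegrable X y₀ y₁ (logTerm a ρ) ∧ rectIntegral X y₀ y₁ (logTerm a ρ) = 0 := by
  have hX : 0 ≤ X := (ha.trans haX).le
  have hd : DifferentiableOn ℂ (logTerm a ρ) (Icc 0 X ×ℂ Icc y₀ y₁) := by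
    intro w hw
    rw [Complex.mem_reProdIm] at hw
    have h1 : w ^ 2 - (a : ℂ) ^ 2 ≠ 0 := sq_sub_sq_ne_zero ha hw.1.1 fun h => by
      have := hw.2.1
      simp only [h, Complex.ofReal_im] at this
      linarith
    have h2 : w - ρ ∈ Complex.slitPlane := Or.inr (by
      have := hw.2.1
      simp only [Complex.sub_im]
      linarith)
    refine ((differentiableAt_argKernel h1).mul ?_).differentiableWithinAt
    exact ((hasDerivAt_log_sub h2).differentiableAt.sub_const _).sub (by fun_prop)
  exact ⟨.of_continuousOn hX hy hd.continuousOn, rectIntegral_eq_zero hX hy hd⟩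

theorem isOpen_im_lt (v : ℝ) : IsOpen {w : ℂ | w.im < v} :=
  isOpen_lt Complex.continuous_im continuous_const

theorem logTerm_rectIntegral_below {a X y₁ : ℝ} (ha : 0 < a) (haX : a < X)
    {ρ : ℂ} (hy : 0 < y₁) (h1 : y₁ < ρ.im) :
    RectIntegrable X 0 y₁ (logTerm a ρ) ∧ rectIntegral X 0 y₁ (logTerm a ρ) = 0 := by
  refine logTerm_rectIntegral_eq_zero ha haX hy (isOpen_im_lt ρ.im) (fun w hw => ?_) fun w hw => ?_
  · exact (Complex.mem_reProdIm.1 hw).2.2.trans_lt h1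
  · refine Or.inr ?_
    have : w.im < ρ.im := hw
    simp only [Complex.sub_im]
    linarith

theorem logTerm_rectIntegrable {a X T : ℝ} (ha : 0 < a) (haX : a < X)
    {ρ : ℂ} (him : 0 < ρ.im) (hT : ρ.im < T) : RectIntegrable X 0 T (logTerm a ρ) := by
  have ver : ∀ x : ℝ, 0 ≤ x → x ≠ a →
      IntervalIntegrable (fun y : ℝ => logTerm a ρ (x + y * Complex.I)) volume 0 T := by
    intro x hx0 hxa
    have hk : ContinuousOn (fun y : ℝ => argKernel a (x + y * Complex.I)) (uIcc 0 T) := by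
      intro y _
      have h1 := differentiableAt_argKernel (sq_sub_sq_ne_zero ha (w := x + y * Complex.I)
        (by simpa using hx0) fun h => hxa (by simpa using congrArg Complex.re h))
      exact (ContinuousAt.comp (f := fun y : ℝ => (x : ℂ) + y * Complex.I) h1.continuousAt
        (by fun_prop)).continuousWithinAt
    refine IntervalIntegrable.continuousOn_mul ?_ hk
    refine ((intervalIntegrable_log_vertical x ρ 0 T).sub intervalIntegrable_const).sub ?_
    exact Continuous.intervalIntegrable (by fun_prop) _ _
  -- The bottom and top sides are also sides of rectangles that avoid the cut, so their
  -- integrability is already known.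
  exact ⟨(logTerm_rectIntegral_below ha haX (half_pos him) (half_lt_self him)).1.bot,
    (logTerm_rectIntegral_above ha haX him hT le_rfl).1.top,
    ver X (ha.trans haX).le haX.ne', ver 0 le_rfl ha.ne⟩

/-- Removes a strip of half width ε about the height v. With v = ρ.im the two remaining rectangles
avoid the cut, and only the edges of the strip survive. -/
theorem rectIntegral_eq_add_gap {X T v ε : ℝ} {h : ℂ → ℂ} (hi : RectIntegrable X 0 T h)
    (hε : 0 < ε) (hv : ε < v) (hT : v + ε < T) :
    rectIntegral X 0 T h = rectIntegral X 0 (v - ε) h + rectIntegral X (v + ε) T h +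
      ((∫ x : ℝ in 0..X, h (x + (v - ε : ℝ) * Complex.I)) -
        (∫ x : ℝ in 0..X, h (x + (v + ε : ℝ) * Complex.I))) +
      Complex.I * ((∫ y : ℝ in (v - ε)..(v + ε), h (X + y * Complex.I)) -
        ∫ y : ℝ in (v - ε)..(v + ε), h ((0 : ℝ) + y * Complex.I)) := by
  have split : ∀ f : ℝ → ℂ, IntervalIntegrable f volume 0 T → (∫ y in (0 : ℝ)..T, f y) =
      (∫ y in (0 : ℝ)..(v - ε), f y) + (∫ y in (v - ε)..(v + ε), f y) + ∫ y in (v + ε)..T, f y := by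
    intro f hf
    have hsub : ∀ p q : ℝ, 0 ≤ p → p ≤ T → 0 ≤ q → q ≤ T → IntervalIntegrable f volume p q := by
      intro p q hp hp' hq hq'
      refine hf.mono_set (uIcc_subset_uIcc ?_ ?_) <;> rw [mem_uIcc] <;> left <;> constructor <;> assumption
    rw [intervalIntegral.integral_add_adjacent_intervals, intervalIntegral.integral_add_adjacent_intervals] <;>
      apply hsub <;> linarith
  simp only [rectIntegral]
  rw [split _ hi.right, split _ hi.left]
  ring

theorem tendsto_integral_gap {f : ℝ → ℂ} {T v : ℝ} (hf : IntervalIntegrable f volume 0 T)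
    (hv : 0 < v) (hT : v < T) :
    Filter.Tendsto (fun ε : ℝ => ∫ y in (v - ε)..(v + ε), f y) (nhdsWithin 0 (Ioi 0)) (nhds 0) := by
  have hc : ContinuousOn (fun y => ∫ s in (0 : ℝ)..y, f s) (Icc 0 T) := by
    have := intervalIntegral.continuousOn_primitive_interval' hf left_mem_uIcc
    rwa [uIcc_of_le (hv.trans hT).le] at this
  have hca : ContinuousAt (fun y => ∫ s in (0 : ℝ)..y, f s) v :=
    hc.continuousAt (Icc_mem_nhds hv hT)
  have h1 : Filter.Tendsto (fun ε : ℝ => v + ε) (nhdsWithin 0 (Ioi 0)) (nhds v) := by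
    have : Continuous fun ε : ℝ => v + ε := by fun_prop
    simpa using (this.tendsto 0).mono_left nhdsWithin_le_nhds
  have h2 : Filter.Tendsto (fun ε : ℝ => v - ε) (nhdsWithin 0 (Ioi 0)) (nhds v) := by
    have : Continuous fun ε : ℝ => v - ε := by fun_prop
    simpa using (this.tendsto 0).mono_left nhdsWithin_le_nhds
  have h3 := (hca.tendsto.comp h1).sub (hca.tendsto.comp h2)
  rw [sub_self] at h3
  refine h3.congr' ?_
  have hev : ∀ᶠ ε in nhdsWithin (0 : ℝ) (Ioi 0), ε ∈ Ioo 0 (min v (T - v)) :=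
    Ioo_mem_nhdsGT (lt_min hv (sub_pos.2 hT))
  filter_upwards [hev] with ε hε
  have e1 := hε.2.trans_le (min_le_left _ _)
  have e2 := hε.2.trans_le (min_le_right _ _)
  refine intervalIntegral.integral_interval_sub_left ?_ ?_ <;>
    refine hf.mono_set (uIcc_subset_uIcc left_mem_uIcc ?_) <;> rw [mem_uIcc] <;> left <;>
    constructor <;> linarith [hε.1]

/-- The contribution of a zero `ρ`, where the logarithm is cut along the half line to the left. -/
theorem logTerm_rectIntegral {a X T : ℝ} (ha : 0 < a) (haX : a < X) {ρ : ℂ} (hre : 0 ≤ ρ.re)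
    (hX : ρ.re ≤ X) (him : 0 < ρ.im) (hT : ρ.im < T) :
    rectIntegral X 0 T (logTerm a ρ) =
      Real.pi * Complex.I * (1 / (ρ ^ 2 - (a : ℂ) ^ 2) + 1 / ((ρ.im : ℂ) ^ 2 + a ^ 2)) := by
  have hi := logTerm_rectIntegrable ha haX him hT
  have hX0 : 0 ≤ X := (ha.trans haX).le
  set P : ℂ → ℂ := fun w => Complex.log (a - ρ) + (a - ρ)⁻¹ * (w - a) with hPdef
  have hP : Continuous P := by fun_prop
  have hform : ∀ w, logTerm a ρ w = argKernel a w * (Complex.log (w - ρ) - P w) := by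
    intro w
    simp only [logTerm, hPdef]
    ring
  have hne : ∀ x : ℝ, x ≠ ρ.re → x - ρ.re ≠ 0 := fun x hx => sub_ne_zero.2 hx
  have hneg : Filter.Tendsto (fun η : ℝ => -η) (nhdsWithin 0 (Ioi 0)) (nhds 0) := by
    have := (continuous_neg (G := ℝ)).tendsto 0
    simpa using this.mono_left (nhdsWithin_le_nhds (s := Ioi 0))
  -- The two horizontal edges of the strip tend to the two boundary values on the cut, while its
  -- vertical edges shrink to nothing.
  have lim_up := tendsto_integral_mul_log hX0 him (continuousOn_argKernel ha) (measurable_argKernel a)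
    hP nhdsWithin_le_nhds (l := nhdsWithin 0 (Ioi 0))
    (Λ := fun x => Complex.log (x - ρ.re : ℝ)) fun x hx => tendsto_log_add_mul_I_right (hne x hx)
  have lim_down := tendsto_integral_mul_log hX0 him (continuousOn_argKernel ha) (measurable_argKernel a)
    hP (l := Filter.map (fun η : ℝ => -η) (nhdsWithin 0 (Ioi 0))) hneg
    (Λ := fun x => (starRingEnd ℂ) (Complex.log (x - ρ.re : ℝ))) fun x hx =>
      Filter.tendsto_map'_iff.2 (tendsto_log_sub_mul_I_right (hne x hx))
  rw [Filter.tendsto_map'_iff] at lim_down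
  have lim := (lim_down.sub lim_up).add
    (((tendsto_integral_gap hi.right him hT).sub (tendsto_integral_gap hi.left him hT)).const_mul
      Complex.I)
  have hconst : Filter.Tendsto (fun _ : ℝ => rectIntegral X 0 T (logTerm a ρ))
      (nhdsWithin 0 (Ioi 0)) (nhds (rectIntegral X 0 T (logTerm a ρ))) := tendsto_const_nhds
  have hev : ∀ᶠ ε in nhdsWithin (0 : ℝ) (Ioi 0), ε ∈ Ioo 0 (min ρ.im (T - ρ.im)) :=
    Ioo_mem_nhdsGT (lt_min him (sub_pos.2 hT))
  have huniq := tendsto_nhds_unique_of_eventuallyEq hconst lim (by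
    filter_upwards [hev] with ε hε
    have e1 := hε.2.trans_le (min_le_left _ _)
    have e2 := hε.2.trans_le (min_le_right _ _)
    rw [rectIntegral_eq_add_gap hi hε.1 e1 (by linarith),
      (logTerm_rectIntegral_below ha haX (by linarith) (by linarith [hε.1])).2,
      (logTerm_rectIntegral_above ha haX him (by linarith [hε.1]) (by linarith)).2]
    simp only [hform, Function.comp_apply, ← sub_eq_add_neg]
    ring)
  rw [huniq, sub_self, mul_zero, add_zero]
  have hlogi : IntervalIntegrable (fun x : ℝ => Complex.log (x - ρ.re : ℝ)) volume 0 X := by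
    have := intervalIntegrable_log_horizontal 0 ρ.re 0 X
    simpa using this
  have hlogc : IntervalIntegrable (fun x : ℝ => (starRingEnd ℂ) (Complex.log (x - ρ.re : ℝ)))
      volume 0 X := by
    refine hlogi.mono_fun ?_ (Filter.Eventually.of_forall fun x => by simp)
    exact Complex.continuous_conj.comp_aestronglyMeasurable hlogi.aestronglyMeasurable_restrict_uIoc
  have hkc : ContinuousOn (fun x : ℝ => argKernel a (x + ρ.im * Complex.I)) (uIcc 0 X) := by
    rw [uIcc_of_le hX0]
    refine (continuousOn_argKernel ha).comp (by fun_prop) fun x hx => ?_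
    simpa using ⟨hx.1, him⟩
  have hPi : IntervalIntegrable (fun x : ℝ => P (x + ρ.im * Complex.I)) volume 0 X :=
    Continuous.intervalIntegrable (by fun_prop) _ _
  rw [← intervalIntegral.integral_sub ((hlogc.sub hPi).continuousOn_mul hkc)
    ((hlogi.sub hPi).continuousOn_mul hkc)]
  -- The Taylor polynomial P is the same on both sides and cancels; the jump -2πi is present only
  -- for x < Re ρ.
  have hstep : (∫ x : ℝ in 0..X, (argKernel a (x + ρ.im * Complex.I) *
        ((starRingEnd ℂ) (Complex.log (x - ρ.re : ℝ)) - P (x + ρ.im * Complex.I)) -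
      argKernel a (x + ρ.im * Complex.I) *
        (Complex.log (x - ρ.re : ℝ) - P (x + ρ.im * Complex.I)))) =
      ∫ x : ℝ in 0..ρ.re, -(2 * Real.pi * Complex.I) * argKernel a (x + ρ.im * Complex.I) := by
    rw [intervalIntegral.integral_of_le hX0, intervalIntegral.integral_of_le hre,
      integral_Ioc_eq_integral_Ioo (x := 0) (y := ρ.re),
      show Ioo 0 ρ.re = Ioc 0 X ∩ Iio ρ.re by
        ext x
        simp only [mem_Ioo, mem_inter_iff, mem_Ioc, mem_Iio]
        exact ⟨fun h => ⟨⟨h.1, h.2.le.trans hX⟩, h.2⟩, fun h => ⟨h.1.1, h.2⟩⟩,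
      ← setIntegral_indicator measurableSet_Iio]
    refine setIntegral_congr_fun measurableSet_Ioc fun x _ => ?_
    rw [← mul_sub, sub_sub_sub_cancel_right, log_ofReal_conj_sub]
    by_cases hx : x < ρ.re
    · rw [indicator_of_mem (mem_Iio.2 (sub_neg.2 hx)), indicator_of_mem (mem_Iio.2 hx)]
      ring
    · rw [indicator_of_notMem (s := Iio (0 : ℝ)) (by simpa using hx),
        indicator_of_notMem (s := Iio ρ.re) (by simpa using hx), mul_zero]
  rw [hstep, intervalIntegral.integral_const_mul, integral_argKernel_horizontal ha hre him,
    Complex.re_add_im]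
  have h2 : ρ ^ 2 - (a : ℂ) ^ 2 ≠ 0 := sq_sub_sq_ne_zero ha hre fun h => by simp [h] at him
  have h3 : (ρ.im : ℂ) ^ 2 + a ^ 2 ≠ 0 := by
    exact_mod_cast (by positivity : ρ.im ^ 2 + a ^ 2 ≠ 0)
  field_simp
  ring

/-- The sign of the contribution of a zero `ρ`. -/
theorem zero_excess {a : ℝ} (ha : 0 < a) {ρ : ℂ} (him : 0 < ρ.im)
    (h3 : a ^ 2 < 3 * ρ.im ^ 2 + ρ.re ^ 2) :
    0 ≤ (Real.pi * Complex.I * (1 / (ρ ^ 2 - (a : ℂ) ^ 2) + 1 / ((ρ.im : ℂ) ^ 2 + a ^ 2))).im ∧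
    (0 < ρ.re →
      0 < (Real.pi * Complex.I * (1 / (ρ ^ 2 - (a : ℂ) ^ 2) + 1 / ((ρ.im : ℂ) ^ 2 + a ^ 2))).im) ∧
    (ρ.re = 0 →
      (Real.pi * Complex.I * (1 / (ρ ^ 2 - (a : ℂ) ^ 2) + 1 / ((ρ.im : ℂ) ^ 2 + a ^ 2))).im = 0) := by
  set u := ρ.re
  set v := ρ.im
  have hval : (Real.pi * Complex.I * (1 / (ρ ^ 2 - (a : ℂ) ^ 2) + 1 / ((v : ℂ) ^ 2 + a ^ 2))).im =
      Real.pi * ((u ^ 2 - v ^ 2 - a ^ 2) / ((u ^ 2 - v ^ 2 - a ^ 2) ^ 2 + (2 * u * v) ^ 2) +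
        1 / (v ^ 2 + a ^ 2)) := by
    have e1 : ρ ^ 2 - (a : ℂ) ^ 2 = ((u ^ 2 - v ^ 2 - a ^ 2 : ℝ) : ℂ) + ((2 * u * v : ℝ) : ℂ) * Complex.I := by
      apply Complex.ext
      · simp [pow_two, u, v]
      · simp [pow_two, u, v]
        ring
    have e2 : (1 / ((v : ℂ) ^ 2 + a ^ 2)) = ((1 / (v ^ 2 + a ^ 2) : ℝ) : ℂ) := by push_cast; rfl
    rw [e1, e2, mul_assoc, Complex.im_ofReal_mul, mul_comm Complex.I, Complex.mul_I_im,
      Complex.add_re, Complex.ofReal_re, one_div, Complex.inv_re, Complex.normSq_add_mul_I,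
      Complex.add_re, Complex.ofReal_re, Complex.re_ofReal_mul, Complex.I_re, mul_zero, add_zero,
      one_div]
  rw [hval]
  have hd2 : 0 < v ^ 2 + a ^ 2 := by positivity
  have hd1 : 0 < (u ^ 2 - v ^ 2 - a ^ 2) ^ 2 + (2 * u * v) ^ 2 := by
    by_cases hu : u = 0
    · rw [hu]
      have : 0 < (v ^ 2 + a ^ 2) ^ 2 := by positivity
      nlinarith
    · have : 0 < (2 * u * v) ^ 2 := by
        have := him.ne'
        positivity
      positivity
  -- Over a common denominator the numerator factors, which displays both the sign and the vanishing
  -- at u = 0.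
  have hcomb : (u ^ 2 - v ^ 2 - a ^ 2) / ((u ^ 2 - v ^ 2 - a ^ 2) ^ 2 + (2 * u * v) ^ 2) +
      1 / (v ^ 2 + a ^ 2) = u ^ 2 * (3 * v ^ 2 + u ^ 2 - a ^ 2) /
        (((u ^ 2 - v ^ 2 - a ^ 2) ^ 2 + (2 * u * v) ^ 2) * (v ^ 2 + a ^ 2)) := by
    rw [div_add_div _ _ hd1.ne' hd2.ne']
    congr 1
    ring
  rw [hcomb]
  have hpos : 0 < 3 * v ^ 2 + u ^ 2 - a ^ 2 := by linarith
  have hpi := Real.pi_pos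
  refine ⟨by positivity, fun hu => by positivity, fun hu => by simp [hu]⟩

/-! ### A logarithm of (s - 1)ζ(s) on a rectangle -/

/-- `(s - 1) ζ(s)` in the coordinate `w = s - b`. -/
noncomputable def shiftedZeta (b : ℝ) (w : ℂ) : ℂ := riemannZeta₁ (b + w)

theorem differentiable_shiftedZeta (b : ℝ) : Differentiable ℂ (shiftedZeta b) := by
  unfold shiftedZeta
  fun_prop

theorem shiftedZeta_one_sub (b : ℝ) : shiftedZeta b ((1 - b : ℝ) : ℂ) = 1 := by
  simp [shiftedZeta]

/-- The source of γ in the theorem: (s - 1)ζ(s) = 1 + γ(s - 1) + ... at s = 1. -/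
theorem hasDerivAt_shiftedZeta (b : ℝ) :
    HasDerivAt (shiftedZeta b) Real.eulerMascheroniConstant ((1 - b : ℝ) : ℂ) := by
  have h1 : HasDerivAt riemannZeta₁ Real.eulerMascheroniConstant 1 := by
    have := (differentiable_riemannZeta₁ 1).hasDerivAt
    rwa [deriv_riemannZeta₁_one] at this
  have h2 : HasDerivAt riemannZeta₁ Real.eulerMascheroniConstant (b + ((1 - b : ℝ) : ℂ)) := by
    convert h1 using 1
    simp
  exact h2.comp_const_add (b : ℂ) _

/-- Supplies `zero_excess`, and shows that no zero meets the bottom side and that the cuts do not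
reach the pole at 1 - b. -/
theorem shiftedZeta_zero_bounds {b : ℝ} (hb : 1 / 2 ≤ b) {ρ : ℂ} (h0 : shiftedZeta b ρ = 0)
    (hre : 0 ≤ ρ.re) :
    ρ.re < 1 - b ∧ ρ.im ≠ 0 ∧ (1 - b) ^ 2 < 3 * ρ.im ^ 2 + ρ.re ^ 2 := by
  have hs : 1 / 2 ≤ ((b : ℂ) + ρ).re := by simp; linarith
  have h1 : ((b : ℂ) + ρ).re < 1 := by
    by_contra h
    exact riemannZeta₁_ne_zero_of_one_le_re (not_lt.1 h) h0
  have h2 := le_im_sq_of_riemannZeta₁_eq_zero hs h0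
  have h3 : (3 / 5) ^ 2 ≤ ‖(b : ℂ) + ρ - 1‖ ^ 2 := by
    gcongr
    exact le_norm_sub_one_of_riemannZeta₁_eq_zero hs h0
  rw [Complex.sq_norm, Complex.normSq_apply] at h3
  simp only [Complex.sub_re, Complex.one_re, Complex.sub_im, Complex.one_im, Complex.add_re,
    Complex.add_im, Complex.ofReal_re, Complex.ofReal_im, zero_add, sub_zero] at h1 h2 h3
  refine ⟨by linarith, fun h => by norm_num [h] at h2, ?_⟩
  -- With a = 1 - b and d = a - ρ.re, distance 3/5 gives 3·ρ.im² ≥ 27/25 - 3d², and a² - ρ.re² + 3d²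
  -- = 2ad + 2d² ≤ 4a² ≤ 1.
  nlinarith

theorem shiftedZeta_im_ofReal (b x : ℝ) : (shiftedZeta b x).im = 0 := by
  have := riemannZeta₁_ofReal_im (b + x)
  simpa [shiftedZeta] using this

/-- The branch of the logarithm of a product that is normalised to vanish at `c`. -/
noncomputable def sumLog (S : Multiset ℂ) (ℓ : ℂ → ℂ) (c w : ℂ) : ℂ :=
  (S.map fun ρ => Complex.log (w - ρ) - Complex.log (c - ρ)).sum + (ℓ w - ℓ c)

theorem sumLog_self (S : Multiset ℂ) (ℓ : ℂ → ℂ) (c : ℂ) : sumLog S ℓ c c = 0 := by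
  simp [sumLog]

theorem exp_sumLog {S : Multiset ℂ} {ℓ : ℂ → ℂ} {c w : ℂ} (hc : ∀ ρ ∈ S, c ≠ ρ)
    (hw : ∀ ρ ∈ S, w ≠ ρ) : Complex.exp (sumLog S ℓ c w) =
      ((S.map (w - ·)).prod * Complex.exp (ℓ w)) / ((S.map (c - ·)).prod * Complex.exp (ℓ c)) := by
  have h1 : Complex.exp ((S.map fun ρ => Complex.log (w - ρ) - Complex.log (c - ρ)).sum) =
      (S.map (w - ·)).prod / (S.map (c - ·)).prod := by
    rw [Complex.exp_multiset_sum, Multiset.map_map, ← Multiset.prod_map_div]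
    refine congrArg _ (Multiset.map_congr rfl fun ρ hρ => ?_)
    rw [Function.comp_apply, Complex.exp_sub, Complex.exp_log (sub_ne_zero.2 (hw ρ hρ)),
      Complex.exp_log (sub_ne_zero.2 (hc ρ hρ))]
  rw [sumLog, Complex.exp_add, h1, Complex.exp_sub, mul_div_mul_comm]

theorem hasDerivAt_sumLog {S : Multiset ℂ} {ℓ : ℂ → ℂ} {c w d : ℂ}
    (hS : ∀ ρ ∈ S, w - ρ ∈ Complex.slitPlane) (hℓ : HasDerivAt ℓ d w) :
    HasDerivAt (sumLog S ℓ c) ((S.map fun ρ => (w - ρ)⁻¹).sum + d) w := by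
  have h1 : HasDerivAt
      (fun w => (S.map fun ρ => Complex.log (w - ρ) - Complex.log (c - ρ)).sum)
      ((S.map fun ρ => (w - ρ)⁻¹).sum) w := by
    induction S using Multiset.induction with
    | empty => simpa using hasDerivAt_const w (0 : ℂ)
    | cons ρ S ih =>
      simp only [Multiset.map_cons, Multiset.sum_cons]
      exact ((hasDerivAt_log_sub (hS ρ (Multiset.mem_cons_self ρ S))).sub_const _).add
        (ih fun σ hσ => hS σ (Multiset.mem_cons_of_mem hσ))
  exact h1.add (hℓ.sub_const _)

/-- The imaginary part is continuous with values in πℤ; leaving 0, it would pass through ±π/2. -/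
theorem im_eq_zero_of_exp_real {L : ℝ → ℂ} {p q x y : ℝ} (hL : ContinuousOn L (Icc p q))
    (hr : ∀ x ∈ Icc p q, (Complex.exp (L x)).im = 0) (hx : x ∈ Icc p q) (hy : y ∈ Icc p q)
    (h0 : (L x).im = 0) : (L y).im = 0 := by
  have hsin : ∀ x ∈ Icc p q, Real.sin (L x).im = 0 := by
    intro x hx
    have := hr x hx
    rw [Complex.exp_im] at this
    exact (mul_eq_zero.1 this).resolve_left (Real.exp_ne_zero _)
  by_contra hne
  have hsub : uIcc x y ⊆ Icc p q := uIcc_subset_Icc hx hy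
  have hc : ContinuousOn (fun x => (L x).im) (uIcc x y) :=
    Complex.continuous_im.comp_continuousOn (hL.mono hsub)
  have hivt := intermediate_value_uIcc hc
  have hpi := Real.pi_pos
  rcases lt_or_gt_of_ne hne with hlt | hgt
  · have hle : (L y).im ≤ -Real.pi := by
      by_contra h
      exact (Real.sin_neg_of_neg_of_neg_pi_lt hlt (not_le.1 h)).ne (hsin y hy)
    obtain ⟨z, hz, hz'⟩ := hivt (show -(Real.pi / 2) ∈ _ by
      rw [h0, mem_uIcc]
      right
      constructor <;> linarith)
    have := hsin z (hsub hz)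
    simp only [hz', Real.sin_neg, Real.sin_pi_div_two] at this
    norm_num at this
  · have hle : Real.pi ≤ (L y).im := by
      by_contra h
      exact (Real.sin_pos_of_pos_of_lt_pi hgt (not_le.1 h)).ne' (hsin y hy)
    obtain ⟨z, hz, hz'⟩ := hivt (show Real.pi / 2 ∈ _ by
      rw [h0, mem_uIcc]
      left
      constructor <;> linarith)
    have := hsin z (hsub hz)
    simp only [hz', Real.sin_pi_div_two] at this
    norm_num at this

/-- The rectangle integral of a single logarithmic term for a zero of `ζ`. -/
theorem logTerm_rectIntegral_zero {b X T : ℝ} (hb : 1 / 2 ≤ b) (hb1 : b < 1) (hX : 1 - b < X)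
    (hT : 0 < T) {ρ : ℂ} (h0 : shiftedZeta b ρ = 0) (hρT : 0 ≤ ρ.re → ρ.im ≠ T) :
    RectIntegrable X 0 T (logTerm (1 - b) ρ) ∧
      0 ≤ (rectIntegral X 0 T (logTerm (1 - b) ρ)).im ∧
      (ρ.re ≤ 0 → (rectIntegral X 0 T (logTerm (1 - b) ρ)).im = 0) ∧
      (0 ≤ ρ.re → 0 < ρ.im → ρ.im < T → rectIntegral X 0 T (logTerm (1 - b) ρ) =
        Real.pi * Complex.I * (1 / (ρ ^ 2 - ((1 - b : ℝ) : ℂ) ^ 2) +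
          1 / ((ρ.im : ℂ) ^ 2 + (1 - b : ℝ) ^ 2))) := by
  have ha : 0 < 1 - b := by linarith
  -- The cut misses the rectangle if it starts to the left of it, or runs below or above it; only
  -- the remaining zeros contribute.
  by_cases hre : ρ.re < 0
  · have h := logTerm_rectIntegral_eq_zero (ρ := ρ) (U := {w | ρ.re < w.re}) ha hX hT
      (isOpen_lt continuous_const Complex.continuous_re)
      (fun w hw => hre.trans_le (Complex.mem_reProdIm.1 hw).1.1)
      (fun w (hw : ρ.re < w.re) => Or.inl (by simpa using hw))
    refine ⟨h.1, by simp [h.2], fun _ => by simp [h.2], fun h' => absurd hre (not_lt.2 h')⟩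
  rw [not_lt] at hre
  obtain ⟨h1, h2, h3⟩ := shiftedZeta_zero_bounds hb h0 hre
  rcases lt_or_gt_of_ne h2 with him | him
  · have h := logTerm_rectIntegral_eq_zero (ρ := ρ) (U := {w | ρ.im < w.im}) ha hX hT
      (isOpen_lt continuous_const Complex.continuous_im)
      (fun w hw => him.trans_le (Complex.mem_reProdIm.1 hw).2.1)
      (fun w (hw : ρ.im < w.im) => Or.inr (by simpa [sub_eq_zero] using hw.ne'))
    refine ⟨h.1, by simp [h.2], fun _ => by simp [h.2], fun _ h' => absurd him (not_lt.2 h'.le)⟩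
  · rcases lt_or_gt_of_ne (hρT hre) with hlt | hgt
    · have h := logTerm_rectIntegral ha hX hre (h1.trans hX).le him hlt
      have hz := zero_excess ha him h3
      refine ⟨logTerm_rectIntegrable ha hX him hlt, by rw [h]; exact hz.1, fun h' => ?_, fun _ _ _ => h⟩
      rw [h]
      exact hz.2.2 (le_antisymm h' hre)
    · have h := logTerm_rectIntegral_below ha hX hT hgt
      refine ⟨h.1, by simp [h.2], fun _ => by simp [h.2], fun _ _ h' => absurd hgt (not_lt.2 h'.le)⟩

/-- The kernel times the logarithm minus its Taylor polynomial at the pole. -/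
noncomputable def rectTerm (b : ℝ) (L : ℂ → ℂ) (w : ℂ) : ℂ :=
  argKernel (1 - b) w * (L w - Real.eulerMascheroniConstant * (w - (1 - b : ℝ)))

theorem rectIntegral_const_zero (X y₀ y₁ : ℝ) : rectIntegral X y₀ y₁ (fun _ => 0) = 0 := by
  simp [rectIntegral]

/-- All contributions are nonnegative, so each single one is a lower bound for the sum. -/
theorem rectIntegral_logTerm_sum {b X T : ℝ} (hb : 1 / 2 ≤ b) (hb1 : b < 1) (hX : 1 - b < X)
    (hT : 0 < T) {S : Multiset ℂ} (h0 : ∀ ρ ∈ S, shiftedZeta b ρ = 0)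
    (hρT : ∀ ρ ∈ S, 0 ≤ ρ.re → ρ.im ≠ T) :
    RectIntegrable X 0 T (fun w => (S.map fun ρ => logTerm (1 - b) ρ w).sum) ∧
      0 ≤ (rectIntegral X 0 T fun w => (S.map fun ρ => logTerm (1 - b) ρ w).sum).im ∧
      ((∀ ρ ∈ S, ρ.re ≤ 0) →
        (rectIntegral X 0 T fun w => (S.map fun ρ => logTerm (1 - b) ρ w).sum).im = 0) ∧
      ∀ ρ ∈ S, (rectIntegral X 0 T (logTerm (1 - b) ρ)).im ≤
        (rectIntegral X 0 T fun w => (S.map fun ρ => logTerm (1 - b) ρ w).sum).im := by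
  induction S using Multiset.induction with
  | empty =>
    simp only [Multiset.map_zero, Multiset.sum_zero, rectIntegral_const_zero]
    exact ⟨⟨by simp, by simp, by simp, by simp⟩, by simp, by simp, by simp⟩
  | cons σ S ih =>
    obtain ⟨i1, i2, i3, i4⟩ := ih (fun ρ hρ => h0 ρ (Multiset.mem_cons_of_mem hρ))
      (fun ρ hρ => hρT ρ (Multiset.mem_cons_of_mem hρ))
    obtain ⟨j1, j2, j3, -⟩ := logTerm_rectIntegral_zero hb hb1 hX hT
      (h0 σ (Multiset.mem_cons_self σ S)) (hρT σ (Multiset.mem_cons_self σ S))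
    simp only [Multiset.map_cons, Multiset.sum_cons]
    rw [rectIntegral_add j1 i1, Complex.add_im]
    refine ⟨j1.add i1, by linarith, fun h => ?_, fun ρ hρ => ?_⟩
    · rw [j3 (h σ (Multiset.mem_cons_self σ S)),
        i3 fun ρ hρ => h ρ (Multiset.mem_cons_of_mem hρ), add_zero]
    · rcases Multiset.mem_cons.1 hρ with rfl | hρ
      · linarith
      · linarith [i4 ρ hρ]

theorem zetaArgPath_re_im {b t : ℝ} {z : ℂ} (hz : z ∈ zetaArgPath b t) :
    (z.re = 2 ∧ z.im ∈ uIcc 0 t) ∨ (z.im = t ∧ z.re ∈ uIcc 2 b) := by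
  rcases hz with hz | hz
  · left
    rw [segment_eq_image'] at hz
    obtain ⟨θ, hθ, rfl⟩ := hz
    refine ⟨by simp, ?_⟩
    rw [← segment_eq_uIcc, segment_eq_image']
    exact ⟨θ, hθ, by simp⟩
  · right
    rw [segment_eq_image'] at hz
    obtain ⟨θ, hθ, rfl⟩ := hz
    refine ⟨by simp, ?_⟩
    rw [← segment_eq_uIcc, segment_eq_image']
    exact ⟨θ, hθ, by simp⟩

/-- Passes from a logarithm of (s - 1)ζ(s) to an argument of ζ(s), with q = s - 1. -/
theorem eq_norm_mul_exp_im {z L q : ℂ} (hq : q ≠ 0) (h : Complex.exp L = q * z) :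
    z = ‖z‖ * Complex.exp ((L.im - Complex.arg q : ℝ) * Complex.I) := by
  have h1 : ‖z‖ = Real.exp L.re / ‖q‖ := by
    have := congrArg norm h
    rw [Complex.norm_exp, norm_mul] at this
    rw [this, mul_div_cancel_left₀ _ (norm_ne_zero_iff.2 hq)]
  have h2 := Complex.norm_mul_exp_arg_mul_I q
  have h3 : Complex.exp L = Real.exp L.re * Complex.exp (L.im * Complex.I) := by
    rw [Complex.ofReal_exp, ← Complex.exp_add, Complex.re_add_im]
  have hq' : (‖q‖ : ℂ) ≠ 0 := by exact_mod_cast norm_ne_zero_iff.2 hq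
  have h4 : z = Complex.exp L / q := by rw [h, mul_div_cancel_left₀ _ hq]
  rw [h1, h4, h3]
  push_cast
  rw [sub_mul, Complex.exp_sub]
  nth_rewrite 1 [← h2]
  have := Complex.exp_ne_zero (Complex.arg q * Complex.I)
  field_simp

theorem measurable_sumLog (S : Multiset ℂ) {ℓ : ℂ → ℂ} (hℓ : Measurable ℓ) (c : ℂ) :
    Measurable (sumLog S ℓ c) := by
  have h1 : Measurable
      (fun w => (S.map fun ρ => Complex.log (w - ρ) - Complex.log (c - ρ)).sum) := by
    induction S using Multiset.induction with
    | empty => simp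
    | cons ρ S ih =>
      simp only [Multiset.map_cons, Multiset.sum_cons]
      fun_prop
  exact h1.add (hℓ.sub_const _)

/-- Each factor contributes a difference of two principal arguments. -/
theorem abs_im_sumLog_sub_le (S : Multiset ℂ) (ℓ : ℂ → ℂ) (c w : ℂ) :
    |(sumLog S ℓ c w).im - (ℓ w - ℓ c).im| ≤ S.card * (2 * Real.pi) := by
  rw [sumLog, Complex.add_im, add_sub_cancel_right]
  induction S using Multiset.induction with
  | empty => simp
  | cons ρ S ih =>
    simp only [Multiset.map_cons, Multiset.sum_cons, Multiset.card_cons, Complex.add_im,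
      Complex.sub_im, Complex.log_im] at ih ⊢
    push_cast
    have h1 := abs_le.1 (Complex.abs_arg_le_pi (w - ρ))
    have h2 := abs_le.1 (Complex.abs_arg_le_pi (c - ρ))
    rw [abs_le] at ih ⊢
    constructor <;> linarith [h1.1, h1.2, h2.1, h2.2, ih.1, ih.2]

/-- As γ is the sum of the logarithmic derivatives of the factors at the pole, the Taylor polynomial
can be distributed over them. -/
theorem rectTerm_sumLog (b : ℝ) (S : Multiset ℂ) (ℓ : ℂ → ℂ) {d : ℂ}
    (hsum : (S.map fun ρ => (((1 - b : ℝ) : ℂ) - ρ)⁻¹).sum + d = Real.eulerMascheroniConstant)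
    (w : ℂ) : rectTerm b (sumLog S ℓ (1 - b : ℝ)) w =
      (S.map fun ρ => logTerm (1 - b) ρ w).sum + argKernel (1 - b) w *
        (ℓ w - ℓ (1 - b : ℝ) - d * (w - (1 - b : ℝ))) := by
  rw [rectTerm, sumLog, ← hsum]
  simp only [logTerm]
  rw [Multiset.sum_map_mul_left, Multiset.sum_map_sub (g := fun ρ => (((1 - b : ℝ) : ℂ) - ρ)⁻¹ * _),
    Multiset.sum_map_mul_right]
  ring

/-- A logarithm of `(s - 1) ζ(s)` on a rectangle, with the value of the boundary integral. -/
theorem exists_log_rect {b X T : ℝ} (hb : 1 / 2 ≤ b) (hb1 : b < 1) (hX : 2 ≤ X) (hT : 0 < T)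
    (hno : ∀ ρ, shiftedZeta b ρ = 0 → 0 ≤ ρ.re → ρ.im ≠ T) :
    ∃ (L : ℂ → ℂ), Measurable L ∧
      (∃ B, ∀ w ∈ Icc 0 X ×ℂ Icc 0 T, |(L w).im| ≤ B) ∧
      RectIntegrable X 0 T (rectTerm b L) ∧
      0 ≤ (rectIntegral X 0 T (rectTerm b L)).im ∧
      ((∀ ρ, shiftedZeta b ρ = 0 → ρ.re ≤ 0) → (rectIntegral X 0 T (rectTerm b L)).im = 0) ∧
      (∀ ρ, shiftedZeta b ρ = 0 → 0 ≤ ρ.re → 0 < ρ.im → ρ.im < T →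
        (Real.pi * Complex.I * (1 / (ρ ^ 2 - ((1 - b : ℝ) : ℂ) ^ 2) +
          1 / ((ρ.im : ℂ) ^ 2 + (1 - b : ℝ) ^ 2))).im ≤ (rectIntegral X 0 T (rectTerm b L)).im) ∧
      (∀ x ∈ Icc 0 X, (L (x : ℝ)).im = 0) ∧
      (∀ w ∈ Icc 0 X ×ℂ Icc 0 T, shiftedZeta b w ≠ 0 → Complex.exp (L w) = shiftedZeta b w) ∧
      (∀ x ∈ Icc 0 X, ∀ t, 0 < t → t ≤ T → (∀ ρ, shiftedZeta b ρ = 0 → 0 ≤ ρ.re → ρ.im ≠ t) →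
        zetaArg (b + x) t = (L (x + t * Complex.I)).im - Complex.arg (b + x + t * Complex.I - 1)) := by
  have ha : 0 < 1 - b := by linarith
  have haX : 1 - b < X := by linarith
  set c : ℂ := ((1 - b : ℝ) : ℂ) with hcdef
  have hfc : shiftedZeta b c = 1 := shiftedZeta_one_sub b
  have hfd := differentiable_shiftedZeta b
  set R₁ := X + T + 1
  have hR₁ : 0 < R₁ := by positivity
  obtain ⟨M, hM⟩ := (isCompact_sphere c (R₁ + 1)).exists_bound_of_continuousOn
    hfd.continuous.continuousOn
  obtain ⟨S, g, hgd, hfg, -, hg0, -⟩ := exists_factorization hfd hR₁ (lt_add_one R₁) hM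
    (by rw [hfc]; exact one_ne_zero)
  obtain ⟨ℓ, hℓm, hℓd, hℓ⟩ := exists_differentiableOn_exp_eq hR₁ hgd.differentiableOn
    fun z hz => hg0 z (Metric.ball_subset_closedBall hz)
  have hrect : Icc 0 X ×ℂ Icc 0 T ⊆ Metric.ball c R₁ := by
    intro w hw
    rw [Complex.mem_reProdIm] at hw
    rw [Metric.mem_ball, dist_eq_norm]
    have h1 := Complex.norm_le_abs_re_add_abs_im (w - c)
    have h2 : |(w - c).re| ≤ X := by
      simp only [hcdef, Complex.sub_re, Complex.ofReal_re]
      rw [abs_le]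
      constructor <;> linarith [hw.1.1, hw.1.2]
    have h3 : |(w - c).im| ≤ T := by
      simp only [hcdef, Complex.sub_im, Complex.ofReal_im, sub_zero]
      rw [abs_le]
      constructor <;> linarith [hw.2.1, hw.2.2]
    have : R₁ = X + T + 1 := rfl
    linarith
  have hS0 : ∀ ρ ∈ S, shiftedZeta b ρ = 0 := by
    intro ρ hρ
    rw [hfg ρ, Multiset.prod_eq_zero, zero_mul]
    exact Multiset.mem_map.2 ⟨ρ, hρ, sub_self ρ⟩
  have hmemS : ∀ ρ ∈ Metric.ball c R₁, shiftedZeta b ρ = 0 → ρ ∈ S := by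
    intro ρ hρ h0
    rw [hfg ρ] at h0
    have h1 := (mul_eq_zero.1 h0).resolve_right (hg0 ρ (Metric.ball_subset_closedBall hρ))
    rw [Multiset.prod_eq_zero_iff, Multiset.mem_map] at h1
    obtain ⟨σ, hσ, h2⟩ := h1
    rwa [sub_eq_zero.1 h2]
  have hcS : ∀ ρ ∈ S, c ≠ ρ := by
    rintro ρ hρ rfl
    rw [hS0 c hρ] at hfc
    exact zero_ne_one hfc
  have hslit : ∀ w : ℂ, 0 ≤ w.re → (∀ ρ, shiftedZeta b ρ = 0 → 0 ≤ ρ.re → ρ.re < w.re ∨ ρ.im ≠ w.im) →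
      ∀ ρ ∈ S, w - ρ ∈ Complex.slitPlane := by
    intro w hw h ρ hρ
    by_cases hre : 0 ≤ ρ.re
    · rcases h ρ (hS0 ρ hρ) hre with h1 | h1
      · exact Or.inl (by simpa using h1)
      · exact Or.inr (by simpa [sub_eq_zero] using h1.symm)
    · exact Or.inl (by simp; linarith)
  have hcball : c ∈ Metric.ball c R₁ := Metric.mem_ball_self hR₁
  have hℓat : ∀ w ∈ Metric.ball c R₁, DifferentiableAt ℂ ℓ w := fun w hw =>
    hℓd.differentiableAt (Metric.isOpen_ball.mem_nhds hw)
  have hexp : ∀ w ∈ Metric.ball c R₁, shiftedZeta b w ≠ 0 →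
      Complex.exp (sumLog S ℓ c w) = shiftedZeta b w := by
    intro w hw h0
    have hwS : ∀ ρ ∈ S, w ≠ ρ := by
      rintro ρ hρ rfl
      exact h0 (hS0 _ hρ)
    rw [exp_sumLog hcS hwS, hℓ w hw, hℓ c hcball, ← hfg, ← hfg, hfc, div_one]
  have hcontat : ∀ w ∈ Metric.ball c R₁, 0 ≤ w.re →
      (∀ ρ, shiftedZeta b ρ = 0 → 0 ≤ ρ.re → ρ.re < w.re ∨ ρ.im ≠ w.im) →
      ContinuousAt (sumLog S ℓ c) w := fun w hw hre h =>
    (hasDerivAt_sumLog (hslit w hre h) (hℓat w hw).hasDerivAt).continuousAt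
  have hcre : c.re = 1 - b := Complex.ofReal_re _
  have hcim : c.im = 0 := Complex.ofReal_im _
  have hcslit := hslit c (by rw [hcre]; exact ha.le) fun ρ h0 hre =>
    Or.inl (by rw [hcre]; exact (shiftedZeta_zero_bounds hb h0 hre).1)
  -- Near c the exponential of the logarithm is f, and f(c) = 1, so its derivative at c is f'(c) =
  -- γ.
  have hsum : (S.map fun ρ => (c - ρ)⁻¹).sum + deriv ℓ c = Real.eulerMascheroniConstant := by
    have h1 := (hasDerivAt_sumLog (c := c) hcslit (hℓat c hcball).hasDerivAt).cexp
    rw [sumLog_self, Complex.exp_zero, one_mul] at h1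
    refine h1.unique ((hasDerivAt_shiftedZeta b).congr_of_eventuallyEq ?_)
    have h2 : ∀ᶠ w in nhds c, shiftedZeta b w ≠ 0 :=
      hfd.continuous.continuousAt.eventually_ne (by rw [hfc]; exact one_ne_zero)
    filter_upwards [h2, Metric.isOpen_ball.mem_nhds hcball] with w h3 h4
    exact hexp w h4 h3
  obtain ⟨hℓi, hℓ0⟩ := argKernel_mul_rectIntegral_eq_zero ha haX hT Metric.isOpen_ball hrect hℓd
    (hℓat c hcball).hasDerivAt
  obtain ⟨hSi, hSnn, hSz, hSle⟩ := rectIntegral_logTerm_sum hb hb1 haX hT hS0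
    fun ρ hρ => hno ρ (hS0 ρ hρ)
  have hform : rectTerm b (sumLog S ℓ c) = fun w => (S.map fun ρ => logTerm (1 - b) ρ w).sum +
      argKernel (1 - b) w * (ℓ w - ℓ c - deriv ℓ c * (w - c)) :=
    funext fun w => rectTerm_sumLog b S ℓ hsum w
  have hval : rectIntegral X 0 T (rectTerm b (sumLog S ℓ c)) =
      rectIntegral X 0 T fun w => (S.map fun ρ => logTerm (1 - b) ρ w).sum := by
    rw [hform, rectIntegral_add hSi hℓi, hℓ0, add_zero]
  have hreal : ∀ x ∈ Icc 0 X, (sumLog S ℓ c (x : ℝ)).im = 0 := by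
    intro x hx
    have hm : ∀ y ∈ Icc 0 X, ((y : ℝ) : ℂ) ∈ Metric.ball c R₁ := fun y hy =>
      hrect (by simpa [Complex.mem_reProdIm, hT.le] using hy)
    have hn : ∀ y ∈ Icc 0 X, ∀ ρ, shiftedZeta b ρ = 0 → 0 ≤ ρ.re → ρ.im ≠ ((y : ℝ) : ℂ).im := by
      intro y _ ρ h0 hre
      simpa using (shiftedZeta_zero_bounds hb h0 hre).2.1
    refine im_eq_zero_of_exp_real (L := fun x : ℝ => sumLog S ℓ c x) (p := 0) (q := X) (x := 1 - b)
      (fun y hy => ?_) (fun y hy => ?_) ⟨ha.le, haX.le⟩ hx ?_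
    · refine (ContinuousAt.comp (f := fun x : ℝ => (x : ℂ)) (hcontat y (hm y hy) (by simpa using hy.1)
        fun ρ h0 hre => Or.inr (hn y hy ρ h0 hre)) (by fun_prop)).continuousWithinAt
    · rw [hexp y (hm y hy) fun h0 => hn y hy y h0 (by simpa using hy.1) rfl]
      exact shiftedZeta_im_ofReal b y
    · rw [← hcdef, sumLog_self, Complex.zero_im]
  refine ⟨sumLog S ℓ c, measurable_sumLog S hℓm c, ?_, ?_, ?_, ?_, ?_, hreal,
    fun w hw h0 => hexp w (hrect hw) h0, ?_⟩
  · have hcpt : IsCompact (Icc 0 X ×ℂ Icc 0 T) := isCompact_Icc.reProdIm isCompact_Icc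
    obtain ⟨B, hB⟩ := hcpt.exists_bound_of_continuousOn ((hℓd.continuousOn.mono hrect).sub
      (continuousOn_const (c := ℓ c)))
    refine ⟨S.card * (2 * Real.pi) + B, fun w hw => ?_⟩
    have h1 := abs_le.1 (abs_im_sumLog_sub_le S ℓ c w)
    have h2 := abs_le.1 ((Complex.abs_im_le_norm (ℓ w - ℓ c)).trans (hB w hw))
    rw [abs_le]
    constructor <;> linarith [h1.1, h1.2, h2.1, h2.2]
  · rw [hform]
    exact hSi.add hℓi
  · rw [hval]
    exact hSnn
  · intro h
    rw [hval]
    exact hSz fun ρ hρ => h ρ (hS0 ρ hρ)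
  · intro ρ h0 hre him hlt
    rw [hval, ← (logTerm_rectIntegral_zero hb hb1 haX hT h0 (hno ρ h0)).2.2.2 hre him hlt]
    refine hSle ρ (hmemS ρ (hrect ?_) h0)
    rw [Complex.mem_reProdIm]
    exact ⟨⟨hre, ((shiftedZeta_zero_bounds hb h0 hre).1.trans haX).le⟩, him.le, hlt.le⟩
  · intro x hx t ht htT hnt
    -- The vertical part of the path lies to the right of all zeros, hence of their cuts; the
    -- horizontal part has a height at which no zero with real part at least b lies.
    have hpath : ∀ z ∈ zetaArgPath (b + x) t, z - b ∈ Icc 0 X ×ℂ Icc 0 T ∧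
        (∀ ρ, shiftedZeta b ρ = 0 → 0 ≤ ρ.re → ρ.re < (z - b).re ∨ ρ.im ≠ (z - b).im) ∧
        z - 1 ∈ Complex.slitPlane := by
      intro z hz
      rw [Complex.mem_reProdIm]
      rcases zetaArgPath_re_im hz with ⟨h1, h2⟩ | ⟨h1, h2⟩
      · rw [uIcc_of_le ht.le] at h2
        refine ⟨⟨?_, ?_⟩, fun ρ h0 hre => Or.inl ?_, Or.inl ?_⟩
        · simp only [Complex.sub_re, Complex.ofReal_re, h1]
          constructor <;> linarith
        · simp only [Complex.sub_im, Complex.ofReal_im, sub_zero]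
          exact ⟨h2.1, h2.2.trans htT⟩
        · have := (shiftedZeta_zero_bounds hb h0 hre).1
          simp only [Complex.sub_re, Complex.ofReal_re, h1]
          linarith
        · simp [h1]
      · have h3 : b ≤ z.re ∧ z.re ≤ b + X := by
          rcases mem_uIcc.1 h2 with h | h <;> constructor <;> linarith [h.1, h.2, hx.1, hx.2]
        refine ⟨⟨?_, ?_⟩, fun ρ h0 hre => Or.inr ?_, Or.inr ?_⟩
        · simp only [Complex.sub_re, Complex.ofReal_re]
          constructor <;> linarith
        · simp only [Complex.sub_im, Complex.ofReal_im, sub_zero, h1]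
          exact ⟨ht.le, htT⟩
        · simpa [h1] using hnt ρ h0 hre
        · simpa [h1] using ht.ne'
    have hnz : ∀ z ∈ zetaArgPath (b + x) t, shiftedZeta b (z - b) ≠ 0 := by
      intro z hz h0
      obtain ⟨h1, h2, -⟩ := hpath z hz
      rcases h2 _ h0 (Complex.mem_reProdIm.1 h1).1.1 with h | h
      · exact lt_irrefl _ h
      · exact h rfl
    have hsz : ∀ z, shiftedZeta b (z - b) = riemannZeta₁ z := fun z => by simp [shiftedZeta]
    have hz1 : ∀ z ∈ zetaArgPath (b + x) t, z ≠ 1 := fun z hz h =>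
      Complex.slitPlane_ne_zero (hpath z hz).2.2 (sub_eq_zero.2 h)
    have hbr : IsZetaArgBranch (b + x) t
        (fun z => (sumLog S ℓ c (z - b)).im - Complex.arg (z - 1)) := by
      refine ⟨fun z hz => ?_, ?_, fun z hz => ?_⟩
      · obtain ⟨h1, h2, h3⟩ := hpath z hz
        have h4 : ContinuousAt (fun z => sumLog S ℓ c (z - b)) z :=
          ContinuousAt.comp (f := fun z => z - (b : ℂ))
            (hcontat _ (hrect h1) (Complex.mem_reProdIm.1 h1).1.1 h2) (by fun_prop)
        have h5 : ContinuousAt (fun z => Complex.arg (z - 1)) z :=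
          ContinuousAt.comp (f := fun z => z - (1 : ℂ)) (Complex.continuousAt_arg h3) (by fun_prop)
        exact ((Complex.continuous_im.continuousAt.comp h4).sub h5).continuousWithinAt
      · have h1 := hreal (2 - b) ⟨by linarith, by linarith⟩
        have h2 : ((2 - b : ℝ) : ℂ) = 2 - b := by push_cast; rfl
        rw [h2] at h1
        simp only [h1]
        norm_num
      · have h1 := hexp _ (hrect (hpath z hz).1) (hnz z hz)
        rw [hsz, riemannZeta₁_eq_sub_mul_riemannZeta (hz1 z hz)] at h1
        exact eq_norm_mul_exp_im (sub_ne_zero.2 (hz1 z hz)) h1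
    have hfin := zetaArg_eq (fun z hz h => hnz z hz (by
      rw [hsz, riemannZeta₁_eq_zero_iff]
      exact h)) hbr
    rw [hfin]
    push_cast
    congr 3
    ring

/-! ### Growth of the argument and of the logarithm on horizontal lines -/

theorem norm_riemannZeta_sub_one_le {s : ℂ} (hs : 2 ≤ s.re) : ‖riemannZeta s - 1‖ ≤ 2 / 3 := by
  have hs1 : 1 < s.re := by linarith
  have hz := zeta_eq_tsum_one_div_nat_add_one_cpow hs1
  have hbd : ∀ n : ℕ, ‖1 / ((n : ℂ) + 1 + 1) ^ s‖ ≤ 1 / ((n : ℝ) + 2) ^ 2 := by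
    intro n
    have h1 : ‖((n : ℂ) + 1 + 1) ^ s‖ = ((n : ℝ) + 2) ^ s.re := by
      have := Complex.norm_cpow_eq_rpow_re_of_pos (x := (n : ℝ) + 2) (by positivity) s
      rw [← this]
      congr 2
      push_cast
      ring
    rw [norm_div, norm_one, h1]
    refine one_div_le_one_div_of_le (by positivity) ?_
    rw [← Real.rpow_natCast]
    exact Real.rpow_le_rpow_of_exponent_le (by linarith [n.cast_nonneg (α := ℝ)]) (by exact_mod_cast hs)
  have hsum2 := hasSum_zeta_two
  have h2 : HasSum (fun n : ℕ => 1 / ((n : ℝ) + 2) ^ 2) (Real.pi ^ 2 / 6 - 1) := by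
    have := (hasSum_nat_add_iff' 2).2 hsum2
    simpa [Finset.sum_range_succ] using this
  have hsn : Summable fun n : ℕ => 1 / ((n : ℂ) + 1) ^ s := by
    rw [← summable_nat_add_iff 1]
    refine Summable.of_norm_bounded h2.summable fun n => ?_
    push_cast
    exact hbd n
  have h3 : riemannZeta s - 1 = ∑' n : ℕ, 1 / ((n : ℂ) + 1 + 1) ^ s := by
    rw [hz, hsn.tsum_eq_zero_add]
    push_cast
    simp
  rw [h3]
  refine (tsum_of_norm_bounded h2 hbd).trans ?_
  -- The majorant is π²/6 - 1, and π < 3.15.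
  nlinarith [Real.pi_lt_d2, Real.pi_pos]

theorem riemannZeta_re_pos {s : ℂ} (hs : 2 ≤ s.re) : 1 / 3 ≤ (riemannZeta s).re := by
  have h1 := (Complex.abs_re_le_norm _).trans (norm_riemannZeta_sub_one_le hs)
  rw [Complex.sub_re, Complex.one_re] at h1
  linarith [(abs_le.1 h1).1]

/-- Computation of `zetaArg` from a branch on the horizontal segment alone. -/
theorem zetaArg_eq_of_horizontal {σ t : ℝ} {θ : ℂ → ℝ}
    (hz : ∀ z ∈ segment ℝ (2 + t * Complex.I) (σ + t * Complex.I), riemannZeta z ≠ 0)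
    (hc : ContinuousOn θ (segment ℝ (2 + t * Complex.I) (σ + t * Complex.I)))
    (h2 : θ (2 + t * Complex.I) = Complex.arg (riemannZeta (2 + t * Complex.I)))
    (he : ∀ z ∈ segment ℝ (2 + t * Complex.I) (σ + t * Complex.I),
      riemannZeta z = ‖riemannZeta z‖ * Complex.exp (θ z * Complex.I)) :
    zetaArg σ t = θ (σ + t * Complex.I) := by
  classical
  have hre2 : ∀ z ∈ segment ℝ (2 : ℂ) (2 + t * Complex.I), z.re = 2 := by
    intro z hz
    rw [segment_eq_image'] at hz
    obtain ⟨x, -, rfl⟩ := hz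
    simp
  have him : ∀ z ∈ segment ℝ (2 + t * Complex.I) (σ + t * Complex.I), z.im = t := by
    intro z hz
    rw [segment_eq_image'] at hz
    obtain ⟨x, -, rfl⟩ := hz
    simp
  -- On the vertical side ζ has positive real part, so the principal argument is continuous there
  -- and vanishes at 2.
  let φ : ℂ → ℝ := (segment ℝ (2 : ℂ) (2 + t * Complex.I)).piecewise
    (fun z => Complex.arg (riemannZeta z)) θ
  have e1 : EqOn φ (fun z => Complex.arg (riemannZeta z)) (segment ℝ (2 : ℂ) (2 + t * Complex.I)) :=
    piecewise_eqOn _ _ _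
  have e2 : EqOn φ θ (segment ℝ (2 + t * Complex.I) (σ + t * Complex.I)) := by
    intro z hz
    by_cases h : z ∈ segment ℝ (2 : ℂ) (2 + t * Complex.I)
    · have : z = 2 + t * Complex.I := by
        apply Complex.ext
        · simp [hre2 z h]
        · simp [him z hz]
      rw [e1 h, this]
      exact h2.symm
    · exact piecewise_eq_of_notMem _ _ _ h
  have hbr : IsZetaArgBranch σ t φ := by
    refine ⟨ContinuousOn.union_of_isClosed ?_ (hc.congr e2) ?_ ?_, ?_, ?_⟩
    · refine ContinuousOn.congr (fun z hz => ContinuousAt.continuousWithinAt ?_) e1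
      have hz2 := hre2 z hz
      have hz1 : z ≠ 1 := by
        rintro rfl
        norm_num at hz2
      refine ContinuousAt.comp (Complex.continuousAt_arg (Or.inl ?_))
        (differentiableAt_riemannZeta hz1).continuousAt
      linarith [riemannZeta_re_pos hz2.ge]
    · rw [← affineSegment_eq_segment]
      exact (isCompact_Icc.image (by fun_prop)).isClosed
    · rw [← affineSegment_eq_segment]
      exact (isCompact_Icc.image (by fun_prop)).isClosed
    · rw [e1 (left_mem_segment ℝ _ _)]
      simp only
      rw [riemannZeta_two]
      have : ((Real.pi : ℂ) ^ 2 / 6) = ((Real.pi ^ 2 / 6 : ℝ) : ℂ) := by push_cast; rfl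
      rw [this]
      exact Complex.arg_ofReal_of_nonneg (by positivity)
    · rintro z (hz | hz)
      · rw [e1 hz]
        exact (Complex.norm_mul_exp_arg_mul_I _).symm
      · rw [e2 hz]
        exact he z hz
  rw [zetaArg_eq ?_ hbr]
  · exact e2 (right_mem_segment ℝ _ _)
  · rintro z (h | h)
    · exact riemannZeta_ne_zero_of_one_le_re (by rw [hre2 z h]; norm_num)
    · exact hz z h

theorem segment_horizontal_re_im {σ t : ℝ} {z : ℂ}
    (hz : z ∈ segment ℝ (2 + t * Complex.I) (σ + t * Complex.I)) :
    z.im = t ∧ z.re ∈ uIcc 2 σ := by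
  rw [segment_eq_image'] at hz
  obtain ⟨x, hx, rfl⟩ := hz
  refine ⟨by simp, ?_⟩
  rw [← segment_eq_uIcc, segment_eq_image']
  exact ⟨x, hx, by simp⟩

theorem zetaArg_eq_arg {σ t : ℝ} (hσ : 2 ≤ σ) :
    zetaArg σ t = Complex.arg (riemannZeta (σ + t * Complex.I)) := by
  have hre : ∀ z ∈ segment ℝ (2 + t * Complex.I) (σ + t * Complex.I), 2 ≤ z.re := by
    intro z hz
    have := (segment_horizontal_re_im hz).2
    rw [uIcc_of_le hσ] at this
    exact this.1
  refine zetaArg_eq_of_horizontal (θ := fun z => Complex.arg (riemannZeta z))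
    (fun z hz => ?_) (fun z hz => ?_) rfl
    fun z _ => (Complex.norm_mul_exp_arg_mul_I _).symm
  · exact riemannZeta_ne_zero_of_one_le_re (by linarith [hre z hz])
  · have h2 := hre z hz
    have hz1 : z ≠ 1 := by
      rintro rfl
      norm_num at h2
    exact (ContinuousAt.comp (Complex.continuousAt_arg (Or.inl (by linarith [riemannZeta_re_pos h2])))
      (differentiableAt_riemannZeta hz1).continuousAt).continuousWithinAt

/-- A logarithm of an entire function in a disc, with control of the number of zeros and of the
zero free factor. -/
theorem exists_log_disc {f : ℂ → ℂ} (hf : Differentiable ℂ f) {c : ℂ} {M : ℝ}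
    (hM : ∀ z ∈ Metric.sphere c (7 / 4), ‖f z‖ ≤ M) (hc : 1 / 3 ≤ ‖f c‖) (hM1 : 1 ≤ M) :
    ∃ (S : Multiset ℂ) (ℓ : ℂ → ℂ), (∀ ρ ∈ S, f ρ = 0) ∧ (∀ ρ ∈ S, ‖ρ - c‖ ≤ 13 / 8) ∧
      DifferentiableOn ℂ ℓ (Metric.ball c (13 / 8)) ∧
      (S.card : ℝ) ≤ 14 * Real.log (3 * M) ∧
      (∀ z ∈ Metric.closedBall c (3 / 2), ‖ℓ z - ℓ c‖ ≤ 1032 * Real.log (3 * M)) ∧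
      ∀ z ∈ Metric.ball c (13 / 8), f z = (S.map (z - ·)).prod * Complex.exp (ℓ z) := by
  have hc0 : f c ≠ 0 := norm_pos_iff.1 (by linarith)
  obtain ⟨S, g, hgd, hfg, hS, hg0, hcard⟩ := exists_factorization hf (R₁ := 13 / 8) (by norm_num)
    (by norm_num) hM hc0
  obtain ⟨ℓ, -, hℓd, hℓ⟩ := exists_differentiableOn_exp_eq (R := 13 / 8) (by norm_num)
    hgd.differentiableOn fun z hz => hg0 z (Metric.ball_subset_closedBall hz)
  have hS0 : ∀ ρ ∈ S, f ρ = 0 := by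
    intro ρ hρ
    rw [hfg ρ, Multiset.prod_eq_zero, zero_mul]
    exact Multiset.mem_map.2 ⟨ρ, hρ, sub_self ρ⟩
  have hcb : c ∈ Metric.ball c (13 / 8 : ℝ) := Metric.mem_ball_self (by norm_num)
  set N := S.card
  have hlog : 0 < Real.log (3 * M) := Real.log_pos (by linarith)
  -- Jensen with ratio (7/4)/(13/8) = 14/13, together with log(14/13) ≥ 1/14.
  have hN : (N : ℝ) ≤ 14 * Real.log (3 * M) := by
    have h1 : (14 / 13 : ℝ) ^ N ≤ 3 * M := by
      have h2 : (7 / 4 / (13 / 8) : ℝ) = 14 / 13 := by norm_num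
      rw [h2] at hcard
      have h3 : (1 / 3) * (14 / 13 : ℝ) ^ N ≤ ‖f c‖ * (14 / 13 : ℝ) ^ N := by gcongr
      linarith
    have h4 := Real.log_le_log (by positivity) h1
    rw [Real.log_pow] at h4
    have h5 : 1 / 14 ≤ Real.log (14 / 13) := by
      have := Real.one_sub_inv_le_log_of_pos (x := 14 / 13) (by norm_num)
      norm_num at this ⊢
      exact this
    have h6 : (N : ℝ) * (1 / 14) ≤ N * Real.log (14 / 13) := by gcongr
    linarith
  have hgM : ∀ z ∈ Metric.ball c (7 / 4 : ℝ), ‖g z‖ ≤ M * 8 ^ N := by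
    intro z hz
    refine Complex.norm_le_of_forall_mem_frontier_norm_le (U := Metric.ball c (7 / 4 : ℝ))
      Metric.isBounded_ball hgd.diffContOnCl (fun z hz => ?_) (subset_closure hz)
    rw [frontier_ball c (by norm_num)] at hz
    have hz' : ‖z - c‖ = 7 / 4 := by simpa [dist_eq_norm] using hz
    have h1 := hM z hz
    rw [hfg z, norm_mul, norm_multiset_map_prod] at h1
    -- On the outer circle every factor has modulus at least 7/4 - 13/8 = 1/8.
    have h2 : (1 / 8 : ℝ) ^ N ≤ (S.map fun ρ => ‖z - ρ‖).prod := by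
      rw [← Multiset.prod_replicate, ← Multiset.map_const']
      refine Multiset.prod_map_le_prod_map₀ _ _ (fun _ _ => by norm_num) fun ρ hρ => ?_
      have h3 := hS ρ hρ
      have h4 := norm_sub_le_norm_sub_add_norm_sub z ρ c
      linarith
    have h5 : (1 / 8 : ℝ) ^ N * ‖g z‖ ≤ M :=
      (mul_le_mul_of_nonneg_right h2 (norm_nonneg _)).trans h1
    calc ‖g z‖ = (1 / 8 : ℝ) ^ N * ‖g z‖ * 8 ^ N := by
          rw [one_div, inv_pow]
          field_simp
      _ ≤ M * 8 ^ N := by gcongr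
  have hgc : 1 / 3 ≤ 2 ^ N * ‖g c‖ := by
    refine hc.trans ?_
    rw [hfg c, norm_mul, norm_multiset_map_prod]
    refine mul_le_mul_of_nonneg_right ?_ (norm_nonneg _)
    rw [← Multiset.prod_replicate, ← Multiset.map_const']
    refine Multiset.prod_map_le_prod_map₀ _ _ (fun _ _ => norm_nonneg _) fun ρ hρ => ?_
    rw [norm_sub_rev]
    linarith [hS ρ hρ]
  have hre : ∀ z ∈ Metric.ball c (13 / 8 : ℝ), (ℓ z).re = Real.log ‖g z‖ := by
    intro z hz
    rw [← hℓ z hz, Complex.norm_exp, Real.log_exp]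
  have hlog2 : Real.log 2 ≤ 3 / 4 := by linarith [Real.log_two_lt_d9]
  have hlog2' : 0 < Real.log 2 := Real.log_pos one_lt_two
  -- The zeros cost N·log 8 on the outer circle and N·log 2 at the centre, together 4N·log 2 ≤ 3N ≤
  -- 42·log(3M).
  have hA : ∀ z ∈ Metric.ball c (13 / 8 : ℝ), (ℓ z - ℓ c).re ≤ 43 * Real.log (3 * M) := by
    intro z hz
    rw [Complex.sub_re, hre z hz, hre c hcb]
    have hgz : 0 < ‖g z‖ := norm_pos_iff.2 (hg0 z (Metric.ball_subset_closedBall hz))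
    have hgc0 : 0 < ‖g c‖ := norm_pos_iff.2 (hg0 c (Metric.ball_subset_closedBall hcb))
    have h1 := Real.log_le_log hgz (hgM z (Metric.ball_subset_ball (by norm_num) hz))
    have h2 := Real.log_le_log (by norm_num) hgc
    rw [Real.log_mul (by positivity) (by positivity), Real.log_pow] at h1 h2
    have h8 : Real.log 8 = 3 * Real.log 2 := by
      rw [show (8 : ℝ) = 2 ^ 3 by norm_num, Real.log_pow]
      norm_num
    have h3 : Real.log (1 / 3) = -Real.log 3 := by rw [one_div, Real.log_inv]
    have h4 : Real.log (3 * M) = Real.log 3 + Real.log M :=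
      Real.log_mul (by norm_num) (by positivity)
    have h5 : (N : ℝ) * Real.log 2 ≤ N * (3 / 4) := by gcongr
    rw [h8] at h1
    linarith
  refine ⟨S, ℓ, hS0, hS, hℓd, hN, fun z hz => ?_, fun z hz => by rw [hℓ z hz]; exact hfg z⟩
  have hz' : ‖z - c‖ ≤ 3 / 2 := by simpa [dist_eq_norm] using hz
  -- With radius 13/8 and |z - c| ≤ 3/2 the factor is 2·43·(3/2)/(1/8) = 1032.
  have hbc := Complex.borelCaratheodory_zero (f := fun w => ℓ (c + w) - ℓ c) (R := 13 / 8)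
    (M := 43 * Real.log (3 * M)) (z := z - c) (by positivity) ?_ ?_ (by norm_num) ?_ (by simp)
  · simp only [add_sub_cancel] at hbc
    refine hbc.trans ?_
    rw [div_le_iff₀ (by linarith)]
    nlinarith [norm_nonneg (z - c)]
  · refine DifferentiableOn.sub_const (hℓd.comp (by fun_prop) fun w hw => ?_) _
    simpa using hw
  · intro w hw
    exact hA _ (by simpa using hw)
  · rw [mem_ball_zero_iff]
    linarith

theorem norm_sumLog_sub_le {S : Multiset ℂ} {ℓ : ℂ → ℂ} {c w : ℂ} {F : ℂ → ℝ}
    (hF : ∀ ρ ∈ S, ‖Complex.log (w - ρ) - Complex.log (c - ρ)‖ ≤ F ρ) :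
    ‖sumLog S ℓ c w - (ℓ w - ℓ c)‖ ≤ (S.map F).sum := by
  rw [sumLog, add_sub_cancel_right]
  induction S using Multiset.induction with
  | empty => simp
  | cons ρ S ih =>
    simp only [Multiset.map_cons, Multiset.sum_cons]
    exact (norm_add_le _ _).trans (add_le_add (hF ρ (Multiset.mem_cons_self ρ S))
      (ih fun σ hσ => hF σ (Multiset.mem_cons_of_mem hσ)))

theorem intervalIntegral_multiset_sum_le {S : Multiset ℂ} {F : ℂ → ℝ → ℝ} {p q B : ℝ}
    (hi : ∀ ρ ∈ S, IntervalIntegrable (F ρ) volume p q) (hB : ∀ ρ ∈ S, (∫ x in p..q, F ρ x) ≤ B) :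
    IntervalIntegrable (fun x => (S.map fun ρ => F ρ x).sum) volume p q ∧
      (∫ x in p..q, (S.map fun ρ => F ρ x).sum) ≤ S.card * B := by
  induction S using Multiset.induction with
  | empty => simp
  | cons ρ S ih =>
    obtain ⟨h1, h2⟩ := ih (fun σ hσ => hi σ (Multiset.mem_cons_of_mem hσ))
      (fun σ hσ => hB σ (Multiset.mem_cons_of_mem hσ))
    have h3 := hi ρ (Multiset.mem_cons_self ρ S)
    simp only [Multiset.map_cons, Multiset.sum_cons, Multiset.card_cons]
    refine ⟨h3.add h1, ?_⟩
    rw [intervalIntegral.integral_add h3 h1]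
    push_cast
    linarith [hB ρ (Multiset.mem_cons_self ρ S)]

/-- The range of β is that of real parts in the disc of radius 13/8 about 2; the bound does not
depend on the zero. -/
theorem integral_abs_log_abs_sub_le {β : ℝ} (h1 : 3 / 8 ≤ β) (h2 : β ≤ 29 / 8) :
    (∫ x in (1 / 2 : ℝ)..2, |Real.log (|x - β|)|) ≤ ∫ x in (-4 : ℝ)..4, |Real.log (|x|)| := by
  rw [intervalIntegral.integral_comp_sub_right (fun y => |Real.log (|y|)|) β]
  refine intervalIntegral.integral_mono_interval (by linarith) (by linarith) (by linarith)
    (Filter.Eventually.of_forall fun x => abs_nonneg _) ?_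
  simpa using intervalIntegrable_abs_log_abs_sub 0 (-4) 4

/-- Bounds on a horizontal line that contains no zeros. -/
theorem exists_horizontal_bounds : ∃ C : ℝ, 0 < C ∧ ∀ t : ℝ, 2 ≤ t →
    (∀ ρ, riemannZeta₁ ρ = 0 → 1 / 2 ≤ ρ.re → ρ.im ≠ t) →
    (∀ σ ∈ Icc (1 / 2 : ℝ) 2, |zetaArg σ t| ≤ C * t) ∧
      (∫ σ in (1 / 2 : ℝ)..2, |Real.log ‖riemannZeta₁ (σ + t * Complex.I)‖|) ≤ C * t := by
  set C₀ := ∫ x in (-4 : ℝ)..4, |Real.log (|x|)|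
  have hC₀ : 0 ≤ C₀ := intervalIntegral.integral_nonneg (by norm_num) fun x _ => abs_nonneg _
  refine ⟨20000 + 300 * C₀ + 50000, by positivity, fun t ht hnt => ?_⟩
  have hpi3 := Real.pi_gt_three
  have hpi4 := Real.pi_lt_d2
  set c : ℂ := 2 + t * Complex.I with hc
  have hcre : c.re = 2 := by simp [hc]
  have hcim : c.im = t := by simp [hc]
  have hc1 : c ≠ 1 := by
    intro h
    rw [h] at hcre
    norm_num at hcre
  have hcn : ‖c‖ ≤ 2 + t := by
    refine (norm_add_le _ _).trans ?_
    simp [abs_of_pos (show 0 < t by linarith)]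
  -- On the sphere ‖z‖ ≤ 7/4 + 2 + t, so 1 + ‖z‖ ≤ 5 + t.
  set M := 5 * (5 + t) ^ 2
  have hM : ∀ z ∈ Metric.sphere c (7 / 4), ‖riemannZeta₁ z‖ ≤ M := by
    intro z hz
    have hz' : ‖z - c‖ = 7 / 4 := by simpa [dist_eq_norm] using hz
    have h1 := abs_le.1 (Complex.abs_re_le_norm (z - c))
    rw [Complex.sub_re, hz', hcre] at h1
    refine (norm_riemannZeta₁_le (by linarith [h1.1])).trans ?_
    have h2 : ‖z‖ ≤ ‖z - c‖ + ‖c‖ := norm_le_norm_sub_add z c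
    have h3 : 1 + ‖z‖ ≤ 5 + t := by linarith
    show 5 * (1 + ‖z‖) ^ 2 ≤ 5 * (5 + t) ^ 2
    gcongr
  have hfc : 1 / 3 ≤ ‖riemannZeta₁ c‖ := by
    rw [riemannZeta₁_eq_sub_mul_riemannZeta hc1, norm_mul]
    have h1 : 1 ≤ ‖c - 1‖ := by
      have := (le_abs_self _).trans (Complex.abs_re_le_norm (c - 1))
      rw [Complex.sub_re, hcre, Complex.one_re] at this
      linarith
    have h2 : 1 / 3 ≤ ‖riemannZeta c‖ :=
      (riemannZeta_re_pos hcre.ge).trans ((le_abs_self _).trans (Complex.abs_re_le_norm _))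
    nlinarith [norm_nonneg (riemannZeta c)]
  have hM1 : 1 ≤ M := by
    show 1 ≤ 5 * (5 + t) ^ 2
    nlinarith
  obtain ⟨S, ℓ, hS0, hS, hℓd, hN, hℓb, hfac⟩ :=
    exists_log_disc differentiable_riemannZeta₁ hM hfc hM1
  set Λ := Real.log (3 * M)
  have hΛ0 : 0 < Λ := Real.log_pos (by linarith)
  -- The logarithmic growth is given away: linear growth suffices against a kernel of order t⁻³.
  have hΛ : Λ ≤ 15 * t := by
    have h1 : Λ = Real.log 15 + 2 * Real.log (5 + t) := by
      show Real.log (3 * (5 * (5 + t) ^ 2)) = _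
      rw [← mul_assoc, Real.log_mul (by norm_num) (by positivity), Real.log_pow]
      norm_num
    have h2 := Real.log_le_sub_one_of_pos (show (0 : ℝ) < 15 by norm_num)
    have h3 := Real.log_le_sub_one_of_pos (show (0 : ℝ) < 5 + t by linarith)
    linarith
  have hcball : c ∈ Metric.ball c (13 / 8 : ℝ) := Metric.mem_ball_self (by norm_num)
  have hfc0 : riemannZeta₁ c ≠ 0 := norm_pos_iff.1 (by linarith)
  have hcS : ∀ ρ ∈ S, c ≠ ρ := by
    rintro ρ hρ rfl
    exact hfc0 (hS0 _ hρ)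
  have hdisc : ∀ z : ℂ, z.im = t → z.re ∈ Icc (1 / 2 : ℝ) 2 → z ∈ Metric.closedBall c (3 / 2) := by
    intro z h1 h2
    rw [Metric.mem_closedBall, dist_eq_norm]
    refine (Complex.norm_le_abs_re_add_abs_im _).trans ?_
    rw [Complex.sub_re, Complex.sub_im, h1, hcim, hcre, sub_self, abs_zero, add_zero, abs_le]
    constructor <;> linarith [h2.1, h2.2]
  have hsub : Metric.closedBall c (3 / 2 : ℝ) ⊆ Metric.ball c (13 / 8) :=
    Metric.closedBall_subset_ball (by norm_num)
  have hz0 : ∀ z : ℂ, z.im = t → 1 / 2 ≤ z.re → riemannZeta₁ z ≠ 0 := fun z h1 h2 h0 =>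
    hnt z h0 h2 h1
  have hexp : ∀ z : ℂ, z.im = t → z.re ∈ Icc (1 / 2 : ℝ) 2 →
      Complex.exp (sumLog S ℓ c z) = riemannZeta₁ z / riemannZeta₁ c := by
    intro z h1 h2
    rw [exp_sumLog hcS, ← hfac z (hsub (hdisc z h1 h2)), ← hfac c hcball]
    rintro ρ hρ rfl
    exact hz0 z h1 h2.1 (hS0 _ hρ)
  have hρre : ∀ ρ ∈ S, ρ.re < 1 := fun ρ hρ => by
    by_contra h
    exact riemannZeta₁_ne_zero_of_one_le_re (not_lt.1 h) (hS0 ρ hρ)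
  constructor
  · intro σ hσ
    have hseg : ∀ z ∈ segment ℝ (2 + t * Complex.I) (σ + t * Complex.I),
        z.im = t ∧ z.re ∈ Icc (1 / 2 : ℝ) 2 := by
      intro z hz
      obtain ⟨h1, h2⟩ := segment_horizontal_re_im hz
      rw [uIcc_of_ge hσ.2] at h2
      exact ⟨h1, hσ.1.trans h2.1, h2.2⟩
    have hz1 : ∀ z : ℂ, z.im = t → z ≠ 1 := by
      rintro z h1 rfl
      simp at h1
      linarith
    -- The constants log ζ(c) and log(c - 1) adjust the branch to start from the principal argument
    -- of ζ at c = 2 + it.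
    have harg : zetaArg σ t = (sumLog S ℓ c (σ + t * Complex.I) +
        (Complex.log (riemannZeta c) + Complex.log (c - 1))).im -
          Complex.arg (σ + t * Complex.I - 1) := by
      refine zetaArg_eq_of_horizontal (θ := fun z => (sumLog S ℓ c z +
        (Complex.log (riemannZeta c) + Complex.log (c - 1))).im - Complex.arg (z - 1))
        (fun z hz => ?_) (fun z hz => ?_) ?_ (fun z hz => ?_)
      · obtain ⟨h1, h2⟩ := hseg z hz
        rw [Ne, ← riemannZeta₁_eq_zero_iff]
        exact hz0 z h1 h2.1
      · obtain ⟨h1, h2⟩ := hseg z hz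
        have h3 : ∀ ρ ∈ S, z - ρ ∈ Complex.slitPlane := by
          intro ρ hρ
          by_cases hre : 1 / 2 ≤ ρ.re
          · refine Or.inr ?_
            rw [Complex.sub_im, h1]
            exact sub_ne_zero.2 (hnt ρ (hS0 ρ hρ) hre).symm
          · refine Or.inl ?_
            rw [Complex.sub_re]
            linarith [h2.1]
        have h4 := hℓd.differentiableAt (Metric.isOpen_ball.mem_nhds (hsub (hdisc z h1 h2)))
        have h5 := (hasDerivAt_sumLog (c := c) h3 h4.hasDerivAt).continuousAt
        have h6 : ContinuousAt (fun z => Complex.arg (z - 1)) z := by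
          refine ContinuousAt.comp (f := fun z => z - (1 : ℂ)) (Complex.continuousAt_arg (Or.inr ?_))
            (by fun_prop)
          simp only [Complex.sub_im, h1, Complex.one_im, sub_zero]
          linarith
        exact ((Complex.continuous_im.continuousAt.comp (h5.add continuousAt_const)).sub
          h6).continuousWithinAt
      · rw [← hc, sumLog_self, zero_add, Complex.add_im, Complex.log_im, Complex.log_im,
          add_sub_cancel_right]
      · obtain ⟨h1, h2⟩ := hseg z hz
        have hzc : riemannZeta c ≠ 0 := fun h => hfc0 (riemannZeta₁_eq_zero_iff.2 h)
        refine eq_norm_mul_exp_im (sub_ne_zero.2 (hz1 z h1)) ?_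
        rw [Complex.exp_add, Complex.exp_add, hexp z h1 h2, Complex.exp_log hzc,
          Complex.exp_log (sub_ne_zero.2 hc1), riemannZeta₁_eq_sub_mul_riemannZeta (hz1 z h1),
          riemannZeta₁_eq_sub_mul_riemannZeta hc1]
        have := sub_ne_zero.2 hc1
        field_simp
    rw [harg, Complex.add_im, Complex.add_im, Complex.log_im, Complex.log_im]
    have hm := hdisc (σ + t * Complex.I) (by simp) (by simpa using hσ)
    have h1 := abs_le.1 (abs_im_sumLog_sub_le S ℓ c (σ + t * Complex.I))
    have h2 := abs_le.1 ((Complex.abs_im_le_norm _).trans (hℓb _ hm))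
    have h3 := abs_le.1 (Complex.abs_arg_le_pi (riemannZeta c))
    have h4 := abs_le.1 (Complex.abs_arg_le_pi (c - 1))
    have h5 := abs_le.1 (Complex.abs_arg_le_pi (σ + t * Complex.I - 1))
    have h6 : (S.card : ℝ) * (2 * Real.pi) ≤ 14 * Λ * 7 := by
      gcongr
      linarith
    have h7 : 0 ≤ C₀ * t := by positivity
    rw [abs_le]
    constructor <;> linarith [h1.1, h1.2, h2.1, h2.2, h3.1, h3.2, h4.1, h4.2, h5.1, h5.2]
  · have hpt : ∀ᵐ σ : ℝ, σ ∈ Icc (1 / 2 : ℝ) 2 →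
        |Real.log ‖riemannZeta₁ (σ + t * Complex.I)‖| ≤
          (S.map fun ρ => |Real.log (|σ - ρ.re|)| + 10).sum + 1033 * Λ := by
      have hfin : ∀ᵐ σ : ℝ, ∀ ρ ∈ S.toFinset, σ ≠ ρ.re := by
        rw [Filter.eventually_all_finset]
        intro ρ _
        simp [ae_iff]
      filter_upwards [hfin] with σ hσS hσ
      have him : ((σ : ℂ) + t * Complex.I).im = t := by simp
      have hre : ((σ : ℂ) + t * Complex.I).re = σ := by simp
      set z : ℂ := (σ : ℂ) + t * Complex.I
      have hzI : z.re ∈ Icc (1 / 2 : ℝ) 2 := by rw [hre]; exact hσ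
      have hm := hdisc z him hzI
      -- The constant 10 absorbs log 4 + log 2 + 2π.
      have h1 := norm_sumLog_sub_le (S := S) (ℓ := ℓ) (c := c) (w := z)
        (F := fun ρ => |Real.log (|σ - ρ.re|)| + 10) (fun ρ hρ => by
          have hne := hσS ρ (Multiset.mem_toFinset.2 hρ)
          have hz4 : ‖z - ρ‖ ≤ 4 := by
            have e1 := norm_sub_le_norm_sub_add_norm_sub z c ρ
            have e2 := hS ρ hρ
            rw [norm_sub_rev] at e2
            have e3 : ‖z - c‖ ≤ 3 / 2 := by simpa [dist_eq_norm] using hm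
            linarith
          have k1 := norm_log_le (z := z - ρ) (abs_pos.2 (sub_ne_zero.2 hne))
            (by have := Complex.abs_re_le_norm (z - ρ); rwa [Complex.sub_re, hre] at this) hz4
            (by norm_num)
          have k2 := norm_log_le (z := c - ρ) (δ := 1) (K := 2) one_pos
            (by
              have := (le_abs_self _).trans (Complex.abs_re_le_norm (c - ρ))
              rw [Complex.sub_re, hcre] at this
              linarith [hρre ρ hρ])
            (by rw [norm_sub_rev]; linarith [hS ρ hρ]) (by norm_num)
          have k3 : Real.log 4 = 2 * Real.log 2 := by
            rw [show (4 : ℝ) = 2 ^ 2 by norm_num, Real.log_pow]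
            norm_num
          have k4 := Real.log_two_lt_d9
          rw [Real.log_one, abs_zero, zero_add] at k2
          have k5 := norm_sub_le (Complex.log (z - ρ)) (Complex.log (c - ρ))
          linarith)
      have h2 := hℓb z hm
      have h3 : Real.log ‖riemannZeta₁ z‖ = (sumLog S ℓ c z).re + Real.log ‖riemannZeta₁ c‖ := by
        have h4 := congrArg norm (hexp z him hzI)
        rw [Complex.norm_exp, norm_div, eq_div_iff (norm_ne_zero_iff.2 hfc0)] at h4
        rw [← h4, Real.log_mul (Real.exp_ne_zero _) (norm_ne_zero_iff.2 hfc0), Real.log_exp]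
      have h5 : |Real.log ‖riemannZeta₁ c‖| ≤ Λ := by
        have hMc : ‖riemannZeta₁ c‖ ≤ 3 * M := by
          refine (norm_riemannZeta₁_le (by rw [hcre]; norm_num)).trans ?_
          have : 1 + ‖c‖ ≤ 5 + t := by linarith
          have : 5 * (1 + ‖c‖) ^ 2 ≤ 5 * (5 + t) ^ 2 := by gcongr
          have e : M = 5 * (5 + t) ^ 2 := rfl
          linarith
        have k1 := Real.log_le_log (by linarith) hMc
        have k2 := Real.log_le_log (by norm_num) hfc
        have k3 : Real.log (1 / 3) = -Real.log 3 := by rw [one_div, Real.log_inv]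
        have k4 : Λ = Real.log 3 + Real.log M := Real.log_mul (by norm_num) (by positivity)
        have k5 := Real.log_nonneg hM1
        rw [abs_le]
        constructor <;> linarith
      have h6 := abs_le.1 ((Complex.abs_re_le_norm _).trans h1)
      have h7 := abs_le.1 ((Complex.abs_re_le_norm _).trans h2)
      have h8 := abs_le.1 h5
      rw [Complex.sub_re] at h6
      rw [h3, abs_le]
      constructor <;> linarith [h6.1, h6.2, h7.1, h7.2, h8.1, h8.2]
    -- The 15 is the constant 10 integrated over an interval of length 3/2.
    obtain ⟨hi, hle⟩ := intervalIntegral_multiset_sum_le (S := S) (p := 1 / 2) (q := 2)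
      (F := fun ρ σ => |Real.log (|σ - ρ.re|)| + 10) (B := C₀ + 15)
      (fun ρ _ => (intervalIntegrable_abs_log_abs_sub _ _ _).add intervalIntegrable_const)
      (fun ρ hρ => by
        have h1 := abs_le.1 ((Complex.abs_re_le_norm _).trans (hS ρ hρ))
        rw [Complex.sub_re, hcre] at h1
        rw [intervalIntegral.integral_add (intervalIntegrable_abs_log_abs_sub _ _ _)
          intervalIntegrable_const, intervalIntegral.integral_const, smul_eq_mul]
        have h2 := integral_abs_log_abs_sub_le (β := ρ.re) (by linarith [h1.1]) (by linarith [h1.2])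
        have : C₀ = ∫ x in (-4 : ℝ)..4, |Real.log (|x|)| := rfl
        linarith)
    have hcontI : IntervalIntegrable
        (fun σ : ℝ => |Real.log ‖riemannZeta₁ (σ + t * Complex.I)‖|) volume (1 / 2) 2 := by
      refine ContinuousOn.intervalIntegrable (ContinuousOn.abs (ContinuousOn.log ?_ ?_))
      · have := differentiable_riemannZeta₁.continuous
        fun_prop
      · intro σ hσ
        rw [uIcc_of_le (by norm_num)] at hσ
        exact norm_ne_zero_iff.2 (hz0 _ (by simp) (by simpa using hσ.1))
    calc (∫ σ in (1 / 2 : ℝ)..2, |Real.log ‖riemannZeta₁ (σ + t * Complex.I)‖|)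
        ≤ ∫ σ in (1 / 2 : ℝ)..2, ((S.map fun ρ => |Real.log (|σ - ρ.re|)| + 10).sum + 1033 * Λ) := by
          refine intervalIntegral.integral_mono_ae_restrict (by norm_num) hcontI
            (hi.add intervalIntegrable_const) ?_
          filter_upwards [ae_restrict_of_ae hpt, ae_restrict_mem measurableSet_Icc] with σ h1 h2
          exact h1 h2
      _ ≤ S.card * (C₀ + 15) + 1033 * Λ * (3 / 2) := by
          rw [intervalIntegral.integral_add hi intervalIntegrable_const,
            intervalIntegral.integral_const, smul_eq_mul]
          linarith
      _ ≤ 14 * (15 * t) * (C₀ + 15) + 1033 * (15 * t) * (3 / 2) := by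
          gcongr
          exact hN.trans (by linarith)
      _ ≤ (20000 + 300 * C₀ + 50000) * t := by nlinarith

/-! ### Two elementary integrals -/

theorem hasDerivAt_arctan_div {a : ℝ} (ha : 0 < a) (y : ℝ) :
    HasDerivAt (fun y => Real.arctan (y / a)) (a / (a ^ 2 + y ^ 2)) y := by
  refine (((hasDerivAt_id y).div_const a).arctan).congr_deriv ?_
  have : a ^ 2 + y ^ 2 ≠ 0 := by positivity
  simp only [id]
  field_simp

theorem hasDerivAt_sq_add_sq (a y : ℝ) : HasDerivAt (fun y => a ^ 2 + y ^ 2) (2 * y) y := by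
  simpa using ((hasDerivAt_id y).pow 2).const_add (a ^ 2)

theorem tendsto_arctan_div {a : ℝ} (ha : 0 < a) :
    Filter.Tendsto (fun y => Real.arctan (y / a)) Filter.atTop (nhds (Real.pi / 2)) :=
  (Real.tendsto_arctan_atTop.mono_right nhdsWithin_le_nhds).comp
    (Filter.tendsto_id.atTop_div_const ha)

theorem tendsto_inv_sq_add_sq (a : ℝ) :
    Filter.Tendsto (fun y : ℝ => (a ^ 2 + y ^ 2)⁻¹) Filter.atTop (nhds 0) :=
  (Filter.tendsto_atTop_add_const_left _ _
    (Filter.tendsto_pow_atTop two_ne_zero)).inv_tendsto_atTop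

theorem tendsto_div_sq_add_sq (a : ℝ) :
    Filter.Tendsto (fun y : ℝ => y / (a ^ 2 + y ^ 2)) Filter.atTop (nhds 0) := by
  refine squeeze_zero' ?_ ?_ tendsto_inv_atTop_zero
  · filter_upwards [Filter.eventually_gt_atTop 0] with y hy
    positivity
  · filter_upwards [Filter.eventually_gt_atTop 0] with y hy
    rw [div_le_iff₀ (by positivity)]
    field_simp
    nlinarith [sq_nonneg a]

theorem integral_sq_div {a : ℝ} (ha : 0 < a) :
    IntegrableOn (fun y : ℝ => y * y / (a ^ 2 + y ^ 2) ^ 2) (Ioi 0) ∧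
      (∫ y in Ioi (0 : ℝ), y * y / (a ^ 2 + y ^ 2) ^ 2) = Real.pi / (4 * a) := by
  have hder : ∀ y : ℝ, HasDerivAt
      (fun y => -(y / (a ^ 2 + y ^ 2)) / 2 + Real.arctan (y / a) / (2 * a))
      (y * y / (a ^ 2 + y ^ 2) ^ 2) y := by
    intro y
    have hne : a ^ 2 + y ^ 2 ≠ 0 := by positivity
    refine (((((hasDerivAt_id y).fun_div (hasDerivAt_sq_add_sq a y) hne).fun_neg.div_const 2)).fun_add
      ((hasDerivAt_arctan_div ha y).div_const (2 * a))).congr_deriv ?_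
    simp only [id]
    field_simp
    ring
  have hlim : Filter.Tendsto
      (fun y => -(y / (a ^ 2 + y ^ 2)) / 2 + Real.arctan (y / a) / (2 * a)) Filter.atTop
      (nhds (-0 / 2 + Real.pi / 2 / (2 * a))) :=
    ((tendsto_div_sq_add_sq a).neg.div_const 2).add ((tendsto_arctan_div ha).div_const (2 * a))
  have hpos : ∀ y ∈ Ioi (0 : ℝ), 0 ≤ y * y / (a ^ 2 + y ^ 2) ^ 2 := fun y _ => by
    have := mul_self_nonneg y
    positivity
  refine ⟨integrableOn_Ioi_deriv_of_nonneg' (fun y _ => hder y) hpos hlim, ?_⟩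
  rw [integral_Ioi_of_hasDerivAt_of_nonneg' (fun y _ => hder y) hpos hlim]
  simp
  ring

/-- The contribution of arg(s - 1) on the line Re s = b, where a = 1 - b. -/
theorem integral_arg_div {a : ℝ} (ha : 0 < a) :
    IntegrableOn (fun y : ℝ => y * (Real.pi - Real.arctan (y / a)) / (a ^ 2 + y ^ 2) ^ 2) (Ioi 0) ∧
      (∫ y in Ioi (0 : ℝ), y * (Real.pi - Real.arctan (y / a)) / (a ^ 2 + y ^ 2) ^ 2) =
        3 * Real.pi / (8 * a ^ 2) := by
  have hder : ∀ y : ℝ, HasDerivAt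
      (fun y => -((Real.pi - Real.arctan (y / a)) * (a ^ 2 + y ^ 2)⁻¹) / 2 -
        y / (a ^ 2 + y ^ 2) / (4 * a) - Real.arctan (y / a) / (4 * a ^ 2))
      (y * (Real.pi - Real.arctan (y / a)) / (a ^ 2 + y ^ 2) ^ 2) y := by
    intro y
    have hne : a ^ 2 + y ^ 2 ≠ 0 := by positivity
    refine (((((hasDerivAt_arctan_div ha y).const_sub Real.pi).fun_mul
      ((hasDerivAt_sq_add_sq a y).fun_inv hne)).fun_neg.div_const 2).fun_sub
      (((hasDerivAt_id y).fun_div (hasDerivAt_sq_add_sq a y) hne).div_const (4 * a))).fun_sub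
      ((hasDerivAt_arctan_div ha y).div_const (4 * a ^ 2)) |>.congr_deriv ?_
    simp only [id]
    field_simp
    ring
  have hlim : Filter.Tendsto
      (fun y => -((Real.pi - Real.arctan (y / a)) * (a ^ 2 + y ^ 2)⁻¹) / 2 -
        y / (a ^ 2 + y ^ 2) / (4 * a) - Real.arctan (y / a) / (4 * a ^ 2)) Filter.atTop
      (nhds (-((Real.pi - Real.pi / 2) * 0) / 2 - 0 / (4 * a) - Real.pi / 2 / (4 * a ^ 2))) :=
    (((((tendsto_arctan_div ha).const_sub Real.pi).mul (tendsto_inv_sq_add_sq a)).neg.div_const 2).sub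
      ((tendsto_div_sq_add_sq a).div_const (4 * a))).sub ((tendsto_arctan_div ha).div_const (4 * a ^ 2))
  have hpos : ∀ y ∈ Ioi (0 : ℝ), 0 ≤ y * (Real.pi - Real.arctan (y / a)) / (a ^ 2 + y ^ 2) ^ 2 := by
    intro y hy
    have h1 := Real.arctan_lt_pi_div_two (y / a)
    have h2 : 0 ≤ Real.pi - Real.arctan (y / a) := by linarith [Real.pi_pos]
    have h3 : 0 < y := hy
    positivity
  refine ⟨integrableOn_Ioi_deriv_of_nonneg' (fun y _ => hder y) hpos hlim, ?_⟩
  rw [integral_Ioi_of_hasDerivAt_of_nonneg' (fun y _ => hder y) hpos hlim]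
  simp
  field_simp
  ring

theorem arg_eq_pi_sub_arctan {a y : ℝ} (ha : 0 < a) (hy : 0 < y) :
    Complex.arg ((-a : ℝ) + y * Complex.I) = Real.pi - Real.arctan (y / a) := by
  have h1 : ((-a : ℝ) + y * Complex.I : ℂ) = -((a : ℂ) + (-y : ℝ) * Complex.I) := by
    push_cast
    ring
  have hre : 0 < ((a : ℂ) + (-y : ℝ) * Complex.I).re := by simpa using ha
  have h2 : Complex.arg ((a : ℂ) + (-y : ℝ) * Complex.I) = -Real.arctan (y / a) := by
    have h3 := abs_lt.1 (Complex.abs_arg_lt_pi_div_two_iff.2 (Or.inl hre))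
    rw [← Real.arctan_tan h3.1 h3.2, Complex.tan_arg, ← Real.arctan_neg]
    congr 1
    simp [neg_div]
  rw [h1, Complex.arg_neg_eq_arg_add_pi_of_im_neg (by simpa using hy), h2]
  ring

/-! ### Measurability and absolute convergence -/

/-- The heights of the zeros of `ζ` to the right of the critical line or on it. -/
def zeroHeights : Set ℝ := {t | ∃ ρ : ℂ, riemannZeta₁ ρ = 0 ∧ 1 / 2 ≤ ρ.re ∧ ρ.im = t}

theorem countable_zeroHeights : zeroHeights.Countable := by
  have h1 : (riemannZetaZeros).Countable := by
    have h2 : riemannZetaZeros = ⋃ n : ℕ, Metric.closedBall 0 n ∩ riemannZetaZeros := by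
      rw [← iUnion_inter, Metric.iUnion_closedBall_nat, univ_inter]
    rw [h2]
    exact countable_iUnion fun n =>
      ((isCompact_closedBall 0 (n : ℝ)).inter_riemannZetaZeros_finite).countable
  refine (h1.image Complex.im).mono ?_
  rintro t ⟨ρ, h0, -, rfl⟩
  exact ⟨ρ, riemannZeta₁_eq_zero_iff.1 h0, rfl⟩

theorem ae_notMem_zeroHeights : ∀ᵐ t : ℝ, t ∉ zeroHeights :=
  countable_zeroHeights.ae_notMem _

theorem exists_gt_notMem_zeroHeights (N : ℝ) : ∃ T, N < T ∧ T ∉ zeroHeights := by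
  obtain ⟨T, hT, hN⟩ := (countable_zeroHeights.dense_compl ℝ).exists_between (lt_add_one N)
  exact ⟨T, hN.1, hT⟩

theorem im_ne_of_notMem_zeroHeights {b : ℝ} (hb : 1 / 2 ≤ b) {t : ℝ} (ht : t ∉ zeroHeights) (ρ : ℂ)
    (h0 : shiftedZeta b ρ = 0) (hre : 0 ≤ ρ.re) : ρ.im ≠ t := fun h =>
  ht ⟨b + ρ, h0, by simp; linarith, by simpa using h⟩

/-- `zetaArg` is defined by a choice made separately for each t. Off a countable set it agrees with
the imaginary part of one measurable logarithm minus an argument, which also bounds it near t = 0.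
-/
theorem exists_measurable_branch {b : ℝ} (hb : 1 / 2 ≤ b) (hb1 : b < 1) (n : ℝ) :
    ∃ (φ : ℝ → ℝ) (B : ℝ), Measurable φ ∧
      ∀ t ∈ Ioc 0 n, t ∉ zeroHeights → zetaArg b t = φ t ∧ |φ t| ≤ B := by
  obtain ⟨T, hT, hTZ⟩ := exists_gt_notMem_zeroHeights (max n 2)
  have hTn := (le_max_left _ _).trans_lt hT
  have hT2 := (le_max_right _ _).trans_lt hT
  obtain ⟨L, hLm, ⟨B, hB⟩, -, -, -, -, -, -, hL⟩ := exists_log_rect hb hb1 hT2.le (by linarith)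
    (im_ne_of_notMem_zeroHeights hb hTZ)
  refine ⟨fun t => (L ((0 : ℝ) + t * Complex.I)).im - Complex.arg (b + (0 : ℝ) + t * Complex.I - 1),
    B + Real.pi, ?_, fun t ht htZ => ⟨?_, ?_⟩⟩
  · refine (Complex.measurable_im.comp (hLm.comp (by fun_prop))).sub
      (Complex.measurable_arg.comp (by fun_prop))
  · have := hL 0 ⟨le_rfl, by linarith⟩ t ht.1 (ht.2.trans hTn.le)
      (im_ne_of_notMem_zeroHeights hb htZ)
    rwa [add_zero] at this
  · have h1 := abs_le.1 (hB ((0 : ℝ) + t * Complex.I) (by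
      rw [Complex.mem_reProdIm]
      have : 0 ≤ T := by linarith
      simpa [this] using ⟨ht.1.le, ht.2.trans hTn.le⟩))
    have h2 := abs_le.1 (Complex.abs_arg_le_pi (b + (0 : ℝ) + t * Complex.I - 1))
    rw [abs_le]
    constructor <;> linarith [h1.1, h1.2, h2.1, h2.2]

theorem aestronglyMeasurable_zetaArg {b : ℝ} (hb : 1 / 2 ≤ b) (hb1 : b < 1) :
    AEStronglyMeasurable (zetaArg b) (volume.restrict (Ioi 0)) := by
  have hU : Ioi (0 : ℝ) = ⋃ n : ℕ, Ioc 0 (n : ℝ) := by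
    ext x
    simp only [mem_Ioi, mem_iUnion, mem_Ioc]
    exact ⟨fun h => (exists_nat_ge x).imp fun n hn => ⟨h, hn⟩, fun ⟨_, h⟩ => h.1⟩
  rw [hU, aestronglyMeasurable_iUnion_iff]
  intro n
  obtain ⟨φ, B, hφ, h⟩ := exists_measurable_branch hb hb1 n
  refine ⟨φ, hφ.stronglyMeasurable, ?_⟩
  filter_upwards [ae_restrict_mem measurableSet_Ioc, ae_restrict_of_ae ae_notMem_zeroHeights]
    with t h1 h2
  exact (h t h1 h2).1

theorem integrableOn_zetaArg {b : ℝ} (hb : 1 / 2 ≤ b) (hb1 : b < 1) :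
    IntegrableOn (fun t : ℝ => t * zetaArg b t / ((1 - b) ^ 2 + t ^ 2) ^ 2) (Ioi 0) := by
  have ha : 0 < 1 - b := by linarith
  obtain ⟨C, hC, hCb⟩ := exists_horizontal_bounds
  obtain ⟨φ, B, -, hφ⟩ := exists_measurable_branch hb hb1 2
  set K := max B C
  have hK : 0 < K := hC.trans_le (le_max_right _ _)
  -- Boundedness up to height 2 and linear growth beyond it combine into one estimate.
  have hbd : ∀ t : ℝ, 0 < t → t ∉ zeroHeights → |zetaArg b t| ≤ K * (1 + t) := by
    intro t ht htZ
    rcases le_total t 2 with h2 | h2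
    · have h3 := hφ t ⟨ht, h2⟩ htZ
      rw [h3.1]
      calc |φ t| ≤ B := h3.2
        _ ≤ K := le_max_left _ _
        _ ≤ K * (1 + t) := by nlinarith
    · have h3 := (hCb t h2 fun ρ h0 hre him => htZ ⟨ρ, h0, hre, him⟩).1 b ⟨hb, by linarith⟩
      calc |zetaArg b t| ≤ C * t := h3
        _ ≤ K * t := by gcongr; exact le_max_right _ _
        _ ≤ K * (1 + t) := by nlinarith
  refine ((integrable_inv_one_add_sq.const_mul (2 * K / (1 - b) ^ 4)).integrableOn).mono' ?_ ?_
  · refine AEStronglyMeasurable.div₀ ?_ ?_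
    · exact measurable_id.aestronglyMeasurable.mul (aestronglyMeasurable_zetaArg hb hb1)
    · exact Measurable.aestronglyMeasurable (by fun_prop)
  · filter_upwards [ae_restrict_mem measurableSet_Ioi, ae_restrict_of_ae ae_notMem_zeroHeights]
      with t h1 h2
    have ht : 0 < t := h1
    have h3 := hbd t ht h2
    have h4 : (1 - b) ^ 2 * (1 + t ^ 2) ≤ (1 - b) ^ 2 + t ^ 2 := by
      have h : (1 - b) ^ 2 ≤ 1 := by nlinarith
      linarith [mul_le_mul_of_nonneg_right h (sq_nonneg t)]
    have h6 : t * (1 + t) ≤ 2 * (1 + t ^ 2) := by nlinarith [sq_nonneg (t - 1)]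
    have h5 : (1 - b) ^ 4 * (1 + t ^ 2) ^ 2 ≤ ((1 - b) ^ 2 + t ^ 2) ^ 2 := by
      calc (1 - b) ^ 4 * (1 + t ^ 2) ^ 2 = ((1 - b) ^ 2 * (1 + t ^ 2)) ^ 2 := by ring
        _ ≤ _ := by gcongr
    rw [norm_div, norm_mul, Real.norm_eq_abs, Real.norm_eq_abs, Real.norm_eq_abs, abs_of_pos ht,
      abs_of_pos (by positivity : 0 < ((1 - b) ^ 2 + t ^ 2) ^ 2)]
    calc t * |zetaArg b t| / ((1 - b) ^ 2 + t ^ 2) ^ 2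
        ≤ t * (K * (1 + t)) / ((1 - b) ^ 4 * (1 + t ^ 2) ^ 2) := by gcongr
      _ = K / (1 - b) ^ 4 * (t * (1 + t)) / (1 + t ^ 2) ^ 2 := by field_simp
      _ ≤ K / (1 - b) ^ 4 * (2 * (1 + t ^ 2)) / (1 + t ^ 2) ^ 2 := by
        exact div_le_div_of_nonneg_right (mul_le_mul_of_nonneg_left h6 (by positivity))
          (by positivity)
      _ = 2 * K / (1 - b) ^ 4 * (1 + t ^ 2)⁻¹ := by field_simp

/-! ### The four sides of the square and the limit -/

theorem norm_argKernel_le {a T : ℝ} (ha : 0 < a) (ha2 : a ≤ 1 / 2) (hT : 3 ≤ T) {w : ℂ}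
    (hw : T ≤ ‖w‖) : ‖argKernel a w‖ ≤ 2 / T ^ 3 := by
  have hw0 : 0 < ‖w‖ := by linarith
  have h1 : ‖w‖ ^ 2 - a ^ 2 ≤ ‖w ^ 2 - (a : ℂ) ^ 2‖ := by
    have := norm_sub_norm_le (w ^ 2) ((a : ℂ) ^ 2)
    simpa [abs_of_pos ha] using this
  have h2 : 3 / 4 * ‖w‖ ^ 2 ≤ ‖w ^ 2 - (a : ℂ) ^ 2‖ := by nlinarith
  rw [argKernel, norm_div, norm_pow]
  calc ‖w‖ / ‖w ^ 2 - (a : ℂ) ^ 2‖ ^ 2 ≤ ‖w‖ / (3 / 4 * ‖w‖ ^ 2) ^ 2 := by gcongr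
    _ = 16 / 9 / ‖w‖ ^ 3 := by field_simp; norm_num
    _ ≤ 2 / T ^ 3 := by
      gcongr
      norm_num

theorem norm_rectTerm_le {b T B : ℝ} (hb : 1 / 2 ≤ b) (hb1 : b < 1) (hT : 3 ≤ T) {L : ℂ → ℂ} {w : ℂ}
    (hw : T ≤ ‖w‖) (hw2 : ‖w‖ ≤ 2 * T) (hL : Complex.exp (L w) = shiftedZeta b w)
    (hB : |(L w).im| ≤ B) :
    ‖rectTerm b L w‖ ≤ 2 / T ^ 3 * (|Real.log ‖shiftedZeta b w‖| + (B + 2 * T + 1)) := by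
  rw [rectTerm, norm_mul]
  refine mul_le_mul (norm_argKernel_le (by linarith) (by linarith) hT hw) ?_ (norm_nonneg _)
    (by positivity)
  have h1 : (L w).re = Real.log ‖shiftedZeta b w‖ := by
    rw [← hL, Complex.norm_exp, Real.log_exp]
  have h2 := Complex.norm_le_abs_re_add_abs_im (L w)
  have hγ := Real.eulerMascheroniConstant_lt_two_thirds
  have hγ0 := Real.one_half_lt_eulerMascheroniConstant
  have h3 : ‖(Real.eulerMascheroniConstant : ℂ) * (w - (1 - b : ℝ))‖ ≤ 2 * T + 1 := by
    rw [norm_mul, Complex.norm_real, Real.norm_eq_abs, abs_of_pos (by linarith)]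
    have h4 : ‖w - ((1 - b : ℝ) : ℂ)‖ ≤ 2 * T + 1 := by
      refine (norm_sub_le _ _).trans ?_
      rw [Complex.norm_real, Real.norm_eq_abs, abs_of_pos (by linarith)]
      linarith
    nlinarith [norm_nonneg (w - ((1 - b : ℝ) : ℂ))]
  rw [h1] at h2
  linarith [norm_sub_le (L w) ((Real.eulerMascheroniConstant : ℂ) * (w - (1 - b : ℝ)))]

theorem abs_log_norm_riemannZeta₁_le {s : ℂ} (hs : 2 ≤ s.re) :
    |Real.log ‖riemannZeta₁ s‖| ≤ 2 + ‖s‖ := by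
  have hs1 : s ≠ 1 := by
    rintro rfl
    norm_num at hs
  have h1 : 1 ≤ ‖s - 1‖ := by
    have := (le_abs_self _).trans (Complex.abs_re_le_norm (s - 1))
    rw [Complex.sub_re, Complex.one_re] at this
    linarith
  have h2 : ‖s - 1‖ ≤ ‖s‖ + 1 := by simpa using norm_sub_le s 1
  have h3 : 1 / 3 ≤ ‖riemannZeta s‖ :=
    (riemannZeta_re_pos hs).trans ((le_abs_self _).trans (Complex.abs_re_le_norm _))
  have h4 : ‖riemannZeta s‖ ≤ 3 := by
    have h5 := norm_le_norm_sub_add (riemannZeta s) 1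
    have h6 := norm_riemannZeta_sub_one_le hs
    rw [norm_one] at h5
    linarith
  rw [riemannZeta₁_eq_sub_mul_riemannZeta hs1, norm_mul,
    Real.log_mul (by positivity) (by positivity)]
  have h7 := Real.log_nonneg h1
  have h8 := Real.log_le_sub_one_of_pos (show 0 < ‖s - 1‖ by linarith)
  have h9 := Real.log_le_log (by norm_num) h3
  have h10 := Real.log_le_log (by linarith) h4
  have h11 : Real.log (1 / 3) = -Real.log 3 := by rw [one_div, Real.log_inv]
  have h12 := Real.log_le_sub_one_of_pos (show (0 : ℝ) < 3 by norm_num)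
  rw [abs_le]
  constructor <;> linarith [norm_nonneg s]

theorem rectTerm_ofReal_im {b x : ℝ} {L : ℂ → ℂ} (h : (L x).im = 0) : (rectTerm b L x).im = 0 := by
  have h1 : L x = ((L x).re : ℂ) := Complex.ext rfl (by simpa using h)
  rw [rectTerm, argKernel, h1]
  norm_cast

theorem integral_im_eq_zero {f : ℝ → ℂ} {c d : ℝ} (h : ∀ x ∈ uIcc c d, (f x).im = 0) :
    (∫ x in c..d, f x).im = 0 := by
  have h1 : (∫ x in c..d, f x) = ∫ x in c..d, ((f x).re : ℂ) :=
    intervalIntegral.integral_congr fun x hx => Complex.ext rfl (by simpa using h x hx)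
  rw [h1, intervalIntegral.integral_ofReal, Complex.ofReal_im]

/-- The kernel is purely imaginary on the imaginary axis, so the real part of the product sees only
the argument. -/
theorem rectTerm_mul_I_re (b y : ℝ) (L : ℂ → ℂ) :
    (rectTerm b L ((0 : ℝ) + y * Complex.I)).re =
      -(y / ((1 - b) ^ 2 + y ^ 2) ^ 2 * ((L ((0 : ℝ) + y * Complex.I)).im -
        Real.eulerMascheroniConstant * y)) := by
  have h1 : argKernel (1 - b) ((0 : ℝ) + y * Complex.I) =
      ((y / ((1 - b) ^ 2 + y ^ 2) ^ 2 : ℝ) : ℂ) * Complex.I := by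
    have h2 : (((0 : ℝ) + y * Complex.I) ^ 2 - ((1 - b : ℝ) : ℂ) ^ 2) ^ 2 =
        (((1 - b) ^ 2 + y ^ 2 : ℝ) : ℂ) ^ 2 := by
      rw [Complex.ofReal_zero, zero_add, mul_pow, Complex.I_sq]
      push_cast
      ring
    rw [argKernel, h2]
    push_cast
    ring
  rw [rectTerm, h1, mul_assoc, Complex.re_ofReal_mul]
  simp
  ring

/-- The truncated integral over the left side of the rectangle. -/
noncomputable def truncatedIntegral (b T : ℝ) : ℝ :=
  ∫ t in (0 : ℝ)..T, (t * zetaArg b t / ((1 - b) ^ 2 + t ^ 2) ^ 2 +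
    t * (Real.pi - Real.arctan (t / (1 - b))) / ((1 - b) ^ 2 + t ^ 2) ^ 2 -
    Real.eulerMascheroniConstant * (t * t / ((1 - b) ^ 2 + t ^ 2) ^ 2))

theorem integral_left_im {b T : ℝ} (hb : 1 / 2 ≤ b) (hb1 : b < 1) (hT : 0 < T) {L : ℂ → ℂ}
    (hi : IntervalIntegrable (fun y : ℝ => rectTerm b L ((0 : ℝ) + y * Complex.I)) volume 0 T)
    (hL : ∀ t, 0 < t → t ≤ T → (∀ ρ, shiftedZeta b ρ = 0 → 0 ≤ ρ.re → ρ.im ≠ t) →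
      zetaArg b t = (L ((0 : ℝ) + t * Complex.I)).im -
        Complex.arg (b + (0 : ℝ) + t * Complex.I - 1)) :
    (Complex.I * ∫ y : ℝ in (0 : ℝ)..T, rectTerm b L ((0 : ℝ) + y * Complex.I)).im =
      -truncatedIntegral b T := by
  rw [Complex.I_mul_im]
  have h1 := Complex.reCLM.intervalIntegral_comp_comm hi
  simp only [Complex.reCLM_apply] at h1
  rw [← h1, truncatedIntegral, ← intervalIntegral.integral_neg]
  refine intervalIntegral.integral_congr_ae ?_
  filter_upwards [ae_notMem_zeroHeights] with t htZ ht
  rw [uIoc_of_le hT.le] at ht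
  have h2 := hL t ht.1 ht.2 (im_ne_of_notMem_zeroHeights hb htZ)
  have h3 : (b + (0 : ℝ) + t * Complex.I - 1 : ℂ) = ((-(1 - b) : ℝ) : ℂ) + t * Complex.I := by
    push_cast
    ring
  rw [h3, arg_eq_pi_sub_arctan (by linarith) ht.1] at h2
  rw [rectTerm_mul_I_re, h2]
  ring

theorem continuousOn_log_norm_riemannZeta₁ {T : ℝ} (hT : T ∉ zeroHeights) :
    ContinuousOn (fun σ : ℝ => |Real.log ‖riemannZeta₁ (σ + T * Complex.I)‖|) (Ici (1 / 2)) := by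
  refine (ContinuousOn.log ?_ fun σ hσ => ?_).abs
  · exact (differentiable_riemannZeta₁.continuous.comp (by fun_prop)).norm.continuousOn
  · exact norm_ne_zero_iff.2 fun h => hT ⟨_, h, by simpa using hσ, by simp⟩

theorem norm_integral_top_le {b T C : ℝ} (hb : 1 / 2 ≤ b) (hb1 : b < 1) (hT : 3 ≤ T)
    (hTZ : T ∉ zeroHeights) (hC : 0 < C) (hC1 : ∀ σ ∈ Icc (1 / 2 : ℝ) 2, |zetaArg σ T| ≤ C * T)
    (hC2 : (∫ σ in (1 / 2 : ℝ)..2, |Real.log ‖riemannZeta₁ (σ + T * Complex.I)‖|) ≤ C * T)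
    {L : ℂ → ℂ}
    (hexp : ∀ w ∈ Icc 0 T ×ℂ Icc 0 T, shiftedZeta b w ≠ 0 → Complex.exp (L w) = shiftedZeta b w)
    (hL : ∀ x ∈ Icc 0 T, zetaArg (b + x) T =
      (L (x + T * Complex.I)).im - Complex.arg (b + x + T * Complex.I - 1)) :
    ‖∫ x : ℝ in (0 : ℝ)..T, rectTerm b L (x + T * Complex.I)‖ ≤ (4 * C + 40) / T := by
  set G := fun σ : ℝ => |Real.log ‖riemannZeta₁ (σ + T * Complex.I)‖|
  have hG := continuousOn_log_norm_riemannZeta₁ hTZ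
  have hGi : ∀ {c d : ℝ}, 1 / 2 ≤ c → 1 / 2 ≤ d → IntervalIntegrable G volume c d := fun hc hd =>
    (hG.mono fun x hx => le_trans (le_min hc hd) hx.1).intervalIntegrable
  have hT0 : 0 < T := by linarith
  have hpi := Real.pi_lt_d2
  have hpt : ∀ x ∈ Ioc 0 T, ‖rectTerm b L (x + T * Complex.I)‖ ≤
      2 / T ^ 3 * (G (x + b) + (C * T + 7 + 2 * T + 1)) := by
    intro x hx
    have hx' : x ∈ Icc 0 T := ⟨hx.1.le, hx.2⟩
    have hf : shiftedZeta b (x + T * Complex.I) ≠ 0 := fun h =>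
      im_ne_of_notMem_zeroHeights hb hTZ _ h (by simpa using hx'.1) (by simp)
    have hw : (x + T * Complex.I : ℂ) ∈ Icc 0 T ×ℂ Icc 0 T := by
      rw [Complex.mem_reProdIm]
      simpa [hT0.le] using hx'
    have hn1 : T ≤ ‖(x + T * Complex.I : ℂ)‖ := by
      have := Complex.abs_im_le_norm (x + T * Complex.I : ℂ)
      simpa [abs_of_pos hT0] using this
    have hn2 : ‖(x + T * Complex.I : ℂ)‖ ≤ 2 * T := by
      refine (norm_add_le _ _).trans ?_
      rw [norm_mul, Complex.norm_I, Complex.norm_real, Complex.norm_real, Real.norm_eq_abs,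
        Real.norm_eq_abs, abs_of_pos hT0, abs_of_pos hx.1]
      linarith [hx.2]
    -- To the right of 2 the argument is principal, hence at most π < 3.15.
    have hz : |zetaArg (b + x) T| ≤ C * T + 3.15 := by
      rcases le_total (b + x) 2 with h | h
      · linarith [hC1 (b + x) ⟨by linarith [hx.1], h⟩]
      · rw [zetaArg_eq_arg h]
        have := Complex.abs_arg_le_pi (riemannZeta ((b + x : ℝ) + T * Complex.I))
        have := mul_pos hC hT0
        linarith
    have him : |(L (x + T * Complex.I)).im| ≤ C * T + 7 := by
      have h1 := hL x hx'
      have h2 := abs_le.1 (Complex.abs_arg_le_pi (b + x + T * Complex.I - 1))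
      have h3 := abs_le.1 hz
      rw [abs_le]
      constructor <;> linarith [h2.1, h2.2, h3.1, h3.2]
    refine (norm_rectTerm_le hb hb1 hT hn1 hn2 (hexp _ hw hf) him).trans_eq ?_
    have : shiftedZeta b (x + T * Complex.I) = riemannZeta₁ ((x + b : ℝ) + T * Complex.I) := by
      rw [shiftedZeta]
      congr 1
      push_cast
      ring
    rw [this]
  have hGb : IntervalIntegrable (fun x => G (x + b)) volume 0 T := by
    have := (hGi (c := 0 + b) (d := T + b) (by linarith) (by linarith)).comp_add_right b
    simpa using this
  refine (intervalIntegral.norm_integral_le_of_norm_le hT0.le (Filter.Eventually.of_forall hpt)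
    ((hGb.add intervalIntegrable_const).const_mul _)).trans ?_
  rw [intervalIntegral.integral_const_mul, intervalIntegral.integral_add hGb intervalIntegrable_const,
    intervalIntegral.integral_comp_add_right, intervalIntegral.integral_const, sub_zero, smul_eq_mul,
    zero_add]
  have h1 : (∫ x in b..T + b, G x) ≤ C * T + T * (5 + 2 * T) := by
    rw [← intervalIntegral.integral_add_adjacent_intervals (hGi hb (by norm_num : (1 / 2 : ℝ) ≤ 2))
      (hGi (by norm_num) (by linarith))]
    have h2 : (∫ x in b..2, G x) ≤ C * T := by
      rw [← intervalIntegral.integral_add_adjacent_intervals (hGi le_rfl hb)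
        (hGi hb (by norm_num : (1 / 2 : ℝ) ≤ 2))] at hC2
      have : 0 ≤ ∫ x in (1 / 2)..b, G x :=
        intervalIntegral.integral_nonneg hb fun x _ => abs_nonneg _
      linarith
    have h3 : (∫ x in (2 : ℝ)..T + b, G x) ≤ ∫ x in (2 : ℝ)..T + b, (3 + 2 * T + 1 : ℝ) := by
      refine intervalIntegral.integral_mono_on (by linarith) (hGi (by norm_num) (by linarith))
        intervalIntegrable_const fun x hx => ?_
      refine (abs_log_norm_riemannZeta₁_le (by simpa using hx.1)).trans ?_
      have : ‖(x + T * Complex.I : ℂ)‖ ≤ x + T := by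
        refine (norm_add_le _ _).trans ?_
        rw [norm_mul, Complex.norm_I, Complex.norm_real, Complex.norm_real, Real.norm_eq_abs,
          Real.norm_eq_abs, abs_of_pos hT0, abs_of_pos (by linarith [hx.1]), mul_one]
      linarith [hx.2]
    rw [intervalIntegral.integral_const, smul_eq_mul] at h3
    nlinarith
  calc 2 / T ^ 3 * ((∫ x in b..T + b, G x) + T * (C * T + 7 + 2 * T + 1))
      ≤ 2 / T ^ 3 * ((C * T + T * (5 + 2 * T)) + T * (C * T + 7 + 2 * T + 1)) := by gcongr
    _ = 2 / T ^ 2 * (C + C * T + 13 + 4 * T) := by field_simp; ring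
    _ ≤ 2 / T ^ 2 * ((2 * C + 20) * T) := by
      gcongr
      nlinarith
    _ = (4 * C + 40) / T := by field_simp; ring

theorem norm_integral_right_le {b T : ℝ} (hb : 1 / 2 ≤ b) (hb1 : b < 1) (hT : 3 ≤ T) {L : ℂ → ℂ}
    (hexp : ∀ w ∈ Icc 0 T ×ℂ Icc 0 T, shiftedZeta b w ≠ 0 → Complex.exp (L w) = shiftedZeta b w)
    (hL : ∀ t, 0 < t → t ≤ T → (∀ ρ, shiftedZeta b ρ = 0 → 0 ≤ ρ.re → ρ.im ≠ t) →
      zetaArg (b + T) t = (L (T + t * Complex.I)).im - Complex.arg (b + T + t * Complex.I - 1)) :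
    ‖∫ y : ℝ in (0 : ℝ)..T, rectTerm b L (T + y * Complex.I)‖ ≤ 20 / T := by
  have hT0 : 0 < T := by linarith
  have hpi := Real.pi_lt_d2
  have hpt : ∀ᵐ y : ℝ, y ∈ Ioc 0 T → ‖rectTerm b L (T + y * Complex.I)‖ ≤
      2 / T ^ 3 * ((3 + 2 * T) + (7 + 2 * T + 1)) := by
    filter_upwards [ae_notMem_zeroHeights] with y hyZ hy
    have hf : shiftedZeta b (T + y * Complex.I) ≠ 0 := fun h =>
      im_ne_of_notMem_zeroHeights hb hyZ _ h (by simpa using hT0.le) (by simp)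
    have hw : (T + y * Complex.I : ℂ) ∈ Icc 0 T ×ℂ Icc 0 T := by
      rw [Complex.mem_reProdIm]
      simpa [hT0.le] using ⟨hy.1.le, hy.2⟩
    have hn1 : T ≤ ‖(T + y * Complex.I : ℂ)‖ := by
      have := Complex.abs_re_le_norm (T + y * Complex.I : ℂ)
      simpa [abs_of_pos hT0] using this
    have hn2 : ‖(T + y * Complex.I : ℂ)‖ ≤ 2 * T := by
      refine (norm_add_le _ _).trans ?_
      rw [norm_mul, Complex.norm_I, Complex.norm_real, Complex.norm_real, Real.norm_eq_abs,
        Real.norm_eq_abs, abs_of_pos hT0, abs_of_pos hy.1]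
      linarith [hy.2]
    have him : |(L (T + y * Complex.I)).im| ≤ 7 := by
      have h1 := hL y hy.1 hy.2 (im_ne_of_notMem_zeroHeights hb hyZ)
      rw [zetaArg_eq_arg (by linarith)] at h1
      have h2 := abs_le.1 (Complex.abs_arg_le_pi (b + T + y * Complex.I - 1))
      have h3 := abs_le.1 (Complex.abs_arg_le_pi (riemannZeta ((b + T : ℝ) + y * Complex.I)))
      rw [abs_le]
      constructor <;> linarith [h2.1, h2.2, h3.1, h3.2]
    refine (norm_rectTerm_le hb hb1 hT hn1 hn2 (hexp _ hw hf) him).trans ?_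
    gcongr
    refine (abs_log_norm_riemannZeta₁_le (by simp; linarith)).trans ?_
    have := norm_add_le (b : ℂ) (T + y * Complex.I)
    rw [Complex.norm_real, Real.norm_eq_abs, abs_of_pos (by linarith)] at this
    linarith
  refine (intervalIntegral.norm_integral_le_of_norm_le hT0.le hpt intervalIntegrable_const).trans ?_
  rw [intervalIntegral.integral_const, smul_eq_mul, sub_zero]
  calc T * (2 / T ^ 3 * ((3 + 2 * T) + (7 + 2 * T + 1))) = 2 / T ^ 2 * (11 + 4 * T) := by
        field_simp; ring
    _ ≤ 2 / T ^ 2 * (10 * T) := by gcongr; linarith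
    _ = 20 / T := by field_simp; ring

/-- V is the imaginary part of the boundary integral. The bottom side adds nothing to it, and the
top and right sides make up the error. -/
theorem exists_truncatedIntegral_approx {b : ℝ} (hb : 1 / 2 ≤ b) (hb1 : b < 1) :
    ∃ E : ℝ, ∀ T : ℝ, 3 ≤ T → T ∉ zeroHeights → ∃ V : ℝ, |V - truncatedIntegral b T| ≤ E / T ∧
      ((∀ ρ, shiftedZeta b ρ = 0 → ρ.re ≤ 0) → V = 0) ∧
      (∀ ρ, shiftedZeta b ρ = 0 → 0 ≤ ρ.re → 0 < ρ.im → ρ.im < T →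
        (Real.pi * Complex.I * (1 / (ρ ^ 2 - ((1 - b : ℝ) : ℂ) ^ 2) +
          1 / ((ρ.im : ℂ) ^ 2 + (1 - b : ℝ) ^ 2))).im ≤ V) := by
  obtain ⟨C, hC, hCb⟩ := exists_horizontal_bounds
  refine ⟨(4 * C + 40) + 20, fun T hT hTZ => ?_⟩
  have hT0 : 0 < T := by linarith
  obtain ⟨hC1, hC2⟩ := hCb T (by linarith) fun ρ h0 hre him => hTZ ⟨ρ, h0, hre, him⟩
  have hno := im_ne_of_notMem_zeroHeights hb hTZ
  obtain ⟨L, -, -, hi, -, hz, hz', hbot, hexp, hL⟩ :=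
    exists_log_rect hb hb1 (by linarith : 2 ≤ T) hT0 hno
  refine ⟨(rectIntegral T 0 T (rectTerm b L)).im, ?_, hz, hz'⟩
  have htop := norm_integral_top_le hb hb1 hT hTZ hC hC1 hC2 hexp fun x hx =>
    hL x hx T hT0 le_rfl hno
  have hright := norm_integral_right_le hb hb1 hT hexp (hL T ⟨hT0.le, le_rfl⟩)
  have hleft := integral_left_im hb hb1 hT0 hi.left fun t h1 h2 h3 => by
    have := hL 0 ⟨le_rfl, hT0.le⟩ t h1 h2 h3
    rwa [add_zero] at this
  have hb0 : (∫ x : ℝ in (0 : ℝ)..T, rectTerm b L (x + (0 : ℝ) * Complex.I)).im = 0 := by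
    refine integral_im_eq_zero fun x hx => ?_
    rw [uIcc_of_le hT0.le] at hx
    have := rectTerm_ofReal_im (b := b) (hbot x hx)
    simpa using this
  have h1 := (Complex.abs_im_le_norm _).trans htop
  have h2 := (Complex.abs_re_le_norm _).trans hright
  have h3 : (rectIntegral T 0 T (rectTerm b L)).im - truncatedIntegral b T =
      -(∫ x : ℝ in (0 : ℝ)..T, rectTerm b L (x + T * Complex.I)).im +
        (∫ y : ℝ in (0 : ℝ)..T, rectTerm b L (T + y * Complex.I)).re := by
    rw [rectIntegral, Complex.sub_im, hleft, Complex.add_im, Complex.sub_im, hb0, Complex.I_mul_im]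
    ring
  rw [h3, add_div]
  refine (abs_add_le _ _).trans ?_
  rw [abs_neg]
  exact add_le_add h1 h2

theorem tendsto_truncatedIntegral {b : ℝ} (hb : 1 / 2 ≤ b) (hb1 : b < 1) :
    Filter.Tendsto (truncatedIntegral b) Filter.atTop
      (nhds ((∫ t in Ioi (0 : ℝ), t * zetaArg b t / ((1 - b) ^ 2 + t ^ 2) ^ 2) +
        3 * Real.pi / (8 * (1 - b) ^ 2) -
        Real.eulerMascheroniConstant * (Real.pi / (4 * (1 - b))))) := by
  have ha : 0 < 1 - b := by linarith
  obtain ⟨i1, e1⟩ := integral_sq_div ha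
  obtain ⟨i2, e2⟩ := integral_arg_div ha
  have i3 := integrableOn_zetaArg hb hb1
  have i1' := i1.const_mul Real.eulerMascheroniConstant
  have h := intervalIntegral_tendsto_integral_Ioi 0 ((i3.add i2).sub i1') Filter.tendsto_id
  rw [integral_sub' (i3.add i2) i1', integral_add' i3 i2, integral_const_mul, e1, e2] at h
  exact h

/-- The limit of the truncated integrals detects the zeros to the right of `b`. -/
theorem limit_eq_zero_iff {b : ℝ} (hb : 1 / 2 ≤ b) (hb1 : b < 1) {l : ℝ}
    (hl : Filter.Tendsto (truncatedIntegral b) Filter.atTop (nhds l)) :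
    l = 0 ↔ ¬ ∃ s : ℂ, riemannZeta s = 0 ∧ b < s.re := by
  obtain ⟨E, hE⟩ := exists_truncatedIntegral_approx hb hb1
  choose T hT hTZ using fun n : ℕ => exists_gt_notMem_zeroHeights (n + 3)
  have hT3 : ∀ n, 3 ≤ T n := fun n => by
    have : (0 : ℝ) ≤ n := n.cast_nonneg
    linarith [hT n]
  have hTlim : Filter.Tendsto T Filter.atTop Filter.atTop :=
    Filter.tendsto_atTop_mono (fun n => by linarith [hT n]) tendsto_natCast_atTop_atTop
  choose V hV hV0 hVρ using fun n => hE (T n) (hT3 n) (hTZ n)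
  have hVl : Filter.Tendsto V Filter.atTop (nhds l) := by
    have h1 : Filter.Tendsto (fun n => V n - truncatedIntegral b (T n)) Filter.atTop (nhds 0) :=
      squeeze_zero_norm hV (hTlim.const_div_atTop E)
    have h2 := h1.add (hl.comp hTlim)
    simpa using h2
  constructor
  · rintro rfl ⟨s, hs, hre⟩
    -- One zero to the right of b in the upper half plane keeps all but finitely many V n above a
    -- fixed positive number, against the limit 0.
    have key : ∀ ρ : ℂ, shiftedZeta b ρ = 0 → 0 < ρ.re → ¬ 0 < ρ.im := by
      intro ρ h0 hre him
      have h1 := shiftedZeta_zero_bounds hb h0 hre.le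
      have h2 := (zero_excess (a := 1 - b) (by linarith) him h1.2.2).2.1 hre
      refine h2.not_ge (ge_of_tendsto hVl ?_)
      filter_upwards [hTlim.eventually_gt_atTop ρ.im] with n hn
      exact hVρ n ρ h0 hre.le him hn
    have hs1 : riemannZeta₁ s = 0 := riemannZeta₁_eq_zero_iff.2 hs
    have h0 : shiftedZeta b (s - b) = 0 := by simpa [shiftedZeta] using hs1
    -- Zeros come in conjugate pairs and are not real, so one of the pair lies in the upper half
    -- plane.
    have h0' : shiftedZeta b (starRingEnd ℂ s - b) = 0 := by
      rw [shiftedZeta, add_sub_cancel, riemannZeta₁_conj, hs1, map_zero]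
    have h1 := (shiftedZeta_zero_bounds hb h0 (by simp; linarith)).2.1
    have h2 := key _ h0 (by simpa using hre)
    have h3 := key _ h0' (by simpa using hre)
    simp at h1 h2 h3
    exact h1 (le_antisymm h2 h3)
  · intro h
    refine tendsto_nhds_unique hVl ?_
    have : V = fun _ => 0 := funext fun n => hV0 n fun ρ h0 => by
      by_contra hre
      exact h ⟨b + ρ, riemannZeta₁_eq_zero_iff.1 h0, by simpa using hre⟩
    rw [this]
    exact tendsto_const_nhds

/-- The functional equation reflects a zero left of the critical line to the right of it, unless the
cosine factor vanishes; those exceptions are the trivial zeros. -/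
theorem riemannHypothesis_iff :
    RiemannHypothesis ↔ ¬ ∃ s : ℂ, riemannZeta s = 0 ∧ 1 / 2 < s.re := by
  constructor
  · rintro h ⟨s, hs, hre⟩
    refine hre.ne' (h s hs ?_ ?_)
    · rintro ⟨n, rfl⟩
      have : (-2 * ((n : ℂ) + 1)).re = -2 * ((n : ℝ) + 1) := by simp
      rw [this] at hre
      have : (0 : ℝ) ≤ n := n.cast_nonneg
      linarith
    · rintro rfl
      exact riemannZeta_one_ne_zero hs
  · intro h s hs htriv h1
    rcases lt_trichotomy s.re (1 / 2) with hlt | heq | hgt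
    · exfalso
      have hure : 1 / 2 < (1 - s).re := by
        rw [Complex.sub_re, Complex.one_re]
        linarith
      have hu1 : 1 - s ≠ 1 := by
        intro h0
        have : s = 0 := by linear_combination -h0
        rw [this, riemannZeta_zero] at hs
        norm_num at hs
      have huN : ∀ n : ℕ, 1 - s ≠ -n := by
        intro n hn
        rw [hn] at hure
        have : (0 : ℝ) ≤ n := n.cast_nonneg
        simp at hure
        linarith
      have hζ : riemannZeta (1 - s) ≠ 0 := fun h0 => h ⟨_, h0, hure⟩
      have hfe := riemannZeta_one_sub huN hu1
      rw [sub_sub_cancel, hs] at hfe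
      have hpi : (2 * (Real.pi : ℂ)) ^ (-(1 - s)) ≠ 0 := by
        rw [Complex.cpow_ne_zero_iff]
        left
        exact_mod_cast (by positivity : 2 * Real.pi ≠ 0)
      have hΓ : Complex.Gamma (1 - s) ≠ 0 := Complex.Gamma_ne_zero huN
      have hcos : Complex.cos (Real.pi * (1 - s) / 2) = 0 := by
        simpa [hpi, hΓ, hζ] using hfe.symm
      obtain ⟨k, hk⟩ := Complex.cos_eq_zero_iff.1 hcos
      have hpi0 : (Real.pi : ℂ) ≠ 0 := by exact_mod_cast Real.pi_ne_zero
      -- The vanishing of the cosine gives s = -2k; k ≥ 1 then follows from 1 - s ≠ 1 and Re(1 - s)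
      -- > 1/2.
      have hk' : 1 - s = 2 * k + 1 := by
        field_simp at hk
        exact hk
      have hk1 : 0 < k := by
        have h2 : (1 / 2 : ℝ) < 2 * k + 1 := by
          rw [hk'] at hure
          simpa using hure
        have h3 : k ≠ 0 := by
          rintro rfl
          exact hu1 (by simpa using hk')
        have h4 : -1 < k := by
          have : (-1 : ℝ) < k := by linarith
          exact_mod_cast this
        omega
      obtain ⟨n, rfl⟩ := Int.eq_succ_of_zero_lt hk1
      refine htriv ⟨n, ?_⟩
      push_cast at hk'
      linear_combination -hk'
    · exact heq
    · exact absurd ⟨s, hs, hgt⟩ h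

theorem integral_zetaArg_eq_iff {b : ℝ} (hb : 1 / 2 ≤ b) (hb1 : b < 1) :
    (∫ t in Ioi (0 : ℝ), t * zetaArg b t / ((1 - b) ^ 2 + t ^ 2) ^ 2) =
        Real.pi / (4 * (1 - b)) * (Real.eulerMascheroniConstant - 3 / (2 * (1 - b))) ↔
      ¬ ∃ s : ℂ, riemannZeta s = 0 ∧ b < s.re := by
  rw [← limit_eq_zero_iff hb hb1 (tendsto_truncatedIntegral hb hb1)]
  have ha : 1 - b ≠ 0 := by linarith
  have h : Real.pi / (4 * (1 - b)) * (Real.eulerMascheroniConstant - 3 / (2 * (1 - b))) =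
      Real.eulerMascheroniConstant * (Real.pi / (4 * (1 - b))) -
        3 * Real.pi / (8 * (1 - b) ^ 2) := by
    field_simp
    ring
  rw [h]
  constructor <;> intro h <;> linarith

theorem mainTheorem4 :
    (∀ b : ℝ, 1 / 2 ≤ b → b < 1 →
      IntegrableOn (fun t : ℝ => t * zetaArg b t / ((1 - b) ^ 2 + t ^ 2) ^ 2) (Ioi 0) volume ∧
      ((∫ t in Ioi (0 : ℝ), t * zetaArg b t / ((1 - b) ^ 2 + t ^ 2) ^ 2) =
          Real.pi / (4 * (1 - b)) * (Real.eulerMascheroniConstant - 3 / (2 * (1 - b))) ↔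
        ¬ ∃ s : ℂ, riemannZeta s = 0 ∧ b < s.re)) ∧
    ((∫ t in Ioi (0 : ℝ), t * zetaArg (1 / 2) t / ((1 - 1 / 2) ^ 2 + t ^ 2) ^ 2) =
        Real.pi / (4 * (1 - 1 / 2)) * (Real.eulerMascheroniConstant - 3 / (2 * (1 - 1 / 2))) ↔
      RiemannHypothesis) ∧
    (1 / Real.pi * (∫ t in Ioi (0 : ℝ), 2 * t * zetaArg (1 / 2) t / (1 / 4 + t ^ 2) ^ 2) =
        Real.eulerMascheroniConstant - 3 ↔
      RiemannHypothesis) := by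
  have hhalf := (integral_zetaArg_eq_iff le_rfl one_half_lt_one).trans riemannHypothesis_iff.symm
  refine ⟨fun b hb hb1 => ⟨integrableOn_zetaArg hb hb1, integral_zetaArg_eq_iff hb hb1⟩, hhalf, ?_⟩
  rw [← hhalf]
  have h : (∫ t in Ioi (0 : ℝ), 2 * t * zetaArg (1 / 2) t / (1 / 4 + t ^ 2) ^ 2) =
      2 * ∫ t in Ioi (0 : ℝ), t * zetaArg (1 / 2) t / ((1 - 1 / 2) ^ 2 + t ^ 2) ^ 2 := by
    rw [← integral_const_mul]
    congr 1 with t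
    norm_num
    ring
  rw [h]
  generalize (∫ t in Ioi (0 : ℝ), t * zetaArg (1 / 2) t / ((1 - 1 / 2) ^ 2 + t ^ 2) ^ 2) = I
  have hpi := Real.pi_pos
  field_simp
  constructor <;> intro h <;> linarith
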